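/- **Setting.** Let $\mathsf M(p|q)$, $p+q\ge 1$, be the algebra of $(p+q)\times(p+q)$ complex matrices with the $\mathbb Z_2$-grading for which block-diagonal matrices are even and block-off-diagonal ones odd (the CAR algebra of $d\geq 1$ modes is $\mathsf M(2^{d-1}|2^{d-1})$). For $\mathbb G=\mathbb Z^s$ or $\mathbb G=\mathbb Z_n^s$ with a copy $\mathsf A_x$ of $\mathsf M(p|q)$ at each site, let $\mathsf A(\Lambda)=\boxtimes_{x\in\Lambda}\mathsf A_x$ (graded tensor product) for finite $\Lambda$, and let $\mathsf A(\mathbb G)$ be the quasi-local $C^*$-algebra, the norm completion of $\bigcup_\Lambda\mathsf A(\Lambda)$. An FCA is a parity-preserving $*$-automorphism $T$ of $\mathsf A(\mathbb G)$ that commutes with all lattice shifts and has a finite neighbourhood scheme $\mathcal N$, i.e. $T(\mathsf A(\Lambda))\subseteq\mathsf A(\Lambda+\mathcal N)$ for all finite $\Lambda$. Let $\varphi_n:\mathbb Z^s\to\mathbb Z_n^s$ be reduction mod $n$ and $\mathcal N_x=x+\mathcal N$. An FCA $T_w$ on $\mathbb Z_n^s$ is a *wrapping* of an FCA $T$ on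 $\mathbb Z^s$ if, for some neighbourhood scheme $\mathcal N$ of $T$ on which $\varphi_n$ is injective, $T_w|_{\mathsf A_0}$ is $T|_{\mathsf A_0}:\mathsf A_0\to\mathsf A(\mathcal N)$ followed by the relabelling of sites $\mathsf A(\mathcal N)\cong\mathsf A(\varphi_n(\mathcal N))$. Let $N\ge1$, $\Lambda_0=[0,N-1]^s$ and $\Lambda_x=\Lambda_0+Nx$. For $m\ge1$, $\mathbb L=\mathbb Z_{Nm}^s$ is called a *regular wrapping* for $T^N$ (with respect to a neighbourhood scheme $\mathcal N$ of $T^N$) if $$\varphi_{Nm}^{-1}\big(\varphi_{Nm}(\mathcal N_x)\cap\varphi_{Nm}(\mathcal N_y)\big)\cap(\mathcal N_x\cup\mathcal N_y)=\mathcal N_x\cap\mathcal N_y\quad\text{whenever }\mathcal N_x\cap\mathcal N_y\ne\emptyset ,$$ and if moreover distinct tiles meeting $\Lambda_0+\mathcal N$ stay distinct in $\mathbb L$, i.e. $\varphi_m$ is injective on $\mathcal N'=\{y:\Lambda_y\cap(\Lambda_0+\mathcal N)\ne\emptyset\}$. Let $\Pi_{\Lambda_0}\in\mathsf A(\Lambda_0)$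 be a nonzero (even) projection, of rank $r$. A tile isometry is an injective parity-preserving $*$-homomorphism $E_0$ from a cell algebra $\mathsf A'_0=\mathsf M(p'|q')$, $p'+q'=r$, onto $\Pi_{\Lambda_0}\mathsf A(\Lambda_0)\Pi_{\Lambda_0}$. On $\mathbb L=\mathbb Z_{Nm}^s$ with coarse-grained lattice $\mathbb L'=\mathbb Z_m^s$ put $\Pi=\boxtimes_{x\in\mathbb L'}\Pi_{\Lambda_x}$ and $\mathcal P(O)=\Pi O\Pi$, where $\Pi_{\Lambda_x}$ are the translated copies of $\Pi_{\Lambda_0}$. Let $E=\boxtimes_x E_x:\mathsf A'(\mathbb L')\to\mathsf A(\mathbb L)$ be the product of the translated copies of $E_0$, a $*$-isomorphism onto $\Pi\mathsf A(\mathbb L)\Pi$, and let $E^\dagger=E^{-1}\circ\mathcal P$, so that $E^\dagger E=\mathrm{id}$ and $EE^\dagger=\mathcal P$. An FCA $S$ on the lattice $\mathbb Z^s$ with cell algebra $\mathsf A'_0$ is an $(N,\Pi_{\Lambda_0})$-*renormalisation* of $T$ (by means of $E_0$) if for every regular wrapping $\mathbb L=\mathbb Z_{Nm}^s$ for $T^N$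 one has $T^N_w\circ E=E\circ S_w$, where $T^N_w$ and $S_w$ are wrappings of $T^N$ and $S$ on $\mathbb L$ and $\mathbb L'$. $T$ is $(N,\Pi_{\Lambda_0})$-*renormalisable* if it has such a renormalisation for some tile isometry. **Theorem.** Let $T$ be an FCA on $\mathbb Z^s$, $N\ge1$, and $\Pi_{\Lambda_0}$ a nonzero projection of $\mathsf A(\Lambda_0)$. 1. $T$ is $(N,\Pi_{\Lambda_0})$-renormalisable if and only if there is a regular wrapping $\mathbb L=\mathbb Z_{Nm}^s$ for $T^N$ with $T^N_w(\Pi)=\Pi$. 2. On every regular wrapping, $T^N$ has a unique wrapping $T^N_w$, which is implemented as $T_w^N(O)=U^\dagger OU$ by a unitary $U\in\mathsf A(\mathbb L)$ of definite parity; and, for every unitary $U=U_{T^N}$ implementing it, $$\mathcal P\circ T^N_w=T^N_w\circ\mathcal P\iff T^N_w(\Pi)=\Pi\iff[U_{T^N},\Pi]=0 .$$ 3. The condition does not depend on the regular wrapping: if it holds on one, it holds on all. 4. If $T$ is $(N,\Pi_{\Lambda_0})$-renormalisable then, for every tile isometry $E_0$, there is exactly one renormalisation $S$ of $T$ by means of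 $E_0$. For every regular wrapping with respect to a neighbourhood scheme $\mathcal N$ of $T^N$, $S$ has the neighbourhood scheme $\mathcal N'$, the induced map $S_w=E^\dagger\circ T^N_w\circ E$ is a wrapping of $S$ on $\mathbb L'$, and $S$ is the only FCA on the quasi-local algebra $\mathsf A'(\mathbb Z^s)$ with neighbourhood scheme $\mathcal N'$ that has $S_w$ as a wrapping. -/

import Mathlib

open scoped Pointwise

set_option linter.unusedSectionVars false

noncomputable section

namespace FermionicCA

/-! ### Graded local algebras

A cell algebra is the `ℤ₂`-graded matrix algebra `M(p|q)`. It is given by a finite index type `κ`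
together with a parity `π : κ → ZMod 2`: the matrix unit `|i⟩⟨j|` has parity `π i + π j`. The CAR
algebra of `d` modes is the case `κ = Fin d → ZMod 2` with `π a = ∑ k, a k`. -/

/-- The sign `(-1)^p`. -/
def sgn (p : ZMod 2) : ℂ := if p = 0 then 1 else -1

section LocalAlgebra

variable {κ : Type} [Fintype κ] [DecidableEq κ]

/-- The relations of the graded tensor product of copies of the cell algebra, one for each site of
`G`; the generator `(x, i, j)` is the matrix unit `|i⟩⟨j|` at the site `x`. -/
inductive LocalRel (π : κ → ZMod 2) (G : Type) :
    FreeAlgebra ℂ (G × κ × κ) → FreeAlgebra ℂ (G × κ × κ) → Prop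
  | mul (x : G) (i j k l : κ) :
      LocalRel π G (FreeAlgebra.ι ℂ (x, i, j) * FreeAlgebra.ι ℂ (x, k, l))
        (if j = k then FreeAlgebra.ι ℂ (x, i, l) else 0)
  | one (x : G) : LocalRel π G (∑ i, FreeAlgebra.ι ℂ (x, i, i)) 1
  | comm (x y : G) (hxy : x ≠ y) (i j k l : κ) :
      LocalRel π G (FreeAlgebra.ι ℂ (x, i, j) * FreeAlgebra.ι ℂ (y, k, l))
        (sgn ((π i + π j) * (π k + π l)) •
          (FreeAlgebra.ι ℂ (y, k, l) * FreeAlgebra.ι ℂ (x, i, j)))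

/-- The local algebra `A^loc(G)`: the algebraic graded tensor product of the cell algebras over the
sites of `G`. For a finite region `Λ` of a lattice, `A(Λ)` is `LocalAlgebra π Λ`. -/
abbrev LocalAlgebra (π : κ → ZMod 2) (G : Type) : Type := RingQuot (LocalRel π G)

/-- The matrix unit `|i⟩⟨j|` of the cell at `x`. -/
def cellUnit (π : κ → ZMod 2) {G : Type} (x : G) (i j : κ) : LocalAlgebra π G :=
  RingQuot.mkAlgHom ℂ (LocalRel π G) (FreeAlgebra.ι ℂ (x, i, j))

variable {π : κ → ZMod 2}

theorem cellUnit_mul {G : Type} (x : G) (i j k l : κ) :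
    cellUnit π x i j * cellUnit π x k l = if j = k then cellUnit π x i l else 0 := by
  have h := RingQuot.mkAlgHom_rel ℂ (LocalRel.mul (π := π) x i j k l)
  rw [map_mul] at h
  unfold cellUnit
  rw [h]
  split_ifs <;> simp

theorem sum_cellUnit {G : Type} (x : G) : ∑ i, cellUnit π x i i = 1 := by
  have h := RingQuot.mkAlgHom_rel ℂ (LocalRel.one (π := π) x)
  rw [map_sum, map_one] at h
  exact h

theorem cellUnit_comm {G : Type} {x y : G} (hxy : x ≠ y) (i j k l : κ) :
    cellUnit π x i j * cellUnit π y k l =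
      sgn ((π i + π j) * (π k + π l)) • (cellUnit π y k l * cellUnit π x i j) := by
  have h := RingQuot.mkAlgHom_rel ℂ (LocalRel.comm (π := π) x y hxy i j k l)
  rw [map_smul, map_mul, map_mul] at h
  exact h

/-- Universal property: a family of systems of matrix units in an algebra which graded-commute at
distinct sites. -/
def LocalAlgebra.lift {G : Type} {B : Type*} [Ring B] [Algebra ℂ B] (e : G → κ → κ → B)
    (hmul : ∀ x i j k l, e x i j * e x k l = if j = k then e x i l else 0)
    (hone : ∀ x, ∑ i, e x i i = 1)
    (hcomm : ∀ x y, x ≠ y → ∀ i j k l, e x i j * e y k l =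
      sgn ((π i + π j) * (π k + π l)) • (e y k l * e x i j)) :
    LocalAlgebra π G →ₐ[ℂ] B :=
  RingQuot.liftAlgHom ℂ ⟨FreeAlgebra.lift ℂ (fun p : G × κ × κ => e p.1 p.2.1 p.2.2), by
    intro a b hab
    cases hab with
    | mul x i j k l =>
      have h := hmul x i j k l
      split_ifs at h ⊢ <;> simpa using h
    | one x => simpa using hone x
    | comm x y hxy i j k l => simpa using hcomm x y hxy i j k l⟩

/-- The relabelling of sites along an injective map; for the inclusion of a region this is tensoring
with the identity outside the region. -/
def LocalAlgebra.map {G G' : Type} (f : G ↪ G') : LocalAlgebra π G →ₐ[ℂ] LocalAlgebra π G' :=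
  LocalAlgebra.lift (fun x i j => cellUnit π (f x) i j)
    (fun x i j k l => cellUnit_mul (f x) i j k l) (fun x => sum_cellUnit (f x))
    (fun _ _ hxy i j k l => cellUnit_comm (fun h => hxy (f.injective h)) i j k l)

/-- The elements of parity `p`: the span of the monomials of total parity `p`. -/
def LocalAlgebra.graded (π : κ → ZMod 2) (G : Type) (p : ZMod 2) :
    Submodule ℂ (LocalAlgebra π G) :=
  Submodule.span ℂ {a | ∃ l : List (G × κ × κ),
    (l.map fun t => π t.2.1 + π t.2.2).sum = p ∧
      a = (l.map fun t => cellUnit π t.1 t.2.1 t.2.2).prod}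

end LocalAlgebra

/-! ### The quasi-local algebra

The `C*`-norm of the local algebra is read off from a faithful representation, the Jordan–Wigner
representation on `ℓ²` of the set of all configurations `G → κ`. -/

section JordanWigner

variable {κ : Type} [Fintype κ] [DecidableEq κ] (π : κ → ZMod 2) {G : Type} [Countable G]
  [DecidableEq G]

/-- The Hilbert space with orthonormal basis the configurations `G → κ`. -/
abbrev ConfSpace (κ G : Type) : Type := lp (fun _ : G → κ => ℂ) 2

/-- An enumeration of the sites. -/
def siteIndex (G : Type) [Countable G] : G → ℕ := (exists_injective_nat G).choose

theorem siteIndex_injective (G : Type) [Countable G] : Function.Injective (siteIndex G) :=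
  (exists_injective_nat G).choose_spec

theorem finite_preceding (x : G) : {y : G | siteIndex G y < siteIndex G x}.Finite :=
  (Set.finite_Iio (siteIndex G x)).preimage (siteIndex_injective G).injOn

/-- The total parity of a configuration on the sites preceding `x`. -/
def stringParity (x : G) (c : G → κ) : ZMod 2 :=
  ∑ y ∈ (finite_preceding x).toFinset, π (c y)

/-- The Jordan–Wigner matrix unit at `x`, as a map on functions of configurations. -/
def jwFun (x : G) (i j : κ) (ψ : (G → κ) → ℂ) (c : G → κ) : ℂ :=
  if c x = i then
    sgn ((π i + π j) * stringParity π x c) * ψ (Function.update c x j)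
  else 0

theorem norm_sgn (p : ZMod 2) : ‖sgn p‖ = 1 := by
  unfold sgn; split_ifs <;> simp

theorem sgn_add (p q : ZMod 2) : sgn (p + q) = sgn p * sgn q := by
  have key : ∀ p : ZMod 2, p = 0 ∨ p = 1 := by decide
  have h11 : (1 + 1 : ZMod 2) = 0 := by decide
  rcases key p with rfl | rfl <;> rcases key q with rfl | rfl <;> simp [sgn, h11]

theorem jwFun_summable (x : G) (i j : κ) (ψ : ConfSpace κ G) :
    Summable (fun c => ‖jwFun π x i j ψ c‖ ^ (2 : ENNReal).toReal) ∧
      ∑' c, ‖jwFun π x i j ψ c‖ ^ (2 : ENNReal).toReal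
        ≤ ∑' c, ‖(ψ : (G → κ) → ℂ) c‖ ^ (2 : ENNReal).toReal := by
  have hs : Summable (fun c => ‖(ψ : (G → κ) → ℂ) c‖ ^ (2 : ENNReal).toReal) :=
    (lp.memℓp ψ).summable (by norm_num)
  let e : {c : G → κ | c x = i} → (G → κ) := fun c => Function.update c.1 x j
  have he : Function.Injective e := by
    intro c c' h
    ext y
    by_cases hy : y = x
    · subst hy; exact c.2.trans c'.2.symm
    · have := congrFun h y
      simpa [e, hy] using this
  have hf : (fun c => ‖jwFun π x i j ψ c‖ ^ (2 : ENNReal).toReal) =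
      Set.indicator {c : G → κ | c x = i}
        (fun c => ‖(ψ : (G → κ) → ℂ) (Function.update c x j)‖ ^ (2 : ENNReal).toReal) := by
    ext c
    by_cases h : c x = i
    · simp [jwFun, h, norm_sgn]
    · simp [jwFun, h]
  rw [hf]
  refine ⟨summable_subtype_iff_indicator.mp (hs.comp_injective he), ?_⟩
  rw [← tsum_subtype]
  exact tsum_comp_le_tsum_of_inj hs (fun _ => by positivity) he

/-- The Jordan–Wigner matrix unit at `x`, as a bounded operator. -/
def jwUnit (x : G) (i j : κ) : ConfSpace κ G →L[ℂ] ConfSpace κ G :=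
  LinearMap.mkContinuous
    { toFun := fun ψ => ⟨jwFun π x i j ψ, memℓp_gen (jwFun_summable π x i j ψ).1⟩
      map_add' := by
        intro ψ φ
        ext c
        simp only [jwFun, lp.coeFn_add, Pi.add_apply]
        split_ifs <;> ring
      map_smul' := by
        intro a ψ
        ext c
        simp only [jwFun, lp.coeFn_smul, Pi.smul_apply, RingHom.id_apply, smul_eq_mul]
        split_ifs <;> ring } 1 (by
    intro ψ
    rw [one_mul]
    have h2 : (0 : ℝ) < (2 : ENNReal).toReal := by norm_num
    refine lp.norm_le_of_tsum_le h2 (norm_nonneg _) ?_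
    rw [lp.norm_rpow_eq_tsum h2]
    exact (jwFun_summable π x i j ψ).2)

theorem jwUnit_apply (x : G) (i j : κ) (ψ : ConfSpace κ G) (c : G → κ) :
    (jwUnit π x i j ψ : (G → κ) → ℂ) c = jwFun π x i j ψ c := rfl

theorem stringParity_update_of_le (x y : G) (h : siteIndex G x ≤ siteIndex G y) (c : G → κ)
    (j : κ) : stringParity π x (Function.update c y j) = stringParity π x c := by
  unfold stringParity
  refine Finset.sum_congr rfl fun z hz => ?_
  have hz' : siteIndex G z < siteIndex G x := by simpa using hz
  have : z ≠ y := by rintro rfl; omega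
  simp [this]

theorem stringParity_update_of_lt (x y : G) (h : siteIndex G y < siteIndex G x) (c : G → κ)
    (j : κ) :
    stringParity π x (Function.update c y j) = stringParity π x c + (π (c y) + π j) := by
  have hy : y ∈ (finite_preceding x).toFinset := by simpa using h
  unfold stringParity
  rw [← Finset.add_sum_erase _ _ hy, ← Finset.add_sum_erase _ (fun y => π (c y)) hy]
  have : ∑ z ∈ (finite_preceding x).toFinset.erase y, π (Function.update c y j z) =
      ∑ z ∈ (finite_preceding x).toFinset.erase y, π (c z) := by
    refine Finset.sum_congr rfl fun z hz => ?_
    simp [Finset.ne_of_mem_erase hz]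
  rw [this]
  simp only [Function.update_self]
  have h2 : π (c y) + π (c y) = 0 := CharTwo.add_self_eq_zero _
  linear_combination -h2

theorem jwUnit_mul (x : G) (i j k l : κ) :
    jwUnit π x i j * jwUnit π x k l = if j = k then jwUnit π x i l else 0 := by
  ext ψ c
  rw [mul_apply_eq_comp, jwUnit_apply]
  by_cases hc : c x = i
  · by_cases hjk : j = k
    · subst hjk
      rw [if_pos rfl, jwUnit_apply]
      simp only [jwFun, hc, if_true, jwUnit_apply, Function.update_self, Function.update_idem,
        stringParity_update_of_le π x x le_rfl]
      rw [← mul_assoc, ← sgn_add]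
      congr 2
      have h2 : π j + π j = 0 := CharTwo.add_self_eq_zero _
      linear_combination (stringParity π x c) * h2
    · rw [if_neg hjk]
      simp [jwFun, jwUnit_apply, hjk]
  · split_ifs <;> simp [jwFun, jwUnit_apply, hc]

theorem sum_jwUnit (x : G) : ∑ i, jwUnit π x i i = (1 : ConfSpace κ G →L[ℂ] ConfSpace κ G) := by
  ext ψ c
  rw [sum_apply, lp.coeFn_sum, Finset.sum_apply,
    one_apply_eq_self]
  simp only [jwUnit_apply, jwFun]
  rw [Finset.sum_ite_eq]
  have h2 : π (c x) + π (c x) = 0 := CharTwo.add_self_eq_zero _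
  simp [h2, sgn]

theorem jwUnit_comm_aux (x y : G) (hxy : siteIndex G x < siteIndex G y) (i j k l : κ) :
    jwUnit π x i j * jwUnit π y k l =
      sgn ((π i + π j) * (π k + π l)) • (jwUnit π y k l * jwUnit π x i j) := by
  have hne : x ≠ y := by rintro rfl; omega
  ext ψ c
  rw [smul_apply, lp.coeFn_smul, Pi.smul_apply, mul_apply_eq_comp,
    mul_apply_eq_comp, jwUnit_apply, jwUnit_apply]
  simp only [jwFun, jwUnit_apply, Function.update_of_ne hne, Function.update_of_ne hne.symm,
    stringParity_update_of_le π x y hxy.le, stringParity_update_of_lt π y x hxy]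
  by_cases hx : c x = i
  · by_cases hy : c y = k
    · simp only [hx, hy, if_true, smul_eq_mul, Function.update_comm hne]
      rw [mul_add, sgn_add, mul_comm (π k + π l) (π i + π j)]
      ring
    · simp [hy]
  · simp [hx]

theorem jwUnit_comm (x y : G) (hxy : x ≠ y) (i j k l : κ) :
    jwUnit π x i j * jwUnit π y k l =
      sgn ((π i + π j) * (π k + π l)) • (jwUnit π y k l * jwUnit π x i j) := by
  rcases lt_trichotomy (siteIndex G x) (siteIndex G y) with h | h | h
  · exact jwUnit_comm_aux π x y h i j k l
  · exact absurd (siteIndex_injective G h) hxy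
  · rw [jwUnit_comm_aux π y x h k l i j, smul_smul, mul_comm (π k + π l), ← sgn_add,
      CharTwo.add_self_eq_zero]
    simp [sgn]

variable (G)

/-- The Jordan–Wigner representation of the local algebra. -/
def jordanWigner : LocalAlgebra π G →ₐ[ℂ] (ConfSpace κ G →L[ℂ] ConfSpace κ G) :=
  LocalAlgebra.lift (jwUnit π) (jwUnit_mul π) (sum_jwUnit π) (jwUnit_comm π)

/-- The norm closure of the local operators. -/
def quasiLocalSubalgebra : StarSubalgebra ℂ (ConfSpace κ G →L[ℂ] ConfSpace κ G) :=
  (StarAlgebra.adjoin ℂ (Set.range (jordanWigner π G))).topologicalClosure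

/-- The quasi-local algebra `A(G)`. -/
abbrev QuasiLocal : Type := ↥(quasiLocalSubalgebra π G)

variable {π G}

/-- The inclusion of the local algebra into the quasi-local algebra. -/
def toQL : LocalAlgebra π G →ₐ[ℂ] QuasiLocal π G :=
  (jordanWigner π G).codRestrict (quasiLocalSubalgebra π G).toSubalgebra fun a =>
    StarSubalgebra.le_topologicalClosure _
      (StarAlgebra.subset_adjoin ℂ _ (Set.mem_range_self a))

/-- The subalgebra `A(Λ)` of the quasi-local algebra, for a finite region `Λ`. -/
def localSubalgebra (π : κ → ZMod 2) (Λ : Finset G) : Subalgebra ℂ (QuasiLocal π G) :=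
  (toQL.comp (LocalAlgebra.map (π := π) (Function.Embedding.subtype (· ∈ Λ)))).range

/-- The elements of parity `p` of the quasi-local algebra. -/
def gradedPart (π : κ → ZMod 2) (G : Type) [Countable G] [DecidableEq G] (p : ZMod 2) :
    Submodule ℂ (QuasiLocal π G) :=
  ((LocalAlgebra.graded π G p).map (toQL (π := π) (G := G)).toLinearMap).topologicalClosure

end JordanWigner

/-! ### Fermionic cellular automata -/

section Automata

variable {κ : Type} [Fintype κ] [DecidableEq κ] {π : κ → ZMod 2} {G : Type} [AddCommGroup G]
  [Countable G] [DecidableEq G]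

/-- `τ` is the shift by `x`. -/
def IsShift (x : G) (τ : QuasiLocal π G ≃⋆ₐ[ℂ] QuasiLocal π G) : Prop :=
  ∀ a : LocalAlgebra π G,
    τ (toQL a) = toQL (LocalAlgebra.map (Equiv.addLeft x).toEmbedding a)

/-- `𝒩` is a neighbourhood scheme of `T`: `T (A(Λ)) ⊆ A(Λ + 𝒩)` for all finite regions `Λ`. -/
def IsNeighbourhood (T : QuasiLocal π G ≃⋆ₐ[ℂ] QuasiLocal π G) (𝒩 : Finset G) : Prop :=
  ∀ Λ : Finset G, ∀ a ∈ localSubalgebra π Λ, T a ∈ localSubalgebra π (Λ + 𝒩)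

/-- A fermionic cellular automaton: a graded `*`-automorphism of the quasi-local algebra which is
local and translation invariant. -/
structure IsFCA (T : QuasiLocal π G ≃⋆ₐ[ℂ] QuasiLocal π G) : Prop where
  graded : ∀ p, ∀ a ∈ gradedPart π G p, T a ∈ gradedPart π G p
  local_ : ∃ 𝒩 : Finset G, IsNeighbourhood T 𝒩
  shift : ∀ x : G, ∃ τ : QuasiLocal π G ≃⋆ₐ[ℂ] QuasiLocal π G, IsShift x τ ∧
    ∀ a, T (τ a) = τ (T a)

end Automata

/-! ### Wrappings -/

instance countableZMod (n : ℕ) : Countable (ZMod n) := by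
  cases n
  · exact inferInstanceAs (Countable ℤ)
  · infer_instance

/-- The infinite lattice `ℤ^s`. -/
abbrev ZLattice (s : ℕ) : Type := Fin s → ℤ

/-- The torus `ℤ_n^s`. -/
abbrev Torus (s n : ℕ) : Type := Fin s → ZMod n

/-- The wrapping map `ℤ^s → ℤ_n^s`. -/
def wrap {s : ℕ} (n : ℕ) (x : ZLattice s) : Torus s n := fun t => (x t : ZMod n)

/-- The torus `ℤ_n^s` is a regular wrapping for the neighbourhood scheme `𝒩`. Here `x +ᵥ 𝒩` is the
neighbourhood `𝒩_x` of `x`, and its image is the neighbourhood of the wrapped cell. -/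
def IsRegular {s : ℕ} (n : ℕ) (𝒩 : Finset (ZLattice s)) : Prop :=
  ∀ x y : ZLattice s, ((x +ᵥ (𝒩 : Set (ZLattice s))) ∩ (y +ᵥ (𝒩 : Set (ZLattice s)))).Nonempty →
    (wrap n ⁻¹' (wrap n '' (x +ᵥ (𝒩 : Set (ZLattice s))) ∩
        wrap n '' (y +ᵥ (𝒩 : Set (ZLattice s))))) ∩
      ((x +ᵥ (𝒩 : Set (ZLattice s))) ∪ (y +ᵥ (𝒩 : Set (ZLattice s)))) =
    (x +ᵥ (𝒩 : Set (ZLattice s))) ∩ (y +ᵥ (𝒩 : Set (ZLattice s)))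

/-- The wrapping map on a region on which it is injective. -/
def wrapEmb {s : ℕ} (n : ℕ) (Λ : Finset (ZLattice s))
    (h : Set.InjOn (wrap n) (Λ : Set (ZLattice s))) : Λ ↪ Torus s n where
  toFun x := wrap n x.1
  inj' x y hxy := Subtype.ext (h x.2 y.2 hxy)

section Wrapped

variable {κ : Type} [Fintype κ] [DecidableEq κ] {π : κ → ZMod 2} {s : ℕ}

/-- The FCA `Tw` on the torus is a wrapping of `T`, i.e. it has the same transition rule: `T` maps
each element of the cell at `0` to an element `b` of `A(𝒩)`, and `Tw` maps it to the copy of `b` in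
the algebra of the wrapped neighbourhood. -/
def IsWrapping (n : ℕ) (T : QuasiLocal π (ZLattice s) ≃⋆ₐ[ℂ] QuasiLocal π (ZLattice s))
    (Tw : QuasiLocal π (Torus s n) ≃⋆ₐ[ℂ] QuasiLocal π (Torus s n)) : Prop :=
  IsFCA Tw ∧ ∃ 𝒩 : Finset (ZLattice s), IsNeighbourhood T 𝒩 ∧
    ∃ h : Set.InjOn (wrap n) (𝒩 : Set (ZLattice s)), ∀ i j : κ, ∃ b : LocalAlgebra π 𝒩,
      T (toQL (cellUnit π 0 i j)) =
          toQL (LocalAlgebra.map (Function.Embedding.subtype (· ∈ 𝒩)) b) ∧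
        Tw (toQL (cellUnit π 0 i j)) = toQL (LocalAlgebra.map (wrapEmb n 𝒩 h) b)

end Wrapped

/-! ### Tiles and coarse-graining -/

/-- The tile `Λ₀ = [0, N-1]^s`. -/
def tile (s N : ℕ) : Finset (ZLattice s) := Fintype.piFinset fun _ => Finset.Ico 0 (N : ℤ)

/-- The tiles met by `Λ₀ + 𝒩`: the set of all `y` such that `Λ_y = Λ₀ + N y` meets `Λ₀ + 𝒩`. -/
def tileNeighbourhood {s : ℕ} (N : ℕ) (𝒩 : Finset (ZLattice s)) : Finset (ZLattice s) :=
  (tile s N + 𝒩).image fun z t => z t / (N : ℤ)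

/-- The tile `Λ_x` of the torus `ℤ_{Nm}^s`, for `x` in the coarse-grained torus `ℤ_m^s`, as a copy
of `Λ₀`. -/
def tileEmb {s : ℕ} (N m : ℕ) [NeZero m] (x : Torus s m) : tile s N ↪ Torus s (N * m) where
  toFun y := fun t => ((y.1 t : ℤ) : ZMod (N * m)) + ((N * (x t).val : ℕ) : ZMod (N * m))
  inj' := by
    intro y z h
    ext t
    have h1 := add_right_cancel (congrFun h t)
    rw [ZMod.intCast_eq_intCast_iff_dvd_sub] at h1
    have hy := Finset.mem_Ico.mp (Fintype.mem_piFinset.mp y.2 t)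
    have hz := Finset.mem_Ico.mp (Fintype.mem_piFinset.mp z.2 t)
    have h2 : (N : ℤ) ∣ z.1 t - y.1 t := by
      refine dvd_trans ?_ h1
      push_cast
      exact dvd_mul_right _ _
    have h3 := Int.eq_zero_of_abs_lt_dvd h2 (by rw [abs_lt]; constructor <;> omega)
    omega

section CoarseGraining

variable {κ : Type} [Fintype κ] [DecidableEq κ] {π : κ → ZMod 2} {s N : ℕ}

/-- `P` is a nonzero projection of the graded algebra `A(Λ)`. -/
structure IsProjection {Λ : Finset (ZLattice s)} (P : LocalAlgebra π Λ) : Prop where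
  even : P ∈ LocalAlgebra.graded π Λ 0
  idem : P * P = P
  selfAdjoint : star (toQL P) = toQL P
  ne_zero : P ≠ 0

/-- An isometry `A'₀ → A(Λ₀)` with `1 ↦ P`, where `A'₀` is the graded matrix algebra with index set
`Fin r` and parity `π'`. It is given by the images of the matrix units, which form a homogeneous
basis of matrix units of the corner `P A(Λ₀) P`. -/
structure TileIsometry (P : LocalAlgebra π (tile s N)) (r : ℕ) (π' : Fin r → ZMod 2) where
  unit : Fin r → Fin r → LocalAlgebra π (tile s N)
  unit_graded : ∀ i j, unit i j ∈ LocalAlgebra.graded π (tile s N) (π' i + π' j)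
  unit_mul : ∀ i j k l, unit i j * unit k l = if j = k then unit i l else 0
  unit_star : ∀ i j, star (toQL (unit i j)) = toQL (unit j i)
  sum_unit : ∑ i, unit i i = P
  corner : ∀ a, P * a * P ∈ Submodule.span ℂ (Set.range fun ij : Fin r × Fin r => unit ij.1 ij.2)

/-- The product projection `Π = ⊠ Π_{Λ_x}` on the torus `ℤ_{Nm}^s`. The factors are even and sit on
disjoint tiles, so they commute and the order of the product is immaterial. -/
def productProjection (m : ℕ) [NeZero m] (P : LocalAlgebra π (tile s N)) :
    QuasiLocal π (Torus s (N * m)) :=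
  ((Finset.univ : Finset (Torus s m)).toList.map
    fun x => toQL (LocalAlgebra.map (tileEmb N m x) P)).prod

variable {P : LocalAlgebra π (tile s N)} {r : ℕ} {π' : Fin r → ZMod 2}

/-- `E : A'(ℤ_m^s) → A(ℤ_{Nm}^s)` is the product over the tiles of the copies of the tile isometry.
An element of the cell `x` is mapped to its image in `A(Λ_x)` times the projections of all the
other tiles. -/
def IsLatticeIsometry (m : ℕ) [NeZero m] (E₀ : TileIsometry P r π')
    (E : QuasiLocal π' (Torus s m) →⋆ₙₐ[ℂ] QuasiLocal π (Torus s (N * m))) : Prop :=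
  E 1 = productProjection m P ∧ ∀ x i j,
    E (toQL (cellUnit π' x i j)) =
      toQL (LocalAlgebra.map (tileEmb N m x) (E₀.unit i j)) * productProjection m P

/-- The coisometry `E†`: the compression `O ↦ Π O Π` followed by the inverse of the isomorphism `E`
onto `Π A(ℤ_{Nm}^s) Π`. -/
def coisometry (m : ℕ) [NeZero m] (P : LocalAlgebra π (tile s N))
    (E : QuasiLocal π' (Torus s m) →⋆ₙₐ[ℂ] QuasiLocal π (Torus s (N * m)))
    (O : QuasiLocal π (Torus s (N * m))) : QuasiLocal π' (Torus s m) :=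
  Function.invFun E (productProjection m P * O * productProjection m P)

/-- `ℤ_{Nm}^s` is a regular wrapping for `R` (with respect to the neighbourhood scheme `𝒩` of `R`)
and distinct tiles met by `Λ₀ + 𝒩` remain distinct tiles of it. -/
def IsRegularWrapping (N m : ℕ) (R : QuasiLocal π (ZLattice s) ≃⋆ₐ[ℂ] QuasiLocal π (ZLattice s))
    (𝒩 : Finset (ZLattice s)) : Prop :=
  IsNeighbourhood R 𝒩 ∧ IsRegular (N * m) 𝒩 ∧
    Set.InjOn (wrap m) (tileNeighbourhood N 𝒩 : Set (ZLattice s))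

/-- The FCA `S` is a renormalisation of `T` by means of the tile isometry `E₀`: one has
`T_w^N ∘ E = E ∘ S_w` on every regular wrapping `ℤ_{Nm}^s` for `T^N`. -/
def IsRenormalisation (T : QuasiLocal π (ZLattice s) ≃⋆ₐ[ℂ] QuasiLocal π (ZLattice s))
    (E₀ : TileIsometry P r π')
    (S : QuasiLocal π' (ZLattice s) ≃⋆ₐ[ℂ] QuasiLocal π' (ZLattice s)) : Prop :=
  IsFCA S ∧ ∀ (m : ℕ) [NeZero m], (∃ 𝒩, IsRegularWrapping N m (T ^ N) 𝒩) →
    ∃ Tw Sw E, IsWrapping (N * m) (T ^ N) Tw ∧ IsWrapping m S Sw ∧ IsLatticeIsometry m E₀ E ∧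
      ∀ a, Tw (E a) = E (Sw a)

/-- `T` is `(N, P)`-renormalisable. -/
def IsRenormalisable (T : QuasiLocal π (ZLattice s) ≃⋆ₐ[ℂ] QuasiLocal π (ZLattice s))
    (P : LocalAlgebra π (tile s N)) : Prop :=
  ∃ (r : ℕ) (π' : Fin r → ZMod 2) (E₀ : TileIsometry P r π')
    (S : QuasiLocal π' (ZLattice s) ≃⋆ₐ[ℂ] QuasiLocal π' (ZLattice s)), IsRenormalisation T E₀ S

end CoarseGraining

end FermionicCA

end

/-!
The proof reduces everything to the algebra of local observables, where it becomes algebra with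
matrix units, and compares the infinite lattice with its finite wrappings region by region.

*Local algebras.* Observables of disjoint regions graded-commute (`IsHomog.mul_comm_of_disjoint`),
the algebra of a finite system is a full matrix algebra by the Jordan–Wigner representation
(`jordanWigner_bijective`), and a graded partial trace shows that the algebras of two regions
intersect in that of the intersection (`mem_regionSub_inter`). Local algebras are therefore
simple: homomorphisms out of them are injective (`algHom_injective`), isometric if they preserve
the involution (`norm_toQL_map`), and an even factor supported elsewhere can be cancelled
(`eq_zero_of_mul_eq_zero`). It follows that automata correspond to graded, shift-invariant
`*`-automorphisms of the local algebra (`IsFCA.exists_restricts`, `IsLocalCA.exists_fca`), and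
these to transition rules: homogeneous systems of matrix units, one for the cell at the origin,
whose distinct translates graded-commute (`IsRule.exists_localCA`).

*Wrappings.* The relabelling of sites along `ℤ^s → ℤ_n^s` is encoded by the relation `wrapGraph`,
which on any region where the map is injective transports identities both ways
(`wrapGraph_eq_iff`). The axioms of a transition rule only involve overlapping pairs of
neighbourhoods, and on those a regular wrapping is injective. Hence a regular wrapping carries a
wrapped automaton (`exists_isLocalWrapping`), and it is unique. Being an automorphism of a full
matrix algebra it is inner; an implementing unitary and its parity conjugate differ by a central
sign, so the unitary has definite parity (`exists_homogeneous_unitary`).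

*Invariance of the projection.* If the wrapped evolution fixes the product projection `Π`, the
image of the projection of one tile dominates `Π`; cancelling the factors of the tiles it does not
meet leaves an identity between finitely many tiles, which lifts to `ℤ^s`
(`IsLocalWrapping.isLocallyInvariant`). Conversely, translates of that identity multiply to `T(Π)
≥ Π`, and equality follows by comparing dimensions (`IsLocalWrapping.map_proj_eq`). So the
invariance is equivalent to a condition on the infinite lattice, `IsLocallyInvariant`, which does
not refer to the wrapping; this gives its independence of the regular wrapping. A renormalisation
implies it, because `Π` is the image of the unit under the lattice isometry.

*The renormalised automaton.* If `Π` is invariant, the wrapped evolution restricts to the corner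
of `Π`, which the lattice isometry identifies with the coarse-grained algebra
(`Tiling.IsIsometry.exists_induced`). Compressing the evolved cell on `ℤ^s` to the tiles of the
coarse neighbourhood yields a candidate transition rule that does not mention any torus
(`exists_isRenormalisedRule`), and on every regular wrapping it is the rule of the induced
automaton (`IsRenormalisedRule.mem_wrapGraph`). On one sufficiently large torus the axioms of a
rule are pulled back to `ℤ^s`; the endomorphism so obtained is invertible, since the inverse on
the torus has the reflected neighbourhood and can be unwrapped too (`IsLocalWrapping.surjective`).
Two automata which agree on a torus that is injective on their neighbourhoods are equal
(`IsLocalWrapping.eq`), which yields the uniqueness assertions (`exists_isRenormalisation`).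
Finally, a tile isometry exists for every even projection, because its range has a basis
diagonalising the parity operator (`exists_tileIsometry`).
-/

noncomputable section

namespace FermionicCA

/-! ### Generators, supports and the parity twist -/

section Local

variable {κ : Type} [Fintype κ] [DecidableEq κ] {π : κ → ZMod 2} {G G' G'' : Type}

theorem sgn_zero : sgn 0 = 1 := by simp [sgn]

theorem sgn_mul_self (p : ZMod 2) : sgn p * sgn p = 1 := by
  rw [← sgn_add, CharTwo.add_self_eq_zero, sgn_zero]

theorem sgn_ne_zero (p : ZMod 2) : sgn p ≠ 0 := left_ne_zero_of_mul_eq_one (sgn_mul_self p)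

theorem star_sgn (p : ZMod 2) : star (sgn p) = sgn p := by
  unfold sgn; split_ifs <;> simp

@[simp]
theorem lift_cellUnit {B : Type*} [Ring B] [Algebra ℂ B] (e : G → κ → κ → B)
    (h1 : ∀ x i j k l, e x i j * e x k l = if j = k then e x i l else 0)
    (h2 : ∀ x, ∑ i, e x i i = 1)
    (h3 : ∀ x y, x ≠ y → ∀ i j k l, e x i j * e y k l =
      sgn ((π i + π j) * (π k + π l)) • (e y k l * e x i j)) (x : G) (i j : κ) :
    LocalAlgebra.lift (π := π) e h1 h2 h3 (cellUnit π x i j) = e x i j := by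
  simp [LocalAlgebra.lift, cellUnit]

@[simp]
theorem map_cellUnit (f : G ↪ G') (x : G) (i j : κ) :
    LocalAlgebra.map f (cellUnit π x i j) = cellUnit π (f x) i j :=
  lift_cellUnit ..

/-- The subalgebra generated by the cells of a region, which may be infinite. -/
def regionSub (π : κ → ZMod 2) (Λ : Set G) : Subalgebra ℂ (LocalAlgebra π G) :=
  Algebra.adjoin ℂ {a | ∃ x ∈ Λ, ∃ i j, a = cellUnit π x i j}

theorem cellUnit_mem {Λ : Set G} {x : G} (hx : x ∈ Λ) (i j : κ) :
    cellUnit π x i j ∈ regionSub π Λ :=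
  Algebra.subset_adjoin ⟨x, hx, i, j, rfl⟩

theorem regionSub_mono {Λ Λ' : Set G} (h : Λ ⊆ Λ') : regionSub π Λ ≤ regionSub π Λ' :=
  Algebra.adjoin_mono fun _ ⟨x, hx, i, j, ha⟩ => ⟨x, h hx, i, j, ha⟩

theorem regionSub_univ : regionSub π (Set.univ : Set G) = ⊤ := by
  rw [eq_top_iff]
  rintro a -
  obtain ⟨a, rfl⟩ := RingQuot.mkAlgHom_surjective ℂ (LocalRel π G) a
  induction a using FreeAlgebra.induction with
  | grade0 r => simp
  | grade1 t => exact cellUnit_mem (Set.mem_univ t.1) t.2.1 t.2.2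
  | mul a b ha hb => simpa using mul_mem ha hb
  | add a b ha hb => simpa using add_mem ha hb

/-- Induction on an element of the local algebra of a region. -/
theorem regionSub_induction {Λ : Set G} {p : ∀ a : LocalAlgebra π G, a ∈ regionSub π Λ → Prop}
    (hu : ∀ x (hx : x ∈ Λ) i j, p (cellUnit π x i j) (cellUnit_mem hx i j))
    (hs : ∀ c : ℂ, p (algebraMap ℂ _ c) (Subalgebra.algebraMap_mem _ c))
    (ha : ∀ a b ha hb, p a ha → p b hb → p (a + b) (add_mem ha hb))
    (hm : ∀ a b ha hb, p a ha → p b hb → p (a * b) (mul_mem ha hb))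
    {a : LocalAlgebra π G} (h : a ∈ regionSub π Λ) : p a h := by
  induction h using Algebra.adjoin_induction with
  | mem a h => obtain ⟨x, hx, i, j, rfl⟩ := h; exact hu x hx i j
  | algebraMap r => exact hs r
  | add a b h1' h2' h1 h2 => exact ha a b h1' h2' h1 h2
  | mul a b h1' h2' h1 h2 => exact hm a b h1' h2' h1 h2

@[elab_as_elim]
theorem local_induction {p : LocalAlgebra π G → Prop}
    (hu : ∀ x i j, p (cellUnit π x i j)) (hs : ∀ c : ℂ, p (algebraMap ℂ _ c))
    (ha : ∀ a b, p a → p b → p (a + b)) (hm : ∀ a b, p a → p b → p (a * b))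
    (a : LocalAlgebra π G) : p a :=
  regionSub_induction (Λ := Set.univ) (p := fun a _ => p a) (fun x _ => hu x) hs
    (fun a b _ _ => ha a b) (fun a b _ _ => hm a b) (by simp [regionSub_univ])

theorem local_algHom_ext {B : Type*} [Semiring B] [Algebra ℂ B] {φ ψ : LocalAlgebra π G →ₐ[ℂ] B}
    (h : ∀ x i j, φ (cellUnit π x i j) = ψ (cellUnit π x i j)) : φ = ψ := by
  refine AlgHom.ext fun a => ?_
  induction a using local_induction with
  | hu x i j => exact h x i j
  | hs c => simp
  | ha a b h1 h2 => simp [h1, h2]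
  | hm a b h1 h2 => simp [h1, h2]

theorem map_map (f : G ↪ G') (g : G' ↪ G'') (a : LocalAlgebra π G) :
    LocalAlgebra.map g (LocalAlgebra.map f a) = LocalAlgebra.map (f.trans g) a :=
  DFunLike.congr_fun (local_algHom_ext (φ := (LocalAlgebra.map g).comp (LocalAlgebra.map f))
    (ψ := LocalAlgebra.map (f.trans g)) fun x i j => by simp) a

theorem regionSub_map (f : G ↪ G') (Λ : Set G) :
    (regionSub π Λ).map (LocalAlgebra.map f) = regionSub π (f '' Λ) := by
  unfold regionSub
  rw [AlgHom.map_adjoin]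
  congr 1
  ext a
  constructor
  · rintro ⟨_, ⟨x, hx, i, j, rfl⟩, rfl⟩
    exact ⟨f x, ⟨x, hx, rfl⟩, i, j, map_cellUnit ..⟩
  · rintro ⟨_, ⟨x, hx, rfl⟩, i, j, rfl⟩
    exact ⟨_, ⟨x, hx, i, j, rfl⟩, map_cellUnit ..⟩

theorem map_mem_regionSub (f : G ↪ G') {Λ : Set G} {a : LocalAlgebra π G}
    (h : a ∈ regionSub π Λ) : LocalAlgebra.map f a ∈ regionSub π (f '' Λ) := by
  rw [← regionSub_map]; exact ⟨a, h, rfl⟩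

theorem mem_regionSub_univ (a : LocalAlgebra π G) : a ∈ regionSub π (Set.univ : Set G) := by
  simp [regionSub_univ]

theorem range_map (f : G ↪ G') :
    (LocalAlgebra.map (π := π) f).range = regionSub π (Set.range f) := by
  rw [← Set.image_univ, ← regionSub_map, regionSub_univ, Algebra.map_top]

theorem map_mem_range (f : G ↪ G') (a : LocalAlgebra π G) :
    LocalAlgebra.map f a ∈ regionSub π (Set.range f) := by
  rw [← range_map]; exact ⟨a, rfl⟩

/-- Every element of the local algebra has finite support. -/
theorem exists_finset_mem (a : LocalAlgebra π G) : ∃ Λ : Finset G, a ∈ regionSub π (Λ : Set G) := by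
  classical
  induction a using local_induction with
  | hu x i j => exact ⟨{x}, cellUnit_mem (by simp) i j⟩
  | hs c => exact ⟨∅, Subalgebra.algebraMap_mem _ c⟩
  | ha a b h1 h2 =>
    obtain ⟨Λ, h1⟩ := h1
    obtain ⟨Λ', h2⟩ := h2
    exact ⟨Λ ∪ Λ', add_mem (regionSub_mono (by simp) h1) (regionSub_mono (by simp) h2)⟩
  | hm a b h1 h2 =>
    obtain ⟨Λ, h1⟩ := h1
    obtain ⟨Λ', h2⟩ := h2
    exact ⟨Λ ∪ Λ', mul_mem (regionSub_mono (by simp) h1) (regionSub_mono (by simp) h2)⟩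

/-- The `p`-th power of the parity automorphism: it multiplies a monomial of parity `q` by
`(-1)^(p q)`. -/
def twist (p : ZMod 2) : LocalAlgebra π G →ₐ[ℂ] LocalAlgebra π G :=
  LocalAlgebra.lift (fun x i j => sgn (p * (π i + π j)) • cellUnit π x i j)
    (fun x i j k l => by
      rw [smul_mul_smul_comm, cellUnit_mul, ← sgn_add]
      split_ifs with h
      · subst h
        congr 2
        linear_combination p * CharTwo.add_self_eq_zero (π j)
      · simp)
    (fun x => by simp [CharTwo.add_self_eq_zero, sgn_zero, sum_cellUnit])
    (fun x y hxy i j k l => by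
      rw [smul_mul_smul_comm, cellUnit_comm hxy, smul_mul_smul_comm, smul_comm, mul_comm (sgn _)])

@[simp]
theorem twist_cellUnit (p : ZMod 2) (x : G) (i j : κ) :
    twist p (cellUnit π x i j) = sgn (p * (π i + π j)) • cellUnit π x i j :=
  lift_cellUnit ..

theorem twist_zero (a : LocalAlgebra π G) : twist 0 a = a :=
  DFunLike.congr_fun (local_algHom_ext (φ := twist 0)
    (ψ := AlgHom.id ℂ (LocalAlgebra π G)) fun x i j => by simp [sgn_zero]) a

theorem twist_twist (p : ZMod 2) (a : LocalAlgebra π G) : twist p (twist p a) = a :=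
  DFunLike.congr_fun (local_algHom_ext (φ := (twist p).comp (twist p))
    (ψ := AlgHom.id ℂ (LocalAlgebra π G)) fun x i j => by simp [smul_smul, sgn_mul_self]) a

theorem twist_map (p : ZMod 2) (f : G ↪ G') (a : LocalAlgebra π G) :
    twist p (LocalAlgebra.map f a) = LocalAlgebra.map f (twist p a) :=
  DFunLike.congr_fun (local_algHom_ext (φ := (twist p).comp (LocalAlgebra.map f))
    (ψ := (LocalAlgebra.map f).comp (twist p)) fun x i j => by simp) a

theorem twist_mem {Λ : Set G} (p : ZMod 2) {a : LocalAlgebra π G} (h : a ∈ regionSub π Λ) :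
    twist p a ∈ regionSub π Λ := by
  induction h using regionSub_induction with
  | hu x hx i j => simpa using Subalgebra.smul_mem _ (cellUnit_mem hx i j) _
  | hs c => simp
  | ha a b _ _ h1 h2 => simpa using add_mem h1 h2
  | hm a b _ _ h1 h2 => simpa using mul_mem h1 h2

/-- `a` is homogeneous of parity `p`. -/
def IsHomog (p : ZMod 2) (a : LocalAlgebra π G) : Prop := twist 1 a = sgn p • a

theorem zmod_two_cases (q : ZMod 2) : q = 0 ∨ q = 1 := by revert q; decide

theorem IsHomog.twist {p : ZMod 2} {a : LocalAlgebra π G} (h : IsHomog p a) (q : ZMod 2) :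
    twist q a = sgn (q * p) • a := by
  rcases zmod_two_cases q with rfl | rfl
  · simp [twist_zero, sgn_zero]
  · simpa [IsHomog] using h

theorem isHomog_cellUnit (x : G) (i j : κ) : IsHomog (π i + π j) (cellUnit π x i j) := by
  simp [IsHomog]

theorem isHomog_one : IsHomog 0 (1 : LocalAlgebra π G) := by simp [IsHomog, sgn_zero]

theorem IsHomog.mul {p q : ZMod 2} {a b : LocalAlgebra π G} (ha : IsHomog p a) (hb : IsHomog q b) :
    IsHomog (p + q) (a * b) := by
  unfold IsHomog at *
  rw [map_mul, ha, hb, smul_mul_smul_comm, sgn_add]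

theorem IsHomog.add {p : ZMod 2} {a b : LocalAlgebra π G} (ha : IsHomog p a) (hb : IsHomog p b) :
    IsHomog p (a + b) := by
  unfold IsHomog at *
  rw [map_add, ha, hb, smul_add]

theorem IsHomog.smul {p : ZMod 2} {a : LocalAlgebra π G} (c : ℂ) (ha : IsHomog p a) :
    IsHomog p (c • a) := by
  unfold IsHomog at *
  rw [map_smul, ha, smul_comm]

theorem IsHomog.map {p : ZMod 2} {a : LocalAlgebra π G} (f : G ↪ G') (ha : IsHomog p a) :
    IsHomog p (LocalAlgebra.map f a) := by
  unfold IsHomog at *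
  rw [twist_map, ha, map_smul]

/-- The elements of parity `p` are the eigenvectors of the parity automorphism. -/
theorem mem_graded_iff {p : ZMod 2} {a : LocalAlgebra π G} :
    a ∈ LocalAlgebra.graded π G p ↔ IsHomog p a := by
  have h1 : ∀ p, ∀ a ∈ LocalAlgebra.graded π G p, IsHomog p a := by
    intro p a ha
    induction ha using Submodule.span_induction with
    | zero => simp [IsHomog]
    | add a b _ _ h1 h2 => exact h1.add h2
    | smul c a _ h => exact h.smul c
    | mem a h =>
      obtain ⟨l, rfl, rfl⟩ := h
      induction l with
      | nil => simpa using isHomog_one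
      | cons t l ih => simpa using (isHomog_cellUnit t.1 t.2.1 t.2.2).mul ih
  refine ⟨h1 p a, fun h => ?_⟩
  have hspan : ∀ a : LocalAlgebra π G,
      a ∈ LocalAlgebra.graded π G 0 ⊔ LocalAlgebra.graded π G 1 := by
    intro a
    have ha : a ∈ Subalgebra.toSubmodule (regionSub π (Set.univ : Set G)) := by
      rw [regionSub_univ]; trivial
    rw [regionSub, Algebra.adjoin_eq_span] at ha
    refine Submodule.span_le.mpr ?_ ha
    intro b hb
    obtain ⟨l, hl, rfl⟩ := Submonoid.exists_list_of_mem_closure hb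
    have : ∃ l' : List (G × κ × κ), l = l'.map fun t => cellUnit π t.1 t.2.1 t.2.2 := by
      clear hb
      induction l with
      | nil => exact ⟨[], rfl⟩
      | cons a l ih =>
        obtain ⟨l', hl'⟩ := ih fun y hy => hl y (List.mem_cons_of_mem _ hy)
        obtain ⟨x, -, i, j, hx⟩ := hl a (List.mem_cons_self ..)
        exact ⟨(x, i, j) :: l', by simp [hl', hx]⟩
    obtain ⟨l', rfl⟩ := this
    rcases zmod_two_cases (l'.map fun t => π t.2.1 + π t.2.2).sum with h0 | h0
    · exact Submodule.mem_sup_left (Submodule.subset_span ⟨l', h0, rfl⟩)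
    · exact Submodule.mem_sup_right (Submodule.subset_span ⟨l', h0, rfl⟩)
  obtain ⟨a0, ha0, a1, ha1, rfl⟩ := Submodule.mem_sup.mp (hspan a)
  have e0 := h1 0 a0 ha0
  have e1 := h1 1 a1 ha1
  unfold IsHomog at *
  rw [map_add, e0, e1] at h
  -- the component of the wrong parity vanishes, as `2` is invertible
  have two : ∀ c : LocalAlgebra π G, c + c = 0 → c = 0 := fun c hc => by
    have : (2 : ℂ) • c = 0 := by rw [two_smul]; exact hc
    exact (smul_eq_zero_iff_right two_ne_zero).mp this
  have hneg : ∀ c : LocalAlgebra π G, (-1 : ℂ) • c = -c := fun c => by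
    refine eq_neg_of_add_eq_zero_right ?_
    conv_lhs => rw [← one_smul ℂ c]
    rw [smul_smul, ← add_smul]; simp
  simp only [sgn, if_true, one_ne_zero, if_false, one_smul, hneg] at h
  rcases zmod_two_cases p with rfl | rfl
  · simp only [if_true, one_smul] at h
    rw [two a1 (by have h2 := add_left_cancel h; rw [← sub_eq_zero] at h2
                   rw [← neg_eq_zero, ← h2]; abel), add_zero]
    exact ha0
  · simp only [one_ne_zero, if_false, hneg, neg_add] at h
    rw [two a0 (by have h2 := add_right_cancel h
                   nth_rewrite 1 [h2]; exact neg_add_cancel _), zero_add]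
    exact ha1

/-- A matrix unit at `x` graded-commutes with everything supported off `x`. -/
theorem cellUnit_mul_of_notMem {Λ : Set G} {x : G} (hx : x ∉ Λ) (i j : κ) {b : LocalAlgebra π G}
    (hb : b ∈ regionSub π Λ) :
    cellUnit π x i j * b = twist (π i + π j) b * cellUnit π x i j := by
  induction hb using regionSub_induction with
  | hu y hy k l =>
    rw [cellUnit_comm (by rintro rfl; exact hx hy), twist_cellUnit, smul_mul_assoc]
  | hs c => simpa using (Algebra.commutes c _).symm
  | ha a b _ _ h1 h2 => rw [mul_add, h1, h2, map_add, add_mul]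
  | hm a b _ _ h1 h2 => rw [← mul_assoc, h1, mul_assoc, h2, map_mul, mul_assoc]

/-- Elements of disjoint regions graded-commute. -/
theorem IsHomog.mul_comm_of_disjoint {Λ Λ' : Set G} (hd : Disjoint Λ Λ') {p : ZMod 2}
    {a b : LocalAlgebra π G} (h : IsHomog p a) (ha : a ∈ regionSub π Λ)
    (hb : b ∈ regionSub π Λ') : a * b = FermionicCA.twist p b * a := by
  induction hb using regionSub_induction with
  | hu y hy k l =>
    have h1 := cellUnit_mul_of_notMem (Set.disjoint_right.mp hd hy) k l ha
    rw [h.twist, smul_mul_assoc] at h1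
    rw [twist_cellUnit, smul_mul_assoc, h1, smul_smul, mul_comm p, sgn_mul_self, one_smul]
  | hs c => simpa using (Algebra.commutes c _).symm
  | ha a b _ _ h1 h2 => rw [mul_add, h1, h2, map_add, add_mul]
  | hm a b _ _ h1 h2 => rw [← mul_assoc, h1, mul_assoc, h2, map_mul, mul_assoc]

theorem IsHomog.comm_of_disjoint {Λ Λ' : Set G} (hd : Disjoint Λ Λ')
    {a b : LocalAlgebra π G} (h : IsHomog 0 a) (ha : a ∈ regionSub π Λ)
    (hb : b ∈ regionSub π Λ') : a * b = b * a := by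
  rw [h.mul_comm_of_disjoint hd ha hb, twist_zero]

/-- The algebra of a union is spanned by the products, in this order, of elements of the two
regions: the cells of `Λ` can be moved to the left of those of `Λ'`. -/
theorem regionSub_union_le (Λ Λ' : Set G) :
    Subalgebra.toSubmodule (regionSub π (Λ ∪ Λ')) ≤
      Subalgebra.toSubmodule (regionSub π Λ) * Subalgebra.toSubmodule (regionSub π Λ') := by
  classical
  set M := Subalgebra.toSubmodule (regionSub π Λ) * Subalgebra.toSubmodule (regionSub π Λ')
  -- the span of the products is stable under left multiplication by the generators
  have key : ∀ a ∈ regionSub π (Λ ∪ Λ'), ∀ m ∈ M, a * m ∈ M := by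
    intro a ha
    induction ha using regionSub_induction with
    | hs c => intro m hm; rw [← Algebra.smul_def]; exact M.smul_mem c hm
    | ha a b _ _ h1 h2 => intro m hm; rw [add_mul]; exact M.add_mem (h1 m hm) (h2 m hm)
    | hm a b _ _ h1 h2 => intro m hm; rw [mul_assoc]; exact h1 _ (h2 m hm)
    | hu x hx i j =>
      intro m hm
      induction hm using Submodule.mul_induction_on' with
      | add a _ b _ h1 h2 => rw [mul_add]; exact M.add_mem h1 h2
      | mem_mul_mem b hb c hc =>
        by_cases hxΛ : x ∈ Λ
        · rw [← mul_assoc]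
          exact Submodule.mul_mem_mul ((regionSub π Λ).mul_mem (cellUnit_mem hxΛ i j) hb) hc
        · have hx' : x ∈ Λ' := hx.resolve_left hxΛ
          rw [← mul_assoc, cellUnit_mul_of_notMem hxΛ i j hb, mul_assoc]
          exact Submodule.mul_mem_mul (twist_mem _ hb)
            ((regionSub π Λ').mul_mem (cellUnit_mem hx' i j) hc)
  intro a ha
  have := key a ha 1 (by
    rw [← one_mul (1 : LocalAlgebra π G)]
    exact Submodule.mul_mem_mul (one_mem (regionSub π Λ)) (one_mem (regionSub π Λ')))
  simpa using this

theorem regionSub_singleton (x : G) :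
    Subalgebra.toSubmodule (regionSub π {x}) =
      Submodule.span ℂ (Set.range fun ij : κ × κ => cellUnit π x ij.1 ij.2) := by
  set M := Submodule.span ℂ (Set.range fun ij : κ × κ => cellUnit π x ij.1 ij.2)
  have hone : (1 : LocalAlgebra π G) ∈ M := by
    rw [← sum_cellUnit x]
    exact Submodule.sum_mem _ fun i _ => Submodule.subset_span ⟨(i, i), rfl⟩
  apply le_antisymm
  · intro a ha
    change a ∈ regionSub π {x} at ha
    induction ha using regionSub_induction with
    | hs c => rw [Algebra.algebraMap_eq_smul_one]; exact M.smul_mem c hone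
    | ha a b _ _ h1 h2 => exact M.add_mem h1 h2
    | hu y hy i j => obtain rfl := hy; exact Submodule.subset_span ⟨(i, j), rfl⟩
    | hm a b _ _ h1 h2 =>
      have hMM : M * M ≤ M := by
        rw [Submodule.span_mul_span, Submodule.span_le]
        rintro _ ⟨_, ⟨⟨i, j⟩, rfl⟩, _, ⟨⟨k, l⟩, rfl⟩, rfl⟩
        simp only [cellUnit_mul]
        split_ifs
        · exact Submodule.subset_span ⟨(i, l), rfl⟩
        · exact M.zero_mem
      exact hMM (Submodule.mul_mem_mul h1 h2)
  · rw [Submodule.span_le]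
    rintro _ ⟨⟨i, j⟩, rfl⟩
    exact cellUnit_mem (Set.mem_singleton x) i j

/-! ### The conditional expectation that removes a site -/

/-- The normalised graded partial trace over the site `x`. -/
def siteTrace (x : G) : LocalAlgebra π G →ₗ[ℂ] LocalAlgebra π G :=
  (Fintype.card κ : ℂ)⁻¹ • ∑ i, ∑ j,
    (LinearMap.mulLeft ℂ (cellUnit π x i j)) ∘ₗ (LinearMap.mulRight ℂ (cellUnit π x j i)) ∘ₗ
      (twist (π i + π j)).toLinearMap

theorem siteTrace_apply (x : G) (a : LocalAlgebra π G) : siteTrace x a =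
    (Fintype.card κ : ℂ)⁻¹ • ∑ i, ∑ j,
      cellUnit π x i j * (twist (π i + π j) a * cellUnit π x j i) := by
  simp [siteTrace, LinearMap.sum_apply]

/-- The partial trace over `x` fixes the elements which graded-commute with the cell at `x`. -/
theorem siteTrace_of_comm [Nonempty κ] (x : G) {a : LocalAlgebra π G}
    (h : ∀ i j, cellUnit π x i j * twist (π i + π j) a = a * cellUnit π x i j) :
    siteTrace x a = a := by
  rw [siteTrace_apply]
  have : ∀ i j, cellUnit π x i j * (twist (π i + π j) a * cellUnit π x j i) =
      a * cellUnit π x i i := by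
    intro i j
    rw [← mul_assoc, h, mul_assoc, cellUnit_mul, if_pos rfl]
  simp only [this, Finset.sum_const, Finset.card_univ]
  rw [← Finset.smul_sum, ← Finset.mul_sum, sum_cellUnit, mul_one, ← Nat.cast_smul_eq_nsmul ℂ,
    smul_smul, inv_mul_cancel₀ (by simp), one_smul]

theorem siteTrace_mem {Λ : Set G} (x : G) {a : LocalAlgebra π G} (ha : a ∈ regionSub π Λ) :
    siteTrace x a ∈ regionSub π (Λ \ {x}) := by
  replace ha := regionSub_union_le {x} (Λ \ {x})
    (regionSub_mono (π := π) (Λ := Λ) (Λ' := {x} ∪ Λ \ {x}) (by simp) ha)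
  induction ha using Submodule.mul_induction_on' with
  | add a _ b _ h1 h2 => rw [map_add]; exact add_mem h1 h2
  | mem_mul_mem c hc b hb =>
    rw [regionSub_singleton] at hc
    induction hc using Submodule.span_induction with
    | zero => simp
    | add c d _ _ h1 h2 => rw [add_mul, map_add]; exact add_mem h1 h2
    | smul r c _ h => rw [smul_mul_assoc, map_smul]; exact Subalgebra.smul_mem _ h r
    | mem c hc =>
      obtain ⟨⟨k, l⟩, rfl⟩ := hc
      rw [siteTrace_apply]
      refine Subalgebra.smul_mem _ ?_ _
      have hb' : b ∈ regionSub π (Λ \ {x}) := hb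
      have hx : x ∉ Λ \ {x} := by simp
      have : ∀ i j, cellUnit π x i j * (twist (π i + π j) (cellUnit π x k l * b) *
          cellUnit π x j i) = if j = k then (if l = j then cellUnit π x i i * b else 0) else 0 := by
        intro i j
        rw [map_mul, twist_cellUnit]
        have h1 := cellUnit_mul_of_notMem hx j i hb'
        rw [add_comm (π j)] at h1
        rw [mul_assoc, ← h1, ← mul_assoc, ← mul_assoc, mul_smul_comm, smul_mul_assoc,
          smul_mul_assoc, cellUnit_mul]
        split_ifs with h2 h3
        · subst h2 h3
          rw [cellUnit_mul, if_pos rfl, CharTwo.add_self_eq_zero, mul_zero, sgn_zero, one_smul]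
        · rw [cellUnit_mul, if_neg h3]; simp
        · simp
      simp only [this, Finset.sum_ite_eq', Finset.mem_univ, if_true]
      split_ifs
      · rw [← Finset.sum_mul, sum_cellUnit, one_mul]; exact hb'
      · simp

/-- An element which graded-commutes with the cells of the finite set `F` has no support in `F`. -/
theorem mem_of_comm [Nonempty κ] {Λ : Set G} (F : Finset G) {a : LocalAlgebra π G}
    (ha : a ∈ regionSub π Λ)
    (h : ∀ x ∈ F, ∀ i j, cellUnit π x i j * twist (π i + π j) a = a * cellUnit π x i j) :
    a ∈ regionSub π (Λ \ F) := by
  classical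
  induction F using Finset.induction_on with
  | empty => simpa using ha
  | insert x F _ ih =>
    have h1 := siteTrace_mem x (ih fun y hy => h y (Finset.mem_insert_of_mem hy))
    rw [siteTrace_of_comm x (h x (Finset.mem_insert_self x F))] at h1
    refine regionSub_mono (fun y hy => ?_) h1
    simp only [Set.mem_sdiff, Set.mem_singleton_iff, Finset.coe_insert, Set.mem_insert_iff] at hy ⊢
    tauto

/-- Local algebras of regions intersect in the local algebra of the intersection. -/
theorem mem_regionSub_inter [Nonempty κ] {Λ Λ' : Set G} {a : LocalAlgebra π G}
    (ha : a ∈ regionSub π Λ) (ha' : a ∈ regionSub π Λ') : a ∈ regionSub π (Λ ∩ Λ') := by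
  classical
  obtain ⟨F, hF⟩ := exists_finset_mem a
  -- finitely many sites can be removed one after the other
  have key2 : ∀ Λ₁ Λ₂ : Set G, Λ₁.Finite → a ∈ regionSub π Λ₁ → a ∈ regionSub π Λ₂ →
      a ∈ regionSub π (Λ₁ ∩ Λ₂) := by
    intro Λ₁ Λ₂ hfin h1 h2
    have h3 := mem_of_comm (hfin.subset (Set.sdiff_subset (t := Λ₂))).toFinset h1 (by
      intro x hx i j
      have hx' : x ∉ Λ₂ := by
        rw [Set.Finite.mem_toFinset] at hx; exact hx.2
      rw [cellUnit_mul_of_notMem hx' i j (twist_mem _ h2), twist_twist])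
    refine regionSub_mono (fun y hy => ?_) h3
    refine ⟨hy.1, ?_⟩
    by_contra hy2
    refine hy.2 (by rw [Finset.mem_coe, Set.Finite.mem_toFinset]; exact ⟨hy.1, hy2⟩)
  have h4 := key2 _ _ F.finite_toSet hF ha
  have h5 := key2 _ _ (F.finite_toSet.subset Set.inter_subset_left) h4 ha'
  exact regionSub_mono (Set.inter_subset_inter_left _ Set.inter_subset_right) h5

end Local

/-! ### Finite systems are full matrix algebras -/

section Finite

variable {κ : Type} [Fintype κ] [DecidableEq κ] (π : κ → ZMod 2) {G : Type}

/-- The algebra of a finite region `F` is spanned by at most `|κ|^(2|F|)` elements. -/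
theorem exists_spanning_finset (F : Finset G) : ∃ S : Finset (LocalAlgebra π G),
    S.card ≤ (Fintype.card κ ^ F.card) ^ 2 ∧
      Subalgebra.toSubmodule (regionSub π (F : Set G)) ≤ Submodule.span ℂ (S : Set _) := by
  classical
  induction F using Finset.induction_on with
  | empty =>
    refine ⟨{1}, by simp, ?_⟩
    have : regionSub π ((∅ : Finset G) : Set G) = ⊥ := by
      rw [regionSub]; convert Algebra.adjoin_empty ℂ (LocalAlgebra π G); simp
    rw [this, Algebra.toSubmodule_bot, Finset.coe_singleton, Submodule.one_eq_span]
  | insert x F hx ih =>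
    obtain ⟨S, hS, hspan⟩ := ih
    refine ⟨(Finset.univ.image fun ij : κ × κ => cellUnit π x ij.1 ij.2) * S, ?_, ?_⟩
    · refine Finset.card_mul_le.trans ?_
      rw [Finset.card_insert_of_notMem hx, pow_succ _ F.card, mul_pow, mul_comm]
      refine Nat.mul_le_mul hS (Finset.card_image_le.trans ?_)
      simp [sq]
    · rw [Finset.coe_insert, Set.insert_eq]
      refine (regionSub_union_le {x} (F : Set G)).trans ?_
      rw [regionSub_singleton, Finset.coe_mul, ← Submodule.span_mul_span]
      exact mul_le_mul' (le_of_eq (by simp)) hspan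

variable [Fintype G] [DecidableEq G]

instance finiteDimensional_confSpace : FiniteDimensional ℂ (ConfSpace κ G) :=
  (lpPiLpₗᵢ (p := 2) (fun _ : G → κ => ℂ) ℂ).symm.toLinearEquiv.finiteDimensional

theorem finrank_confSpace : Module.finrank ℂ (ConfSpace κ G) =
    Fintype.card κ ^ Fintype.card G := by
  rw [(lpPiLpₗᵢ (p := 2) (fun _ : G → κ => ℂ) ℂ).toLinearEquiv.finrank_eq]
  exact (finrank_euclideanSpace (𝕜 := ℂ) (ι := G → κ)).trans (by simp)

theorem finiteDimensional_localAlgebra : FiniteDimensional ℂ (LocalAlgebra π G) ∧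
    Module.finrank ℂ (LocalAlgebra π G) ≤ (Fintype.card κ ^ Fintype.card G) ^ 2 := by
  obtain ⟨S, hS, hspan⟩ := exists_spanning_finset π (Finset.univ : Finset G)
  have htop : Submodule.span ℂ (S : Set (LocalAlgebra π G)) = ⊤ := by
    rw [eq_top_iff]
    refine le_trans ?_ hspan
    rw [Finset.coe_univ, regionSub_univ, Algebra.top_toSubmodule]
  have hfin : Module.Finite ℂ (LocalAlgebra π G) := ⟨⟨S, htop⟩⟩
  refine ⟨hfin, ?_⟩
  rw [← finrank_top, ← htop]
  exact (finrank_span_finset_le_card S).trans hS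

instance : FiniteDimensional ℂ (LocalAlgebra π G) := (finiteDimensional_localAlgebra π).1

/-- A product of Jordan–Wigner matrix units over distinct sites is, up to signs, a matrix unit. -/
theorem prod_jwUnit_apply (l : List G) (hl : l.Nodup) (i j : G → κ) : ∃ σ : (G → κ) → ℂ,
    (∀ c, σ c ≠ 0) ∧ ∀ (ψ : ConfSpace κ G) (c : G → κ),
      ((l.map fun x => jwUnit π x (i x) (j x)).prod ψ : (G → κ) → ℂ) c =
        if ∀ x ∈ l, c x = i x then σ c * (ψ : (G → κ) → ℂ) (fun y => if y ∈ l then j y else c y)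
        else 0 := by
  induction l with
  | nil => exact ⟨fun _ => 1, by simp, by simp⟩
  | cons x l ih =>
    obtain ⟨σ, hσ, h⟩ := ih (List.nodup_cons.mp hl).2
    have hx := (List.nodup_cons.mp hl).1
    refine ⟨fun c => sgn ((π (i x) + π (j x)) * stringParity π x c) *
      σ (Function.update c x (j x)), fun c => mul_ne_zero (sgn_ne_zero _) (hσ _), ?_⟩
    intro ψ c
    rw [List.map_cons, List.prod_cons, mul_apply_eq_comp, jwUnit_apply, jwFun, h]
    have h1 : (∀ y ∈ l, Function.update c x (j x) y = i y) ↔ ∀ y ∈ l, c y = i y := by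
      refine forall₂_congr fun y hy => ?_
      rw [Function.update_of_ne (by rintro rfl; exact hx hy)]
    have h2 : (fun y => if y ∈ l then j y else Function.update c x (j x) y) =
        fun y => if y ∈ x :: l then j y else c y := by
      funext y
      by_cases hyx : y = x
      · subst hyx; simp [hx]
      · simp [hyx]
    rw [h2]
    simp only [h1]
    by_cases hc : c x = i x
    · by_cases hc' : ∀ y ∈ l, c y = i y
      · rw [if_pos hc, if_pos hc', if_pos (by simpa [hc] using hc'), mul_assoc]
      · rw [if_pos hc, if_neg hc', if_neg (by simpa [hc] using hc'), mul_zero]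
    · rw [if_neg hc, if_neg (by simp [hc])]

theorem jordanWigner_cellUnit (x : G) (i j : κ) :
    jordanWigner π G (cellUnit π x i j) = jwUnit π x i j :=
  lift_cellUnit ..

theorem sum_single (ψ : ConfSpace κ G) :
    ψ = ∑ c, (ψ : (G → κ) → ℂ) c • lp.single 2 c (1 : ℂ) := by
  ext d
  rw [lp.coeFn_sum, Finset.sum_apply]
  simp [Pi.single_apply]

theorem jordanWigner_surjective : Function.Surjective (jordanWigner π G) := by
  intro A
  have hunit : ∀ i j : G → κ, ∃ a : LocalAlgebra π G, ∀ (ψ : ConfSpace κ G) (c : G → κ),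
      (jordanWigner π G a ψ : (G → κ) → ℂ) c = if c = i then (ψ : (G → κ) → ℂ) j else 0 := by
    intro i j
    obtain ⟨σ, hσ, h⟩ := prod_jwUnit_apply π (Finset.univ : Finset G).toList
      (Finset.nodup_toList _) i j
    refine ⟨(σ i)⁻¹ •
      ((Finset.univ : Finset G).toList.map fun x => cellUnit π x (i x) (j x)).prod, ?_⟩
    intro ψ c
    have e : jordanWigner π G
        ((Finset.univ : Finset G).toList.map fun x => cellUnit π x (i x) (j x)).prod =
        ((Finset.univ : Finset G).toList.map fun x => jwUnit π x (i x) (j x)).prod := by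
      rw [map_list_prod, List.map_map]
      congr 1
      exact List.map_congr_left fun x _ => jordanWigner_cellUnit π x _ _
    rw [map_smul, e, smul_apply, lp.coeFn_smul, Pi.smul_apply, h]
    simp only [Finset.mem_toList, Finset.mem_univ, if_true, smul_eq_mul]
    by_cases hc : c = i
    · subst hc
      rw [if_pos (fun _ _ => rfl), if_pos rfl]
      exact inv_mul_cancel_left₀ (hσ c) _
    · rw [if_neg (fun h => hc (funext fun x => h x trivial)), if_neg hc, mul_zero]
  choose a ha using hunit
  refine ⟨∑ i, ∑ j, (A (lp.single 2 j (1 : ℂ)) : (G → κ) → ℂ) i • a i j, ?_⟩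
  ext ψ c
  simp only [map_sum, map_smul, sum_apply, smul_apply, lp.coeFn_sum, Finset.sum_apply,
    lp.coeFn_smul, Pi.smul_apply, ha, smul_eq_mul, mul_ite, mul_zero]
  rw [Finset.sum_comm]
  simp only [Finset.sum_ite_eq, Finset.mem_univ, if_true]
  conv_rhs => rw [sum_single ψ]
  rw [map_sum, lp.coeFn_sum, Finset.sum_apply]
  simp [mul_comm]

/-- In the Jordan–Wigner representation a finite system consists of all operators: each matrix
unit of the configuration space is, up to a sign, a product of cell matrix units, and the
representation is faithful because the dimensions agree. -/
theorem jordanWigner_bijective : Function.Bijective (jordanWigner π G) := by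
  refine ⟨?_, jordanWigner_surjective π⟩
  have h1 : Module.finrank ℂ (ConfSpace κ G →L[ℂ] ConfSpace κ G) =
      (Fintype.card κ ^ Fintype.card G) ^ 2 := by
    rw [← (LinearMap.toContinuousLinearMap (𝕜 := ℂ) (E := ConfSpace κ G)
      (F' := ConfSpace κ G)).finrank_eq, Module.finrank_linearMap, finrank_confSpace, sq]
  have hfin : FiniteDimensional ℂ (ConfSpace κ G →L[ℂ] ConfSpace κ G) :=
    (LinearMap.toContinuousLinearMap (𝕜 := ℂ) (E := ConfSpace κ G)
      (F' := ConfSpace κ G)).finiteDimensional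
  have h2 : Module.finrank ℂ (LocalAlgebra π G) =
      Module.finrank ℂ (ConfSpace κ G →L[ℂ] ConfSpace κ G) :=
    le_antisymm (h1 ▸ (finiteDimensional_localAlgebra π).2)
      (LinearMap.finrank_le_finrank_of_surjective (f := (jordanWigner π G).toLinearMap)
        (jordanWigner_surjective π))
  exact (LinearMap.injective_iff_surjective_of_finrank_eq_finrank
    (f := (jordanWigner π G).toLinearMap) h2).mpr (jordanWigner_surjective π)

theorem nontrivial_confSpace (κ G : Type) [Fintype κ] [Nonempty κ] :
    Nontrivial (ConfSpace κ G) := by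
  classical
  obtain ⟨c⟩ : Nonempty (G → κ) := inferInstance
  refine ⟨lp.single 2 c (1 : ℂ), 0, fun h => ?_⟩
  have := congrFun (congrArg (fun f : ConfSpace κ G => (f : (G → κ) → ℂ)) h) c
  simp at this

instance isSimpleRing_localAlgebra [Nonempty κ] : IsSimpleRing (LocalAlgebra π G) := by
  have := nontrivial_confSpace κ G
  have e1 := AlgEquiv.ofBijective (jordanWigner π G) (jordanWigner_bijective π)
  have e2 := Module.End.toContinuousLinearMap (𝕜 := ℂ) (ConfSpace κ G)
  have e3 := algEquivMatrix (Module.finBasis ℂ (ConfSpace κ G))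
  have : Nonempty (Fin (Module.finrank ℂ (ConfSpace κ G))) :=
    ⟨⟨0, Module.finrank_pos⟩⟩
  exact IsSimpleRing.of_ringEquiv ((e3.symm.trans e2).trans e1.symm).toRingEquiv inferInstance

end Finite

/-! ### Simplicity and its consequences -/

section Simple

variable {κ : Type} [Fintype κ] [DecidableEq κ] {π : κ → ZMod 2} [Nonempty κ] {G G' : Type}

theorem exists_map_eq {Λ : Set G} {a : LocalAlgebra π G} (h : a ∈ regionSub π Λ) :
    ∃ b : LocalAlgebra π Λ, LocalAlgebra.map (Function.Embedding.subtype (· ∈ Λ)) b = a := by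
  have : a ∈ (LocalAlgebra.map (π := π) (Function.Embedding.subtype (· ∈ Λ))).range := by
    rw [range_map]; simpa using h
  exact this

/-- The local algebra is simple, being a union of full matrix algebras. -/
theorem algHom_injective {B : Type*} [Ring B] [Algebra ℂ B] [Nontrivial B]
    (φ : LocalAlgebra π G →ₐ[ℂ] B) : Function.Injective φ := by
  classical
  refine (injective_iff_map_eq_zero φ).mpr fun a ha => ?_
  obtain ⟨Λ, hΛ⟩ := exists_finset_mem a
  obtain ⟨b, rfl⟩ := exists_map_eq hΛ
  let ψ := φ.comp (LocalAlgebra.map (Function.Embedding.subtype (· ∈ (Λ : Set G))))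
  have hinj : Function.Injective ψ := RingHom.injective ψ.toRingHom
  rw [hinj (a₁ := b) (a₂ := 0) (by rw [map_zero]; exact ha), map_zero]

theorem nontrivial_quasiLocal (π : κ → ZMod 2) (G : Type) [Countable G] [DecidableEq G] :
    Nontrivial (QuasiLocal π G) := by
  have := nontrivial_confSpace κ G
  refine ⟨1, 0, fun h => ?_⟩
  have h' : (1 : ConfSpace κ G →L[ℂ] ConfSpace κ G) = 0 := congrArg Subtype.val h
  exact one_ne_zero h'

theorem toQL_injective [Countable G] [DecidableEq G] :
    Function.Injective (toQL (π := π) (G := G)) := by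
  have := nontrivial_quasiLocal π G
  exact algHom_injective _

theorem nontrivial_local (π : κ → ZMod 2) (G : Type) [Countable G] :
    Nontrivial (LocalAlgebra π G) := by
  classical
  have := nontrivial_quasiLocal π G
  exact RingHom.domain_nontrivial (toQL (π := π) (G := G)).toRingHom

theorem map_injective [Countable G'] (f : G ↪ G') :
    Function.Injective (LocalAlgebra.map (π := π) f) := by
  have := nontrivial_local π G'
  exact algHom_injective _

/-- Elements of disjoint regions are tensor factors: if `b ≠ 0` is even and `a b = 0`, then
`a = 0`. -/
theorem eq_zero_of_mul_eq_zero [Countable G] {Λ Λ' : Set G} (hd : Disjoint Λ Λ')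
    {a b : LocalAlgebra π G} (ha : a ∈ regionSub π Λ) (hb : b ∈ regionSub π Λ') (hb0 : b ≠ 0)
    (hbe : IsHomog 0 b) (h : a * b = 0) : a = 0 := by
  classical
  obtain ⟨F, hF⟩ := exists_finset_mem a
  have hΛ := mem_regionSub_inter ha hF
  set Λ₁ : Set G := Λ ∩ F
  have : Fintype Λ₁ := (F.finite_toSet.subset Set.inter_subset_right).fintype
  have hcomm : ∀ c : LocalAlgebra π Λ₁,
      LocalAlgebra.map (Function.Embedding.subtype (· ∈ Λ₁)) c * b =
        b * LocalAlgebra.map (Function.Embedding.subtype (· ∈ Λ₁)) c := fun c => by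
    refine (hbe.comm_of_disjoint (hd.symm.mono_right Set.inter_subset_left) hb (Λ' := Λ₁) ?_).symm
    simpa using map_mem_range (Function.Embedding.subtype (· ∈ Λ₁)) c
  obtain ⟨c, rfl⟩ := exists_map_eq hΛ
  -- the annihilator of `b` is a proper two-sided ideal
  let I : TwoSidedIdeal (LocalAlgebra π Λ₁) := TwoSidedIdeal.mk'
    {c | LocalAlgebra.map (Function.Embedding.subtype (· ∈ Λ₁)) c * b = 0}
    (by simp)
    (fun {x y} hx hy => by
      simp only [Set.mem_ofPred_eq] at *; rw [map_add, add_mul, hx, hy, add_zero])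
    (fun {x} hx => by
      simp only [Set.mem_ofPred_eq] at *; rw [map_neg]
      exact (neg_mul _ _).trans ((congrArg _ hx).trans neg_zero))
    (fun {x y} hy => by
      simp only [Set.mem_ofPred_eq] at *; rw [map_mul, mul_assoc, hy, mul_zero])
    (fun {x y} hx => by
      simp only [Set.mem_ofPred_eq] at *; rw [map_mul, mul_assoc, hcomm, ← mul_assoc, hx, zero_mul])
  by_cases hc : c = 0
  · rw [hc, map_zero]
  · have hI : (1 : LocalAlgebra π Λ₁) ∈ I :=
      IsSimpleRing.one_mem_of_ne_zero_mem I hc (by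
        rw [TwoSidedIdeal.mem_mk']; exact h)
    rw [TwoSidedIdeal.mem_mk'] at hI
    exact absurd (by simpa using hI) hb0

end Simple

/-! ### The involution of the local algebra -/

section Star

variable {κ : Type} [Fintype κ] [DecidableEq κ] {π : κ → ZMod 2} {G G' : Type} [Countable G]
  [DecidableEq G]

theorem star_jwUnit (x : G) (i j : κ) : star (jwUnit π x i j) = jwUnit π x j i := by
  symm
  rw [ContinuousLinearMap.star_eq_adjoint, ContinuousLinearMap.eq_adjoint_iff]
  intro φ ψ
  rw [lp.inner_eq_tsum, lp.inner_eq_tsum]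
  let σ : (G → κ) ≃ (G → κ) := Function.Involutive.toPerm
    (fun c => Function.update c x (Equiv.swap i j (c x))) fun c => by simp
  rw [← σ.tsum_eq]
  refine tsum_congr fun c => ?_
  have hσ : σ c = Function.update c x (Equiv.swap i j (c x)) := rfl
  simp only [jwUnit_apply, jwFun, hσ, Function.update_self, Function.update_idem,
    stringParity_update_of_le π x x le_rfl]
  by_cases hc : c x = i
  · rw [hc, Equiv.swap_apply_left, if_pos rfl, if_pos rfl]
    simp only [RCLike.inner_apply, map_mul]
    have h1 := star_sgn ((π i + π j) * stringParity π x c)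
    rw [starRingEnd_apply, add_comm (π j), h1, ← hc, Function.update_eq_self]
    ring
  · have : Equiv.swap i j (c x) ≠ j := fun h => hc (by
      exact (Equiv.swap i j).injective (h.trans (Equiv.swap_apply_left i j).symm))
    rw [if_neg this, if_neg hc]
    simp

theorem toQL_cellUnit_val (x : G) (i j : κ) :
    (toQL (cellUnit π x i j) : ConfSpace κ G →L[ℂ] ConfSpace κ G) = jwUnit π x i j :=
  lift_cellUnit ..

theorem star_toQL_cellUnit (x : G) (i j : κ) :
    star (toQL (cellUnit π x i j)) = toQL (cellUnit π x j i) :=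
  Subtype.ext (by
    change star (toQL (cellUnit π x i j)).1 = _
    rw [toQL_cellUnit_val, toQL_cellUnit_val, star_jwUnit])

/-- The local algebra is closed under the involution of the quasi-local algebra. -/
theorem exists_toQL_eq_star (a : LocalAlgebra π G) : ∃ b : LocalAlgebra π G,
    toQL b = star (toQL a) := by
  induction a using local_induction with
  | hu x i j => exact ⟨_, (star_toQL_cellUnit x i j).symm⟩
  | hs c =>
    refine ⟨algebraMap ℂ _ (star c), ?_⟩
    rw [AlgHom.commutes, AlgHom.commutes, algebraMap_star_comm]
  | ha a b h1 h2 =>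
    obtain ⟨a', h1⟩ := h1
    obtain ⟨b', h2⟩ := h2
    exact ⟨a' + b', by rw [map_add, map_add, star_add, h1, h2]⟩
  | hm a b h1 h2 =>
    obtain ⟨a', h1⟩ := h1
    obtain ⟨b', h2⟩ := h2
    exact ⟨b' * a', by rw [map_mul, map_mul, star_mul, h1, h2]⟩

variable [Nonempty κ]

/-- The involution of the local algebra, induced from the quasi-local algebra. -/
instance : Star (LocalAlgebra π G) := ⟨fun a => (exists_toQL_eq_star a).choose⟩

theorem toQL_star (a : LocalAlgebra π G) : toQL (star a) = star (toQL a) :=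
  (exists_toQL_eq_star a).choose_spec

instance : StarRing (LocalAlgebra π G) where
  star_involutive a := toQL_injective (by rw [toQL_star, toQL_star, star_star])
  star_mul a b := toQL_injective (by
    rw [toQL_star, map_mul, map_mul, star_mul, toQL_star, toQL_star])
  star_add a b := toQL_injective (by
    rw [toQL_star, map_add, map_add, star_add, toQL_star, toQL_star])

instance : StarModule ℂ (LocalAlgebra π G) where
  star_smul c a := toQL_injective (by
    rw [toQL_star, map_smul, map_smul, star_smul, toQL_star])

theorem star_cellUnit (x : G) (i j : κ) : star (cellUnit π x i j) = cellUnit π x j i :=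
  toQL_injective (by rw [toQL_star, star_toQL_cellUnit])

variable {κ' : Type} [Fintype κ'] [DecidableEq κ'] {π' : κ' → ZMod 2} [Nonempty κ']
  [Countable G'] [DecidableEq G']

/-- A homomorphism of local algebras preserves the involution if it does so on the cells. -/
theorem map_star_of_cellUnit (φ : LocalAlgebra π G →ₐ[ℂ] LocalAlgebra π' G')
    (h : ∀ x i j, φ (cellUnit π x j i) = star (φ (cellUnit π x i j))) (a : LocalAlgebra π G) :
    φ (star a) = star (φ a) := by
  induction a using local_induction with
  | hu x i j => rw [star_cellUnit, h]
  | hs c =>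
    rw [← algebraMap_star_comm, AlgHom.commutes, AlgHom.commutes, algebraMap_star_comm]
  | ha a b h1 h2 => rw [star_add, map_add, map_add, star_add, h1, h2]
  | hm a b h1 h2 => rw [star_mul, map_mul, map_mul, star_mul, h1, h2]

theorem map_star' (f : G ↪ G') (a : LocalAlgebra π G) :
    LocalAlgebra.map f (star a) = star (LocalAlgebra.map f a) :=
  map_star_of_cellUnit _ (fun x i j => by simp [star_cellUnit]) a

theorem twist_star (p : ZMod 2) (a : LocalAlgebra π G) : twist p (star a) = star (twist p a) :=
  map_star_of_cellUnit _ (fun x i j => by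
    simp only [twist_cellUnit, star_smul, star_cellUnit, star_sgn]
    rw [add_comm (π i)]) a

end Star

/-! ### Extension of automorphisms to the quasi-local algebra -/

section Extension

variable {κ κ' : Type} [Fintype κ] [DecidableEq κ] {π : κ → ZMod 2} [Nonempty κ]
  [Fintype κ'] [DecidableEq κ'] {π' : κ' → ZMod 2} [Nonempty κ'] {G G' : Type}
  [Countable G] [DecidableEq G] [Countable G'] [DecidableEq G']

instance isClosed_quasiLocalSubalgebra : IsClosed (quasiLocalSubalgebra π G :
    Set (ConfSpace κ G →L[ℂ] ConfSpace κ G)) :=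
  StarSubalgebra.isClosed_topologicalClosure _

theorem adjoin_range_jordanWigner (a : ConfSpace κ G →L[ℂ] ConfSpace κ G)
    (ha : a ∈ StarAlgebra.adjoin ℂ (Set.range (jordanWigner π G))) :
    ∃ b, jordanWigner π G b = a := by
  induction ha using StarAlgebra.adjoin_induction with
  | mem a h => exact h
  | algebraMap r => exact ⟨algebraMap ℂ _ r, AlgHom.commutes _ _⟩
  | add a b _ _ h1 h2 =>
    obtain ⟨a', rfl⟩ := h1
    obtain ⟨b', rfl⟩ := h2
    exact ⟨a' + b', map_add _ _ _⟩
  | mul a b _ _ h1 h2 =>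
    obtain ⟨a', rfl⟩ := h1
    obtain ⟨b', rfl⟩ := h2
    exact ⟨a' * b', map_mul _ _ _⟩
  | star a _ h =>
    obtain ⟨a', rfl⟩ := h
    exact ⟨star a', congrArg Subtype.val (toQL_star a')⟩

theorem denseRange_toQL : DenseRange (toQL (π := π) (G := G)) := by
  intro a
  rw [mem_closure_iff_seq_limit]
  have ha : (a : ConfSpace κ G →L[ℂ] ConfSpace κ G) ∈
      closure ((StarAlgebra.adjoin ℂ (Set.range (jordanWigner π G)) :
        StarSubalgebra ℂ (ConfSpace κ G →L[ℂ] ConfSpace κ G)) : Set _) := a.2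
  obtain ⟨u, hu, hlim⟩ := mem_closure_iff_seq_limit.mp ha
  choose v hv using fun n => adjoin_range_jordanWigner (u n) (hu n)
  refine ⟨fun n => toQL (v n), fun n => ⟨_, rfl⟩, ?_⟩
  rw [tendsto_subtype_rng]
  have : (fun n => (toQL (v n) : ConfSpace κ G →L[ℂ] ConfSpace κ G)) = u := funext hv
  rw [this]
  exact hlim

theorem toQL_surjective [Fintype G] : Function.Surjective (toQL (π := π) (G := G)) := fun a => by
  obtain ⟨b, hb⟩ := jordanWigner_surjective π (a : ConfSpace κ G →L[ℂ] ConfSpace κ G)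
  exact ⟨b, Subtype.ext hb⟩

/-- Finite systems have no proper completion. -/
def localEquiv (π : κ → ZMod 2) (G : Type) [Fintype G] [DecidableEq G] :
    LocalAlgebra π G ≃ₐ[ℂ] QuasiLocal π G :=
  AlgEquiv.ofBijective toQL ⟨toQL_injective, toQL_surjective⟩

theorem localEquiv_apply [Fintype G] (a : LocalAlgebra π G) : localEquiv π G a = toQL a := rfl

/-- A homomorphism of local algebras preserves the `C*`-norm: on each finite region it is an
injective `*`-homomorphism of finite-dimensional `C*`-algebras. -/
theorem norm_toQL_map (φ : LocalAlgebra π G →ₐ[ℂ] LocalAlgebra π' G')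
    (hφ : ∀ a, φ (star a) = star (φ a)) (a : LocalAlgebra π G) :
    ‖toQL (φ a)‖ = ‖toQL a‖ := by
  classical
  obtain ⟨Λ, hΛ⟩ := exists_finset_mem a
  obtain ⟨b, rfl⟩ := exists_map_eq hΛ
  have key : ∀ {κ' : Type} [Fintype κ'] [DecidableEq κ'] {π' : κ' → ZMod 2} [Nonempty κ']
      {G' : Type} [Countable G'] [DecidableEq G']
      (ψ : LocalAlgebra π (Λ : Set G) →ₐ[ℂ] LocalAlgebra π' G')
      (_ : ∀ a, ψ (star a) = star (ψ a)) (b : LocalAlgebra π (Λ : Set G)),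
      ‖toQL (ψ b)‖ = ‖toQL b‖ := by
    intro κ' _ _ π' _ G' _ _ ψ hψ b
    let Ψ : QuasiLocal π (Λ : Set G) →⋆ₐ[ℂ] QuasiLocal π' G' :=
      { (toQL.comp ψ).comp (localEquiv π (Λ : Set G)).symm.toAlgHom with
        map_star' := fun c => by
          obtain ⟨d, rfl⟩ := toQL_surjective c
          have e : ∀ d : LocalAlgebra π (Λ : Set G), ((toQL.comp ψ).comp
              (localEquiv π (Λ : Set G)).symm.toAlgHom) (toQL d) = toQL (ψ d) := fun d => by
            rw [← localEquiv_apply]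
            simp
          change ((toQL.comp ψ).comp (localEquiv π (Λ : Set G)).symm.toAlgHom) (star (toQL d)) =
            star (((toQL.comp ψ).comp (localEquiv π (Λ : Set G)).symm.toAlgHom) (toQL d))
          rw [← toQL_star, e, e, hψ, toQL_star] }
    have hΨ : ∀ d, Ψ (toQL d) = toQL (ψ d) := fun d => by
      rw [← localEquiv_apply]
      change ((toQL.comp ψ).comp (localEquiv π (Λ : Set G)).symm.toAlgHom) _ = _
      simp
    have hinj : Function.Injective Ψ := by
      intro c d hcd
      obtain ⟨c, rfl⟩ := toQL_surjective c
      obtain ⟨d, rfl⟩ := toQL_surjective d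
      rw [hΨ, hΨ] at hcd
      have := nontrivial_local π' G'
      rw [algHom_injective ψ (toQL_injective hcd)]
    rw [← hΨ]
    exact NonUnitalStarAlgHom.norm_map Ψ hinj (toQL b)
  have h1 := key (φ.comp (LocalAlgebra.map (Function.Embedding.subtype (· ∈ (Λ : Set G)))))
    (fun a => by rw [AlgHom.comp_apply, map_star', hφ]; rfl) b
  have h2 := key (LocalAlgebra.map (Function.Embedding.subtype (· ∈ (Λ : Set G))))
    (fun a => map_star' _ a) b
  rw [h2, ← h1]
  rfl

/-- An isometric `*`-automorphism of a dense `*`-subalgebra extends to the whole algebra. -/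
theorem exists_starAlgEquiv_of_dense {A B : Type*} [Ring A] [Algebra ℂ A] [Star A]
    [CStarAlgebra B] (τ : A →ₐ[ℂ] B) (hd : DenseRange τ) (hτ : ∀ a, τ (star a) = star (τ a))
    (e : A ≃ₐ[ℂ] A) (hnorm : ∀ a, ‖τ (e a)‖ = ‖τ a‖) (hstar : ∀ a, e (star a) = star (e a)) :
    ∃ T : B ≃⋆ₐ[ℂ] B, ∀ a, T (τ a) = τ (e a) := by
  let L := e.toLinearEquiv.extendOfIsometry τ.toLinearMap τ.toLinearMap hd hd hnorm
  have hL : ∀ a, L (τ a) = τ (e a) := fun a => by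
    refine LinearEquiv.extend_eq e.toLinearEquiv τ.toLinearMap τ.toLinearMap hd
      ⟨1, fun x => by rw [one_mul]; exact (hnorm x).le⟩ hd ⟨1, fun x => ?_⟩ a
    have := hnorm (e.symm x)
    rw [e.apply_symm_apply] at this
    rw [one_mul]; exact this.ge
  have hmul : ∀ a b, L (a * b) = L a * L b := fun a b => by
    refine hd.induction_on₂ (p := fun a b => L (a * b) = L a * L b)
      (isClosed_eq ?_ ?_) ?_ a b
    · exact L.continuous.comp continuous_mul
    · exact (L.continuous.comp continuous_fst).mul (L.continuous.comp continuous_snd)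
    · intro a b
      rw [← map_mul, hL, hL, hL, map_mul, map_mul]
  have hstar' : ∀ a, L (star a) = star (L a) := fun a => by
    refine hd.induction_on (p := fun a => L (star a) = star (L a)) a
      (isClosed_eq ?_ ?_) ?_
    · exact L.continuous.comp continuous_star
    · exact continuous_star.comp L.continuous
    · intro a
      rw [← hτ, hL, hL, hstar, hτ]
  let T : B ≃⋆ₐ[ℂ] B :=
    { toFun := L
      invFun := L.symm
      left_inv := L.left_inv
      right_inv := L.right_inv
      map_mul' := hmul
      map_add' := map_add L
      map_star' := hstar'
      map_smul' := map_smul L }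
  exact ⟨T, hL⟩

theorem exists_extension (φ : LocalAlgebra π G →ₐ[ℂ] LocalAlgebra π G)
    (hbij : Function.Bijective φ) (hφ : ∀ a, φ (star a) = star (φ a)) :
    ∃ T : QuasiLocal π G ≃⋆ₐ[ℂ] QuasiLocal π G, ∀ a, T (toQL a) = toQL (φ a) := by
  obtain ⟨T, hT⟩ := exists_starAlgEquiv_of_dense (toQL (π := π) (G := G)) denseRange_toQL
    toQL_star (AlgEquiv.ofBijective φ hbij) (norm_toQL_map φ hφ) hφ
  refine ⟨T, fun a => (hT a).trans ?_⟩
  rw [AlgEquiv.ofBijective_apply]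

theorem starAlgEquiv_continuous (T : QuasiLocal π G ≃⋆ₐ[ℂ] QuasiLocal π G) : Continuous T :=
  (NonUnitalStarAlgHom.isometry T T.injective).continuous

theorem starAlgEquiv_ext {T T' : QuasiLocal π G ≃⋆ₐ[ℂ] QuasiLocal π G}
    (h : ∀ a, T (toQL a) = T' (toQL a)) : T = T' := by
  refine StarAlgEquiv.ext fun a => ?_
  refine denseRange_toQL.induction_on (p := fun a => T a = T' a) a
    (isClosed_eq (starAlgEquiv_continuous T) (starAlgEquiv_continuous T')) h

theorem mem_localSubalgebra {Λ : Finset G} {a : QuasiLocal π G} :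
    a ∈ localSubalgebra π Λ ↔ ∃ b ∈ regionSub π (Λ : Set G), toQL b = a := by
  constructor
  · rintro ⟨b, rfl⟩
    refine ⟨_, ?_, rfl⟩
    have := map_mem_range (Function.Embedding.subtype (· ∈ Λ)) b
    simpa using this
  · rintro ⟨b, hb, rfl⟩
    obtain ⟨c, rfl⟩ := exists_map_eq hb
    exact ⟨c, rfl⟩

theorem toQL_mem_localSubalgebra {Λ : Finset G} {a : LocalAlgebra π G} :
    toQL a ∈ localSubalgebra π Λ ↔ a ∈ regionSub π (Λ : Set G) := by
  rw [mem_localSubalgebra]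
  exact ⟨fun ⟨b, hb, h⟩ => toQL_injective h ▸ hb, fun h => ⟨a, h, rfl⟩⟩

/-- Passing to the completion adds no local observables of a given parity. -/
theorem toQL_mem_gradedPart {p : ZMod 2} {a : LocalAlgebra π G} :
    toQL a ∈ gradedPart π G p ↔ IsHomog p a := by
  constructor
  · intro h
    obtain ⟨Θ, hΘ⟩ := exists_extension (twist (π := π) (G := G) 1)
      (Function.Involutive.bijective (twist_twist 1)) (twist_star 1)
    -- the parity automorphism extends to the completion, so its eigenspaces are closed
    have hcl : IsClosed {b : QuasiLocal π G | Θ b = sgn p • b} :=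
      isClosed_eq (starAlgEquiv_continuous Θ) (continuous_const_smul _)
    have : toQL a ∈ {b : QuasiLocal π G | Θ b = sgn p • b} := by
      refine closure_minimal ?_ hcl h
      rintro _ ⟨c, hc, rfl⟩
      have hc' : IsHomog p c := mem_graded_iff.mp hc
      change Θ (toQL c) = sgn p • toQL c
      rw [hΘ, hc', map_smul]
    have h2 : Θ (toQL a) = sgn p • toQL a := this
    rw [hΘ, ← map_smul] at h2
    exact toQL_injective h2
  · intro h
    exact subset_closure ⟨a, mem_graded_iff.mpr h, rfl⟩

end Extension

/-! ### Cellular automata on the local algebra -/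

section LocalCA

variable {κ : Type} [Fintype κ] [DecidableEq κ] {π : κ → ZMod 2} [Nonempty κ] {G : Type}
  [AddCommGroup G] [Countable G] [DecidableEq G]

/-- The shift by `x` of the local algebra. -/
def shift (x : G) : LocalAlgebra π G →ₐ[ℂ] LocalAlgebra π G :=
  LocalAlgebra.map (Equiv.addLeft x).toEmbedding

@[simp]
theorem shift_cellUnit (x y : G) (i j : κ) :
    shift x (cellUnit π y i j) = cellUnit π (x + y) i j := by
  simp [shift]

theorem shift_shift (x y : G) (a : LocalAlgebra π G) : shift x (shift y a) = shift (x + y) a :=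
  DFunLike.congr_fun (local_algHom_ext (φ := (shift x).comp (shift y)) (ψ := shift (x + y))
    fun z i j => by simp [add_assoc]) a

theorem shift_zero (a : LocalAlgebra π G) : shift 0 a = a :=
  DFunLike.congr_fun (local_algHom_ext (φ := shift 0) (ψ := AlgHom.id ℂ (LocalAlgebra π G))
    fun z i j => by simp) a

theorem shift_bijective (x : G) : Function.Bijective (shift (π := π) x) :=
  Function.bijective_iff_has_inverse.mpr ⟨shift (-x), fun a => by simp [shift_shift, shift_zero],
    fun a => by simp [shift_shift, shift_zero]⟩

theorem shift_star (x : G) (a : LocalAlgebra π G) : shift x (star a) = star (shift x a) :=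
  map_star' _ a

theorem shift_mem (x : G) {Λ : Set G} {a : LocalAlgebra π G} (h : a ∈ regionSub π Λ) :
    shift x a ∈ regionSub π (x +ᵥ Λ) := by
  have h2 := map_mem_regionSub (Equiv.addLeft x).toEmbedding h
  have e : (Equiv.addLeft x).toEmbedding '' Λ = x +ᵥ Λ := rfl
  rw [e] at h2
  exact h2

theorem shift_isHomog {x : G} {p : ZMod 2} {a : LocalAlgebra π G} (h : IsHomog p a) :
    IsHomog p (shift x a) := h.map _

/-- The restriction of a fermionic cellular automaton to the local algebra: a graded
`*`-endomorphism which commutes with the shifts. It has a finite neighbourhood automatically. -/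
structure IsLocalCA (α : LocalAlgebra π G →ₐ[ℂ] LocalAlgebra π G) : Prop where
  star : ∀ a, α (star a) = star (α a)
  twist : ∀ a, α (twist 1 a) = FermionicCA.twist 1 (α a)
  shift : ∀ x a, α (shift x a) = FermionicCA.shift x (α a)

variable {α β : LocalAlgebra π G →ₐ[ℂ] LocalAlgebra π G}

theorem IsLocalCA.isHomog (h : IsLocalCA α) {p : ZMod 2} {a : LocalAlgebra π G}
    (ha : IsHomog p a) : IsHomog p (α a) := by
  unfold IsHomog at *
  rw [← h.twist, ha, map_smul]

theorem IsLocalCA.cellUnit (h : IsLocalCA α) (x : G) (i j : κ) :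
    α (cellUnit π x i j) = FermionicCA.shift x (α (FermionicCA.cellUnit π 0 i j)) := by
  rw [← h.shift, shift_cellUnit, add_zero]

theorem IsLocalCA.ext (hα : IsLocalCA α) (hβ : IsLocalCA β)
    (h : ∀ i j, α (FermionicCA.cellUnit π 0 i j) = β (FermionicCA.cellUnit π 0 i j)) : α = β :=
  local_algHom_ext fun x i j => by rw [hα.cellUnit, hβ.cellUnit, h]

/-- The neighbourhood scheme of the cell at the origin is one for all regions. -/
theorem IsLocalCA.map_mem (hα : IsLocalCA α) {𝒩 : Set G}
    (h : ∀ i j, α (FermionicCA.cellUnit π 0 i j) ∈ regionSub π 𝒩) {Λ : Set G}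
    {a : LocalAlgebra π G} (ha : a ∈ regionSub π Λ) : α a ∈ regionSub π (Λ + 𝒩) := by
  induction ha using regionSub_induction with
  | hu x hx i j =>
    rw [hα.cellUnit]
    refine regionSub_mono ?_ (shift_mem x (h i j))
    rintro _ ⟨y, hy, rfl⟩
    exact Set.add_mem_add hx hy
  | hs c => rw [AlgHom.commutes]; exact Subalgebra.algebraMap_mem _ c
  | ha a b _ _ h1 h2 => rw [map_add]; exact add_mem h1 h2
  | hm a b _ _ h1 h2 => rw [map_mul]; exact mul_mem h1 h2

theorem IsLocalCA.exists_neighbourhood (α : LocalAlgebra π G →ₐ[ℂ] LocalAlgebra π G) :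
    ∃ 𝒩 : Finset G, ∀ i j, α (FermionicCA.cellUnit π 0 i j) ∈ regionSub π (𝒩 : Set G) := by
  choose F hF using fun ij : κ × κ => exists_finset_mem (α (FermionicCA.cellUnit π 0 ij.1 ij.2))
  refine ⟨Finset.univ.biUnion F, fun i j => regionSub_mono ?_ (hF (i, j))⟩
  exact_mod_cast Finset.subset_biUnion_of_mem F (Finset.mem_univ (i, j))

/-- The automaton `T` restricts to `α` on the local algebra. -/
def Restricts (T : QuasiLocal π G ≃⋆ₐ[ℂ] QuasiLocal π G)
    (α : LocalAlgebra π G →ₐ[ℂ] LocalAlgebra π G) : Prop :=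
  ∀ a, T (toQL a) = toQL (α a)

variable {T T' : QuasiLocal π G ≃⋆ₐ[ℂ] QuasiLocal π G}

/-- An automaton maps local observables to local observables. -/
theorem IsFCA.exists_restricts (hT : IsFCA T) : ∃ α, IsLocalCA α ∧ Restricts T α := by
  obtain ⟨𝒩, h𝒩⟩ := hT.local_
  have hex : ∀ a : LocalAlgebra π G, ∃ b : LocalAlgebra π G, toQL b = T (toQL a) := fun a => by
    obtain ⟨Λ, hΛ⟩ := exists_finset_mem a
    obtain ⟨b, -, hb⟩ := mem_localSubalgebra.mp (h𝒩 Λ _ (toQL_mem_localSubalgebra.mpr hΛ))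
    exact ⟨b, hb⟩
  choose f hf using hex
  let α : LocalAlgebra π G →ₐ[ℂ] LocalAlgebra π G :=
    { toFun := f
      map_one' := toQL_injective (by rw [hf, map_one, map_one])
      map_mul' := fun a b => toQL_injective (by rw [hf, map_mul, map_mul, map_mul, hf, hf])
      map_zero' := toQL_injective (by rw [hf, map_zero, map_zero])
      map_add' := fun a b => toQL_injective (by rw [hf, map_add, map_add, map_add, hf, hf])
      commutes' := fun c => toQL_injective (by
        rw [hf, AlgHom.commutes, Algebra.algebraMap_eq_smul_one, map_smul, map_one]) }
  have hα : Restricts T α := fun a => (hf a).symm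
  have hhom : ∀ p, ∀ a, IsHomog p a → IsHomog p (α a) := fun p a ha => by
    rw [← toQL_mem_gradedPart, ← hα]
    exact hT.graded p _ (toQL_mem_gradedPart.mpr ha)
  refine ⟨α, ⟨fun a => toQL_injective ?_, fun a => ?_, fun x a => toQL_injective ?_⟩, hα⟩
  · rw [← hα, toQL_star, map_star, hα, toQL_star]
  · induction a using local_induction with
    | hu x i j =>
      have h := isHomog_cellUnit (π := π) x i j
      rw [h, map_smul, hhom _ _ h]
    | hs c => simp
    | ha a b h1 h2 => simp [h1, h2]
    | hm a b h1 h2 => simp [h1, h2]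
  · obtain ⟨τ, hτ, hcomm⟩ := hT.shift x
    have := hcomm (toQL a)
    rw [hτ, hα, hα, hτ] at this
    exact this

theorem Restricts.isFCA (hα : IsLocalCA α) (h : Restricts T α) : IsFCA T where
  graded p a ha := by
    have : Set.MapsTo T (closure ((LocalAlgebra.graded π G p).map
        (toQL (π := π) (G := G)).toLinearMap : Set (QuasiLocal π G))) (closure
        ((LocalAlgebra.graded π G p).map (toQL (π := π) (G := G)).toLinearMap)) := by
      refine Set.MapsTo.closure ?_ (starAlgEquiv_continuous T)
      rintro _ ⟨b, hb, rfl⟩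
      refine ⟨α b, mem_graded_iff.mpr (hα.isHomog (mem_graded_iff.mp hb)), (h b).symm⟩
    exact this ha
  local_ := by
    obtain ⟨𝒩, h𝒩⟩ := IsLocalCA.exists_neighbourhood α
    refine ⟨𝒩, fun Λ a ha => ?_⟩
    obtain ⟨b, hb, rfl⟩ := mem_localSubalgebra.mp ha
    rw [h, toQL_mem_localSubalgebra, Finset.coe_add]
    exact hα.map_mem h𝒩 hb
  shift x := by
    obtain ⟨τ, hτ⟩ := exists_extension (FermionicCA.shift (π := π) x) (shift_bijective x)
      (shift_star x)
    refine ⟨τ, hτ, fun a => ?_⟩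
    refine denseRange_toQL.induction_on (p := fun a => T (τ a) = τ (T a)) a (isClosed_eq
      ((starAlgEquiv_continuous T).comp (starAlgEquiv_continuous τ))
      ((starAlgEquiv_continuous τ).comp (starAlgEquiv_continuous T))) fun b => ?_
    rw [hτ, h, h, hτ, hα.shift]

theorem IsLocalCA.exists_fca (hα : IsLocalCA α) (hbij : Function.Bijective α) :
    ∃ T, IsFCA T ∧ Restricts T α := by
  obtain ⟨T, hT⟩ := exists_extension α hbij hα.star
  exact ⟨T, Restricts.isFCA hα hT, hT⟩

theorem Restricts.isNeighbourhood_iff (hα : IsLocalCA α) (h : Restricts T α) {𝒩 : Finset G} :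
    IsNeighbourhood T 𝒩 ↔
      ∀ i j, α (FermionicCA.cellUnit π 0 i j) ∈ regionSub π (𝒩 : Set G) := by
  constructor
  · intro hN i j
    have := hN {0} (toQL (FermionicCA.cellUnit π 0 i j))
      (toQL_mem_localSubalgebra.mpr (cellUnit_mem (by simp) i j))
    rwa [h, toQL_mem_localSubalgebra, Finset.singleton_add, Finset.coe_vadd_finset,
      zero_vadd] at this
  · intro hN Λ a ha
    obtain ⟨b, hb, rfl⟩ := mem_localSubalgebra.mp ha
    rw [h, toQL_mem_localSubalgebra, Finset.coe_add]
    exact hα.map_mem hN hb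

theorem Restricts.ext (h : Restricts T α) (h' : Restricts T' α) : T = T' :=
  starAlgEquiv_ext fun a => (h a).trans (h' a).symm

theorem IsFCA.pow (hT : IsFCA T) (n : ℕ) : IsFCA (T ^ n) := by
  obtain ⟨α, hα, h⟩ := hT.exists_restricts
  have : ∀ n : ℕ, IsLocalCA (α ^ n) ∧ Restricts (T ^ n) (α ^ n) := by
    intro n
    induction n with
    | zero => exact ⟨⟨fun _ => rfl, fun _ => rfl, fun _ _ => rfl⟩, fun _ => rfl⟩
    | succ n ih =>
      obtain ⟨h1, h2⟩ := ih
      refine ⟨⟨fun a => ?_, fun a => ?_, fun x a => ?_⟩, fun a => ?_⟩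
      · rw [pow_succ, AlgHom.mul_apply, hα.star, h1.star, AlgHom.mul_apply]
      · rw [pow_succ, AlgHom.mul_apply, hα.twist, h1.twist, AlgHom.mul_apply]
      · rw [pow_succ, AlgHom.mul_apply, hα.shift, h1.shift, AlgHom.mul_apply]
      · rw [pow_succ, pow_succ, AlgHom.mul_apply, ← h2, ← h]
        rfl
  exact (this n).2.isFCA (this n).1

end LocalCA

/-! ### Relabelling along a map which is injective on a region only -/

section Graph

variable {κ : Type} [Fintype κ] [DecidableEq κ] {π : κ → ZMod 2} {G G' : Type}

/-- The graph of the relabelling of sites along `f` on the region `Λ`. It is a subalgebra for every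
map `f`; if `f` is injective on `Λ`, it is the graph of an isomorphism of `A(Λ)` onto `A(f(Λ))`. -/
def wrapGraph (π : κ → ZMod 2) (f : G → G') (Λ : Set G) :
    Subalgebra ℂ (LocalAlgebra π G × LocalAlgebra π G') :=
  Algebra.adjoin ℂ {p | ∃ x ∈ Λ, ∃ i j, p = (cellUnit π x i j, cellUnit π (f x) i j)}

variable {f : G → G'} {Λ Λ' : Set G}

theorem cellUnit_mem_wrapGraph {x : G} (hx : x ∈ Λ) (i j : κ) :
    (cellUnit π x i j, cellUnit π (f x) i j) ∈ wrapGraph π f Λ :=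
  Algebra.subset_adjoin ⟨x, hx, i, j, rfl⟩

theorem wrapGraph_mono (h : Λ ⊆ Λ') : wrapGraph π f Λ ≤ wrapGraph π f Λ' :=
  Algebra.adjoin_mono fun _ ⟨x, hx, i, j, ha⟩ => ⟨x, h hx, i, j, ha⟩

theorem wrapGraph_induction {p : LocalAlgebra π G → LocalAlgebra π G' → Prop}
    (hu : ∀ x ∈ Λ, ∀ i j, p (cellUnit π x i j) (cellUnit π (f x) i j))
    (hs : ∀ c : ℂ, p (algebraMap ℂ _ c) (algebraMap ℂ _ c))
    (ha : ∀ a a' b b', p a a' → p b b' → p (a + b) (a' + b'))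
    (hm : ∀ a a' b b', p a a' → p b b' → p (a * b) (a' * b'))
    {a : LocalAlgebra π G} {a' : LocalAlgebra π G'} (h : (a, a') ∈ wrapGraph π f Λ) : p a a' := by
  have : ∀ q : LocalAlgebra π G × LocalAlgebra π G', q ∈ wrapGraph π f Λ → p q.1 q.2 := by
    intro q hq
    induction hq using Algebra.adjoin_induction with
    | mem q h => obtain ⟨x, hx, i, j, rfl⟩ := h; exact hu x hx i j
    | algebraMap r => exact hs r
    | add a b _ _ h1 h2 => exact ha _ _ _ _ h1 h2
    | mul a b _ _ h1 h2 => exact hm _ _ _ _ h1 h2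
  exact this _ h

theorem wrapGraph_fst {a : LocalAlgebra π G} {a' : LocalAlgebra π G'}
    (h : (a, a') ∈ wrapGraph π f Λ) : a ∈ regionSub π Λ :=
  wrapGraph_induction (p := fun a _ => a ∈ regionSub π Λ) (fun _ hx => cellUnit_mem hx)
    (fun c => Subalgebra.algebraMap_mem _ c) (fun _ _ _ _ => add_mem) (fun _ _ _ _ => mul_mem) h

theorem wrapGraph_snd {a : LocalAlgebra π G} {a' : LocalAlgebra π G'}
    (h : (a, a') ∈ wrapGraph π f Λ) : a' ∈ regionSub π (f '' Λ) :=
  wrapGraph_induction (p := fun _ a => a ∈ regionSub π (f '' Λ))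
    (fun x hx => cellUnit_mem ⟨x, hx, rfl⟩)
    (fun c => Subalgebra.algebraMap_mem _ c) (fun _ _ _ _ => add_mem) (fun _ _ _ _ => mul_mem) h

theorem wrapGraph_exists_right {a : LocalAlgebra π G} (h : a ∈ regionSub π Λ) :
    ∃ a', (a, a') ∈ wrapGraph π f Λ := by
  induction h using regionSub_induction with
  | hu x hx i j => exact ⟨_, cellUnit_mem_wrapGraph hx i j⟩
  | hs c => exact ⟨_, Subalgebra.algebraMap_mem _ c⟩
  | ha a b _ _ h1 h2 =>
    obtain ⟨a', h1⟩ := h1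
    obtain ⟨b', h2⟩ := h2
    exact ⟨_, add_mem h1 h2⟩
  | hm a b _ _ h1 h2 =>
    obtain ⟨a', h1⟩ := h1
    obtain ⟨b', h2⟩ := h2
    exact ⟨_, mul_mem h1 h2⟩

theorem wrapGraph_exists_left {a' : LocalAlgebra π G'} (h : a' ∈ regionSub π (f '' Λ)) :
    ∃ a, (a, a') ∈ wrapGraph π f Λ := by
  induction h using regionSub_induction with
  | hu x hx i j =>
    obtain ⟨y, hy, rfl⟩ := hx
    exact ⟨_, cellUnit_mem_wrapGraph hy i j⟩
  | hs c => exact ⟨_, Subalgebra.algebraMap_mem _ c⟩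
  | ha a b _ _ h1 h2 =>
    obtain ⟨a', h1⟩ := h1
    obtain ⟨b', h2⟩ := h2
    exact ⟨_, add_mem h1 h2⟩
  | hm a b _ _ h1 h2 =>
    obtain ⟨a', h1⟩ := h1
    obtain ⟨b', h2⟩ := h2
    exact ⟨_, mul_mem h1 h2⟩

theorem map_mem_wrapGraph (e : Λ ↪ G') (he : ∀ x : Λ, e x = f x) (b : LocalAlgebra π Λ) :
    (LocalAlgebra.map (Function.Embedding.subtype (· ∈ Λ)) b, LocalAlgebra.map e b) ∈
      wrapGraph π f Λ := by
  induction b using local_induction with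
  | hu x i j =>
    rw [map_cellUnit, map_cellUnit, he]
    exact cellUnit_mem_wrapGraph x.2 i j
  | hs c =>
    rw [AlgHom.commutes, AlgHom.commutes]
    exact Subalgebra.algebraMap_mem _ c
  | ha a b h1 h2 => rw [map_add, map_add]; exact add_mem h1 h2
  | hm a b h1 h2 => rw [map_mul, map_mul]; exact mul_mem h1 h2

theorem exists_of_mem_wrapGraph (e : Λ ↪ G') (he : ∀ x : Λ, e x = f x) {a : LocalAlgebra π G}
    {a' : LocalAlgebra π G'} (h : (a, a') ∈ wrapGraph π f Λ) :
    ∃ b : LocalAlgebra π Λ, LocalAlgebra.map (Function.Embedding.subtype (· ∈ Λ)) b = a ∧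
      LocalAlgebra.map e b = a' := by
  refine wrapGraph_induction (p := fun a a' => ∃ b : LocalAlgebra π Λ,
    LocalAlgebra.map (Function.Embedding.subtype (· ∈ Λ)) b = a ∧ LocalAlgebra.map e b = a')
    ?_ ?_ ?_ ?_ h
  · intro x hx i j
    exact ⟨cellUnit π ⟨x, hx⟩ i j, by simp, by simp [he]⟩
  · intro c
    exact ⟨algebraMap ℂ _ c, AlgHom.commutes _ _, AlgHom.commutes _ _⟩
  · rintro _ _ _ _ ⟨a, rfl, rfl⟩ ⟨b, rfl, rfl⟩
    exact ⟨a + b, map_add _ _ _, map_add _ _ _⟩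
  · rintro _ _ _ _ ⟨a, rfl, rfl⟩ ⟨b, rfl, rfl⟩
    exact ⟨a * b, map_mul _ _ _, map_mul _ _ _⟩

variable [Nonempty κ] [Countable G] [Countable G']

/-- Where the relabelling is injective, identities hold on one lattice if and only if they hold on
the other. -/
theorem wrapGraph_eq_iff (hf : Set.InjOn f Λ) {a b : LocalAlgebra π G} {a' b' : LocalAlgebra π G'}
    (h1 : (a, a') ∈ wrapGraph π f Λ) (h2 : (b, b') ∈ wrapGraph π f Λ) : a = b ↔ a' = b' := by
  let e : Λ ↪ G' := ⟨fun x => f x, fun x y h => Subtype.ext (hf x.2 y.2 h)⟩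
  obtain ⟨c, rfl, rfl⟩ := exists_of_mem_wrapGraph e (fun _ => rfl) h1
  obtain ⟨d, rfl, rfl⟩ := exists_of_mem_wrapGraph e (fun _ => rfl) h2
  rw [(map_injective _).eq_iff, (map_injective _).eq_iff]

/-- Where the relabelling is injective, supports can be shrunk on both lattices simultaneously. -/
theorem wrapGraph_inter (hf : Set.InjOn f Λ) {a : LocalAlgebra π G} {a' : LocalAlgebra π G'}
    (h : (a, a') ∈ wrapGraph π f Λ) (ha : a ∈ regionSub π Λ') :
    (a, a') ∈ wrapGraph π f (Λ ∩ Λ') := by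
  obtain ⟨b, hb⟩ := wrapGraph_exists_right (f := f) (mem_regionSub_inter (wrapGraph_fst h) ha)
  rwa [(wrapGraph_eq_iff hf h (wrapGraph_mono Set.inter_subset_left hb)).mp rfl]

theorem wrapGraph_twist (p : ZMod 2) {a : LocalAlgebra π G} {a' : LocalAlgebra π G'}
    (h : (a, a') ∈ wrapGraph π f Λ) : (twist p a, twist p a') ∈ wrapGraph π f Λ := by
  refine wrapGraph_induction (p := fun a a' => (twist p a, twist p a') ∈ wrapGraph π f Λ)
    ?_ ?_ ?_ ?_ h
  · intro x hx i j
    rw [twist_cellUnit, twist_cellUnit]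
    exact Subalgebra.smul_mem _ (cellUnit_mem_wrapGraph hx i j) _
  · intro c
    rw [AlgHom.commutes, AlgHom.commutes]
    exact Subalgebra.algebraMap_mem _ c
  · intro _ _ _ _ h1 h2
    rw [map_add, map_add]; exact add_mem h1 h2
  · intro _ _ _ _ h1 h2
    rw [map_mul, map_mul]; exact mul_mem h1 h2

theorem wrapGraph_star [DecidableEq G] [DecidableEq G'] {a : LocalAlgebra π G}
    {a' : LocalAlgebra π G'}
    (h : (a, a') ∈ wrapGraph π f Λ) : (star a, star a') ∈ wrapGraph π f Λ := by
  refine wrapGraph_induction (p := fun a a' => (star a, star a') ∈ wrapGraph π f Λ)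
    ?_ ?_ ?_ ?_ h
  · intro x hx i j
    rw [star_cellUnit, star_cellUnit]
    exact cellUnit_mem_wrapGraph hx j i
  · intro c
    rw [← algebraMap_star_comm, ← algebraMap_star_comm]
    exact Subalgebra.algebraMap_mem _ _
  · intro _ _ _ _ h1 h2
    rw [star_add, star_add]; exact add_mem h1 h2
  · intro _ _ _ _ h1 h2
    rw [star_mul, star_mul]; exact mul_mem h2 h1

end Graph

section Rules

variable {κ : Type} [Fintype κ] [DecidableEq κ] {π : κ → ZMod 2} [Nonempty κ] {G G' : Type}
  [AddCommGroup G] [Countable G] [DecidableEq G] [AddCommGroup G'] [Countable G'] [DecidableEq G']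
  {f : G →+ G'} {Λ : Set G}

theorem wrapGraph_shift (x : G) {a : LocalAlgebra π G} {a' : LocalAlgebra π G'}
    (h : (a, a') ∈ wrapGraph π f Λ) : (shift x a, shift (f x) a') ∈ wrapGraph π f (x +ᵥ Λ) := by
  refine wrapGraph_induction
    (p := fun a a' => (shift x a, shift (f x) a') ∈ wrapGraph π f (x +ᵥ Λ)) ?_ ?_ ?_ ?_ h
  · intro y hy i j
    rw [shift_cellUnit, shift_cellUnit, ← map_add]
    exact cellUnit_mem_wrapGraph (Set.vadd_mem_vadd_set hy) i j
  · intro c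
    rw [AlgHom.commutes, AlgHom.commutes]
    exact Subalgebra.algebraMap_mem _ c
  · intro _ _ _ _ h1 h2
    rw [map_add, map_add]; exact add_mem h1 h2
  · intro _ _ _ _ h1 h2
    rw [map_mul, map_mul]; exact mul_mem h1 h2

/-- Automata with the same transition rule respect the relabelling. -/
theorem wrapGraph_map {α : LocalAlgebra π G →ₐ[ℂ] LocalAlgebra π G}
    {β : LocalAlgebra π G' →ₐ[ℂ] LocalAlgebra π G'} (hα : IsLocalCA α) (hβ : IsLocalCA β)
    {𝒩 : Set G}
    (hr : ∀ i j, (α (cellUnit π 0 i j), β (cellUnit π 0 i j)) ∈ wrapGraph π f 𝒩)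
    {a : LocalAlgebra π G} {a' : LocalAlgebra π G'}
    (h : (a, a') ∈ wrapGraph π f Λ) : (α a, β a') ∈ wrapGraph π f (Λ + 𝒩) := by
  refine wrapGraph_induction (p := fun a a' => (α a, β a') ∈ wrapGraph π f (Λ + 𝒩)) ?_ ?_ ?_ ?_ h
  · intro x hx i j
    rw [hα.cellUnit, hβ.cellUnit]
    refine wrapGraph_mono ?_ (wrapGraph_shift x (hr i j))
    rintro _ ⟨y, hy, rfl⟩
    exact Set.add_mem_add hx hy
  · intro c
    rw [AlgHom.commutes, AlgHom.commutes]
    exact Subalgebra.algebraMap_mem _ c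
  · intro _ _ _ _ h1 h2
    rw [map_add, map_add]; exact add_mem h1 h2
  · intro _ _ _ _ h1 h2
    rw [map_mul, map_mul]; exact mul_mem h1 h2

/-! ### Automata from transition rules -/

/-- The conditions on a transition rule that concern a single cell: the images of the matrix units
form a homogeneous system of matrix units. -/
structure IsRule (r : κ → κ → LocalAlgebra π G) : Prop where
  mul : ∀ i j k l, r i j * r k l = if j = k then r i l else 0
  one : ∑ i, r i i = 1
  homog : ∀ i j, IsHomog (π i + π j) (r i j)
  star : ∀ i j, star (r i j) = r j i

/-- The images of distinct cells under the transition rule graded-commute. -/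
def RuleComm (r : κ → κ → LocalAlgebra π G) : Prop :=
  ∀ x, x ≠ 0 → ∀ i j k l, r i j * shift x (r k l) =
    sgn ((π i + π j) * (π k + π l)) • (shift x (r k l) * r i j)

theorem IsLocalCA.isRule {α : LocalAlgebra π G →ₐ[ℂ] LocalAlgebra π G} (hα : IsLocalCA α) :
    IsRule fun i j => α (FermionicCA.cellUnit π 0 i j) where
  mul i j k l := by
    rw [← map_mul, cellUnit_mul]
    split_ifs
    · rfl
    · exact map_zero α
  one := by rw [← map_sum, sum_cellUnit, map_one]
  homog i j := hα.isHomog (isHomog_cellUnit 0 i j)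
  star i j := by rw [← hα.star, star_cellUnit]

theorem IsLocalCA.ruleComm {α : LocalAlgebra π G →ₐ[ℂ] LocalAlgebra π G} (hα : IsLocalCA α) :
    RuleComm fun i j => α (FermionicCA.cellUnit π 0 i j) := by
  intro x hx i j k l
  rw [← hα.shift, ← map_mul, ← map_mul, ← map_smul, shift_cellUnit, add_zero,
    cellUnit_comm hx.symm]

/-- A transition rule whose values at distinct cells graded-commute defines an automaton, by the
universal property of the local algebra. -/
theorem IsRule.exists_localCA {r : κ → κ → LocalAlgebra π G} (hr : IsRule r) (hc : RuleComm r) :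
    ∃ α, IsLocalCA α ∧ ∀ i j, α (cellUnit π 0 i j) = r i j := by
  let α : LocalAlgebra π G →ₐ[ℂ] LocalAlgebra π G :=
    LocalAlgebra.lift (fun x i j => shift x (r i j))
      (fun x i j k l => by
        rw [← map_mul, hr.mul]
        split_ifs
        · rfl
        · exact map_zero _)
      (fun x => by rw [← map_sum, hr.one, map_one])
      (fun x y hxy i j k l => by
        have := congrArg (shift x) (hc (y - x) (sub_ne_zero.mpr hxy.symm) i j k l)
        rw [map_mul, map_smul, map_mul, shift_shift, add_sub_cancel] at this
        exact this)
  have hα : ∀ x i j, α (cellUnit π x i j) = shift x (r i j) := fun x i j => lift_cellUnit ..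
  refine ⟨α, ⟨?_, fun a => ?_, fun x a => ?_⟩, fun i j => by rw [hα, shift_zero]⟩
  · refine map_star_of_cellUnit α fun x i j => ?_
    rw [hα, hα, ← shift_star, hr.star]
  · induction a using local_induction with
    | hu x i j =>
      rw [isHomog_cellUnit (π := π) x i j, map_smul, hα, shift_isHomog (hr.homog i j)]
    | hs c => simp
    | ha a b h1 h2 => simp [h1, h2]
    | hm a b h1 h2 => simp [h1, h2]
  · induction a using local_induction with
    | hu y i j => rw [shift_cellUnit, hα, hα, shift_shift]
    | hs c => simp
    | ha a b h1 h2 => simp [h1, h2]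
    | hm a b h1 h2 => simp [h1, h2]

section Transfer

variable {r : κ → κ → LocalAlgebra π G} {r' : κ → κ → LocalAlgebra π G'} {𝒩 : Set G}
  (hr : ∀ i j, (r i j, r' i j) ∈ wrapGraph π f 𝒩)

include hr

/-- The conditions on a single cell hold on both lattices or on neither. -/
theorem isRule_iff_of_wrapGraph (hf : Set.InjOn f 𝒩) : IsRule r ↔ IsRule r' := by
  have h1 : ∀ i j k l, (r i j * r k l = if j = k then r i l else 0) ↔
      r' i j * r' k l = if j = k then r' i l else 0 := fun i j k l => by
    refine wrapGraph_eq_iff (π := π) hf (mul_mem (hr i j) (hr k l)) ?_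
    split_ifs
    · exact hr i l
    · exact zero_mem _
  have h2 : (∑ i, r i i = 1) ↔ ∑ i, r' i i = 1 := by
    refine wrapGraph_eq_iff (π := π) hf ?_ (one_mem (wrapGraph π f 𝒩))
    have := sum_mem (S := wrapGraph π f 𝒩) (t := Finset.univ) fun i _ => hr i i
    convert this
    · rw [Prod.fst_sum]
    · rw [Prod.snd_sum]
  have h3 : ∀ i j, IsHomog (π i + π j) (r i j) ↔ IsHomog (π i + π j) (r' i j) := fun i j =>
    wrapGraph_eq_iff hf (wrapGraph_twist 1 (hr i j)) (Subalgebra.smul_mem _ (hr i j) _)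
  have h4 : ∀ i j, star (r i j) = r j i ↔ star (r' i j) = r' j i := fun i j =>
    wrapGraph_eq_iff hf (wrapGraph_star (hr i j)) (hr j i)
  exact ⟨fun h => ⟨fun i j k l => (h1 i j k l).mp (h.mul i j k l), h2.mp h.one,
      fun i j => (h3 i j).mp (h.homog i j), fun i j => (h4 i j).mp (h.star i j)⟩,
    fun h => ⟨fun i j k l => (h1 i j k l).mpr (h.mul i j k l), h2.mpr h.one,
      fun i j => (h3 i j).mpr (h.homog i j), fun i j => (h4 i j).mpr (h.star i j)⟩⟩

/-- If `f` is injective on the union of any two overlapping neighbourhoods, the commutation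
relations of the images of distinct cells hold on both lattices or on neither. -/
theorem ruleComm_iff_of_wrapGraph (hrule : IsRule r) (hrule' : IsRule r')
    (hreg : ∀ y : G, (𝒩 ∩ (y +ᵥ 𝒩)).Nonempty → Set.InjOn f (𝒩 ∪ (y +ᵥ 𝒩))) :
    RuleComm r ↔ RuleComm r' := by
  have key : ∀ y : G, (𝒩 ∩ (y +ᵥ 𝒩)).Nonempty → ∀ i j k l,
      (r i j * shift y (r k l) = sgn ((π i + π j) * (π k + π l)) • (shift y (r k l) * r i j) ↔
      r' i j * shift (f y) (r' k l) =
        sgn ((π i + π j) * (π k + π l)) • (shift (f y) (r' k l) * r' i j)) := by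
    intro y hy i j k l
    have h1 := wrapGraph_mono (Set.subset_union_left (t := y +ᵥ 𝒩)) (hr i j)
    have h2 := wrapGraph_mono (Set.subset_union_right (s := 𝒩)) (wrapGraph_shift y (hr k l))
    exact wrapGraph_eq_iff (hreg y hy) (mul_mem h1 h2) (Subalgebra.smul_mem _ (mul_mem h2 h1) _)
  constructor
  · intro h x hx i j k l
    by_cases hd : Disjoint (f '' 𝒩) (x +ᵥ f '' 𝒩)
    · have := (hrule'.homog i j).mul_comm_of_disjoint hd (wrapGraph_snd (hr i j))
        (shift_mem x (wrapGraph_snd (hr k l)))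
      rw [(shift_isHomog (hrule'.homog k l)).twist, smul_mul_assoc] at this
      exact this
    · rw [Set.not_disjoint_iff] at hd
      obtain ⟨_, ⟨u, hu, rfl⟩, ⟨_, ⟨v, hv, rfl⟩, huv⟩⟩ := hd
      have hx' : x = f (u - v) := by
        rw [map_sub, eq_sub_iff_add_eq]; exact huv
      subst hx'
      have hne : u - v ≠ 0 := by rintro h0; exact hx (by rw [h0, map_zero])
      refine (key (u - v) ⟨u, hu, v, hv, ?_⟩ i j k l).mp (h _ hne i j k l)
      simp
  · intro h y hy i j k l
    by_cases hd : Disjoint 𝒩 (y +ᵥ 𝒩)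
    · have := (hrule.homog i j).mul_comm_of_disjoint hd (wrapGraph_fst (hr i j))
        (shift_mem y (wrapGraph_fst (hr k l)))
      rw [(shift_isHomog (hrule.homog k l)).twist, smul_mul_assoc] at this
      exact this
    · have hne := Set.not_disjoint_iff_nonempty_inter.mp hd
      refine (key y hne i j k l).mpr (h _ (fun h0 => hy ?_) i j k l)
      obtain ⟨u, hu, v, hv, huv⟩ := hne
      have huv' : y + v = u := huv
      have : u = v := hreg y ⟨u, hu, v, hv, huv⟩ (Or.inl hu) (Or.inl hv) (by
        rw [← huv', map_add, h0, zero_add])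
      rw [← this] at huv'
      exact add_eq_right.mp huv'

end Transfer

/-- Endomorphisms of a finite system are invertible, since its algebra is simple and of finite
dimension. -/
theorem bijective_of_fintype [Fintype G] (φ : LocalAlgebra π G →ₐ[ℂ] LocalAlgebra π G) :
    Function.Bijective φ := by
  have h : Function.Injective φ := RingHom.injective φ.toRingHom
  exact ⟨h, LinearMap.surjective_of_injective (f := φ.toLinearMap) h⟩

end Rules

/-! ### Wrappings -/

section Wrapping

variable {κ : Type} [Fintype κ] [DecidableEq κ] {π : κ → ZMod 2} [Nonempty κ] {s : ℕ}

/-- The wrapping map as a homomorphism. -/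
def wrapHom (s n : ℕ) : ZLattice s →+ Torus s n where
  toFun := wrap n
  map_zero' := by funext t; simp [wrap]
  map_add' x y := by funext t; simp [wrap]

theorem coe_wrapHom (n : ℕ) : ⇑(wrapHom s n) = wrap n := rfl

/-- A regular wrapping is injective on the union of any two overlapping neighbourhoods. -/
theorem IsRegular.injOn_union {n : ℕ} {𝒩 : Finset (ZLattice s)} (h : IsRegular n 𝒩)
    (hinj : Set.InjOn (wrapHom s n) (𝒩 : Set (ZLattice s))) (y : ZLattice s)
    (hy : ((𝒩 : Set (ZLattice s)) ∩ (y +ᵥ (𝒩 : Set (ZLattice s)))).Nonempty) :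
    Set.InjOn (wrapHom s n) ((𝒩 : Set (ZLattice s)) ∪ (y +ᵥ (𝒩 : Set (ZLattice s)))) := by
  have hreg := h 0 y (by simpa using hy)
  rw [zero_vadd] at hreg
  have hinj' : Set.InjOn (wrapHom s n) (y +ᵥ (𝒩 : Set (ZLattice s))) := by
    rintro _ ⟨u, hu, rfl⟩ _ ⟨v, hv, rfl⟩ huv
    simp only [vadd_eq_add, map_add, add_right_inj] at huv
    rw [hinj hu hv huv]
  -- points of the two neighbourhoods with the same image lie in their intersection
  have cross : ∀ u ∈ (𝒩 : Set (ZLattice s)), ∀ v ∈ y +ᵥ (𝒩 : Set (ZLattice s)),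
      wrapHom s n u = wrapHom s n v → u = v := by
    intro u hu v hv huv
    have hv' : v ∈ (𝒩 : Set (ZLattice s)) ∩ (y +ᵥ (𝒩 : Set (ZLattice s))) := by
      rw [← hreg]
      exact ⟨⟨⟨u, hu, huv⟩, ⟨v, hv, rfl⟩⟩, Or.inr hv⟩
    exact hinj hu hv'.1 huv
  rintro u (hu | hu) v (hv | hv) huv
  · exact hinj hu hv huv
  · exact cross u hu v hv huv
  · exact (cross v hv u hu huv.symm).symm
  · exact hinj' hu hv huv

/-- A regular wrapping is injective on the neighbourhood: otherwise a translate of the finite set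
`𝒩` with the same image would coincide with it. -/
theorem IsRegular.injOn {n : ℕ} {𝒩 : Finset (ZLattice s)} (h : IsRegular n 𝒩) :
    Set.InjOn (wrapHom s n) (𝒩 : Set (ZLattice s)) := by
  intro a ha b hb hab
  by_contra hne
  have himg : wrap n '' ((a - b) +ᵥ (𝒩 : Set (ZLattice s))) = wrap n '' (𝒩 : Set _) := by
    have h0 : wrapHom s n (a - b) = 0 := by rw [map_sub, hab, sub_self]
    rw [← coe_wrapHom]
    ext z
    constructor
    · rintro ⟨_, ⟨u, hu, rfl⟩, rfl⟩
      exact ⟨u, hu, by simp [h0]⟩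
    · rintro ⟨u, hu, rfl⟩
      exact ⟨_, ⟨u, hu, rfl⟩, by simp [h0]⟩
  have hreg := h 0 (a - b) ⟨a, by simpa using ha, ⟨b, hb, by simp⟩⟩
  rw [zero_vadd, himg, Set.inter_self] at hreg
  have hsub : (𝒩 : Set (ZLattice s)) ⊆ (a - b) +ᵥ (𝒩 : Set (ZLattice s)) := by
    intro u hu
    have : u ∈ (𝒩 : Set (ZLattice s)) ∩ ((a - b) +ᵥ (𝒩 : Set (ZLattice s))) := by
      rw [← hreg]
      exact ⟨⟨u, hu, rfl⟩, Or.inl hu⟩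
    exact this.2
  -- then `𝒩` would be invariant under all multiples of `b - a`
  have hmul : ∀ k : ℕ, a + (k : ℤ) • (b - a) ∈ (𝒩 : Set (ZLattice s)) := by
    intro k
    induction k with
    | zero => simpa using ha
    | succ k ih =>
      obtain ⟨u, hu, huv⟩ := hsub ih
      have huv' : a - b + u = a + (k : ℤ) • (b - a) := huv
      have : u = a + ((k + 1 : ℕ) : ℤ) • (b - a) := by
        rw [eq_sub_of_add_eq' huv']
        push_cast
        rw [add_smul, one_smul]
        abel
      rw [← this]
      exact hu
  refine Set.infinite_of_injective_forall_mem (f := fun k : ℕ => a + (k : ℤ) • (b - a)) ?_ hmul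
    𝒩.finite_toSet
  intro k l hkl
  have h1 : (k : ℤ) • (b - a) = (l : ℤ) • (b - a) := add_left_cancel hkl
  have hba : b - a ≠ 0 := sub_ne_zero.mpr (Ne.symm hne)
  have := smul_left_injective ℤ hba h1
  exact_mod_cast this

variable {n : ℕ} {T : QuasiLocal π (ZLattice s) ≃⋆ₐ[ℂ] QuasiLocal π (ZLattice s)}
  {Tw : QuasiLocal π (Torus s n) ≃⋆ₐ[ℂ] QuasiLocal π (Torus s n)}
  {α : LocalAlgebra π (ZLattice s) →ₐ[ℂ] LocalAlgebra π (ZLattice s)}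
  {β : LocalAlgebra π (Torus s n) →ₐ[ℂ] LocalAlgebra π (Torus s n)}

/-- The transition rule of a wrapping corresponds to the transition rule of `T` on every
neighbourhood scheme of `T`. -/
theorem IsWrapping.mem_wrapGraph (h : IsWrapping n T Tw) (hα : Restricts T α)
    (hβ : Restricts Tw β) {𝒩 : Set (ZLattice s)}
    (h𝒩 : ∀ i j, α (cellUnit π 0 i j) ∈ regionSub π 𝒩) (i j : κ) :
    (α (cellUnit π 0 i j), β (cellUnit π 0 i j)) ∈ wrapGraph π (wrapHom s n) 𝒩 := by
  obtain ⟨-, 𝒩', -, hinj, hb⟩ := h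
  obtain ⟨b, h1, h2⟩ := hb i j
  rw [hα] at h1
  rw [hβ] at h2
  have hmem := map_mem_wrapGraph (f := wrapHom s n) (wrapEmb n 𝒩' hinj) (fun _ => rfl) b
  have h3 := toQL_injective h1
  have h4 := toQL_injective h2
  have : (α (cellUnit π 0 i j), β (cellUnit π 0 i j)) ∈
      wrapGraph π (wrapHom s n) (𝒩' : Set (ZLattice s)) := by
    rw [h3, h4]; exact hmem
  exact wrapGraph_mono Set.inter_subset_right (wrapGraph_inter hinj this (h𝒩 i j))

theorem isWrapping_of_mem_wrapGraph (hα' : IsLocalCA α) (hβ' : IsLocalCA β) (hα : Restricts T α)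
    (hβ : Restricts Tw β) {𝒩 : Finset (ZLattice s)}
    (hinj : Set.InjOn (wrapHom s n) (𝒩 : Set (ZLattice s)))
    (h : ∀ i j, (α (cellUnit π 0 i j), β (cellUnit π 0 i j)) ∈
      wrapGraph π (wrapHom s n) (𝒩 : Set (ZLattice s))) : IsWrapping n T Tw := by
  refine ⟨hβ.isFCA hβ', 𝒩, (hα.isNeighbourhood_iff hα').mpr fun i j => wrapGraph_fst (h i j),
    hinj, fun i j => ?_⟩
  obtain ⟨b, h1, h2⟩ := exists_of_mem_wrapGraph (wrapEmb n 𝒩 hinj) (fun _ => rfl) (h i j)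
  refine ⟨b, ?_, ?_⟩
  · rw [hα, ← h1]; rfl
  · rw [hβ, ← h2]

/-- The cell at the origin determines an automaton, so a wrapping is unique. -/
theorem IsWrapping.unique {Tw' : QuasiLocal π (Torus s n) ≃⋆ₐ[ℂ] QuasiLocal π (Torus s n)}
    (hT : IsFCA T) (h : IsWrapping n T Tw) (h' : IsWrapping n T Tw')
    {𝒩 : Finset (ZLattice s)} (h𝒩 : IsNeighbourhood T 𝒩)
    (hinj : Set.InjOn (wrapHom s n) (𝒩 : Set (ZLattice s))) : Tw = Tw' := by
  obtain ⟨α, hα', hα⟩ := hT.exists_restricts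
  obtain ⟨β, hβ', hβ⟩ := h.1.exists_restricts
  obtain ⟨γ, hγ', hγ⟩ := h'.1.exists_restricts
  rw [hα.isNeighbourhood_iff hα'] at h𝒩
  have : β = γ := hβ'.ext hγ' fun i j =>
    (wrapGraph_eq_iff hinj (h.mem_wrapGraph hα hβ h𝒩 i j) (h'.mem_wrapGraph hα hγ h𝒩 i j)).mp rfl
  subst this
  exact hβ.ext hγ

/-- The local form of a wrapping: `α` and `β` have the same transition rule on `𝒩`. -/
structure IsLocalWrapping (n : ℕ)
    (α : LocalAlgebra π (ZLattice s) →ₐ[ℂ] LocalAlgebra π (ZLattice s))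
    (β : LocalAlgebra π (Torus s n) →ₐ[ℂ] LocalAlgebra π (Torus s n)) (𝒩 : Finset (ZLattice s)) :
    Prop where
  left : IsLocalCA α
  right : IsLocalCA β
  rule : ∀ i j, (α (cellUnit π 0 i j), β (cellUnit π 0 i j)) ∈
    wrapGraph π (wrapHom s n) (𝒩 : Set (ZLattice s))

theorem IsLocalWrapping.of_mem {𝒩 𝒩' : Finset (ZLattice s)}
    (h : IsLocalWrapping n α β 𝒩) (hinj : Set.InjOn (wrapHom s n) (𝒩 : Set (ZLattice s)))
    (h𝒩' : ∀ i j, α (cellUnit π 0 i j) ∈ regionSub π (𝒩' : Set (ZLattice s))) :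
    IsLocalWrapping n α β 𝒩' :=
  ⟨h.left, h.right, fun i j =>
    wrapGraph_mono Set.inter_subset_right (wrapGraph_inter hinj (h.rule i j) (h𝒩' i j))⟩

/-- The axioms of a transition rule only involve the cell algebra at the origin and the pairs of
intersecting neighbourhoods, on which a regular wrapping is injective; so they carry over to the
torus. -/
theorem exists_isLocalWrapping [NeZero n] {𝒩 : Finset (ZLattice s)} (hα : IsLocalCA α)
    (h𝒩 : ∀ i j, α (cellUnit π 0 i j) ∈ regionSub π (𝒩 : Set (ZLattice s)))
    (hreg : IsRegular n 𝒩) :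
    ∃ β : LocalAlgebra π (Torus s n) →ₐ[ℂ] LocalAlgebra π (Torus s n),
      IsLocalWrapping n α β 𝒩 := by
  choose q hq using fun i j => wrapGraph_exists_right (f := wrapHom s n) (h𝒩 i j)
  have hrule := (isRule_iff_of_wrapGraph hq hreg.injOn).mp hα.isRule
  have hcomm := (ruleComm_iff_of_wrapGraph hq hα.isRule hrule
    (hreg.injOn_union hreg.injOn)).mp hα.ruleComm
  obtain ⟨β, hβ, hβr⟩ := hrule.exists_localCA hcomm
  exact ⟨β, hα, hβ, fun i j => by rw [hβr]; exact hq i j⟩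

theorem exists_isWrapping [NeZero n] (hT : IsFCA T) {𝒩 : Finset (ZLattice s)}
    (h𝒩 : IsNeighbourhood T 𝒩) (hreg : IsRegular n 𝒩) :
    ∃ Tw : QuasiLocal π (Torus s n) ≃⋆ₐ[ℂ] QuasiLocal π (Torus s n), IsWrapping n T Tw := by
  obtain ⟨α, hα', hα⟩ := hT.exists_restricts
  obtain ⟨β, hβ⟩ := exists_isLocalWrapping hα' ((hα.isNeighbourhood_iff hα').mp h𝒩) hreg
  obtain ⟨Tw, -, hTw⟩ := hβ.right.exists_fca (bijective_of_fintype β)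
  exact ⟨Tw, isWrapping_of_mem_wrapGraph hα' hβ.right hα hTw hreg.injOn hβ.rule⟩

end Wrapping

/-! ### Unitaries implementing automorphisms of finite systems -/

section Unitary

variable {κ : Type} [Fintype κ] [DecidableEq κ] {π : κ → ZMod 2} [Nonempty κ] {G : Type}
  [Fintype G] [DecidableEq G]

instance isCentral_localAlgebra : Algebra.IsCentral ℂ (LocalAlgebra π G) := by
  have := nontrivial_confSpace κ G
  have e1 := AlgEquiv.ofBijective (jordanWigner π G) (jordanWigner_bijective π)
  have e2 := Module.End.toContinuousLinearMap (𝕜 := ℂ) (ConfSpace κ G)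
  have e3 := algEquivMatrix (Module.finBasis ℂ (ConfSpace κ G))
  exact Algebra.IsCentral.of_algEquiv ℂ _ _ ((e1.trans e2.symm).trans e3).symm

/-- The quasi-local algebra of a finite system consists of all operators. -/
def operatorEquiv (π : κ → ZMod 2) (G : Type) [Fintype G] [DecidableEq G] :
    QuasiLocal π G ≃⋆ₐ[ℂ] (ConfSpace κ G →L[ℂ] ConfSpace κ G) :=
  StarAlgEquiv.ofBijective (quasiLocalSubalgebra π G).subtype
    ⟨Subtype.val_injective, fun a => by
      obtain ⟨b, hb⟩ := jordanWigner_surjective π a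
      exact ⟨toQL b, hb⟩⟩

/-- A `*`-automorphism of the algebra of all operators is inner. -/
theorem exists_unitary (T : QuasiLocal π G ≃⋆ₐ[ℂ] QuasiLocal π G) :
    ∃ U ∈ unitary (QuasiLocal π G), ∀ O, T O = star U * O * U := by
  let Φ := operatorEquiv π G
  let f := (Φ.symm.trans T).trans Φ
  have hf : Continuous f :=
    LinearMap.continuous_of_finiteDimensional (f.toAlgEquiv.toLinearMap)
  obtain ⟨V, hV⟩ := StarAlgEquiv.eq_linearIsometryEquivConjStarAlgEquiv f hf
  let W : ConfSpace κ G →L[ℂ] ConfSpace κ G := V.symm.toContinuousLinearEquiv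
  let W' : ConfSpace κ G →L[ℂ] ConfSpace κ G := V.toContinuousLinearEquiv
  have hW : star W = W' := by
    rw [ContinuousLinearMap.star_eq_adjoint]
    exact V.symm.adjoint_eq_symm
  have h1 : star W * W = 1 := by
    rw [hW]; ext1 x; exact V.apply_symm_apply x
  have h2 : W * star W = 1 := by
    rw [hW]; ext1 x; exact V.symm_apply_apply x
  refine ⟨Φ.symm W, ?_, fun O => Φ.injective ?_⟩
  · rw [Unitary.mem_iff, ← map_star, ← map_mul, ← map_mul, h1, h2, map_one]
    exact ⟨rfl, rfl⟩
  · have h3 : Φ (T O) = f (Φ O) := congrArg (fun z => Φ (T z)) (Φ.symm_apply_apply O).symm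
    change Φ (T O) = Φ (star (Φ.symm W) * O * Φ.symm W)
    rw [h3, hV, map_mul, map_mul, map_star, Φ.apply_symm_apply, hW]
    rfl

/-- An implementing unitary and its image under the parity automorphism implement the same graded
automorphism, so they agree up to a scalar, which is a sign. -/
theorem exists_isHomog_of_conj {u : LocalAlgebra π G} (h1 : star u * u = 1) (h2 : u * star u = 1)
    (h : ∀ a, twist 1 (star u * a * u) = star u * twist 1 a * u) : ∃ p, IsHomog p u := by
  have : Nontrivial (LocalAlgebra π G) := nontrivial_local π G
  set v := twist 1 u with hv
  have hv1 : star v * v = 1 := by rw [hv, ← twist_star, ← map_mul, h1, map_one]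
  have hvw : twist 1 v = u := twist_twist 1 u
  have hconj : ∀ a, star v * a * v = star u * a * u := fun a => by
    have := h (twist 1 a)
    rw [twist_twist, map_mul, map_mul, twist_twist, twist_star] at this
    exact this
  have hcen : u * star v ∈ Subalgebra.center ℂ (LocalAlgebra π G) := by
    rw [Subalgebra.mem_center_iff]
    intro a
    have hv2 : v * star v = 1 := by rw [hv, ← twist_star, ← map_mul, h2, map_one]
    calc a * (u * star v) = u * (star u * a * u) * star v := by
          simp only [← mul_assoc]; rw [h2, one_mul]
      _ = u * star v * a * (v * star v) := by rw [← hconj]; simp only [mul_assoc]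
      _ = u * star v * a := by rw [hv2, mul_one]
  obtain ⟨c, hc⟩ := (Algebra.IsCentral.mem_center_iff ℂ).mp hcen
  have huv : u = c • v := by
    have := congrArg (· * v) hc
    simp only [mul_assoc, hv1, mul_one] at this
    rw [this, Algebra.smul_def]
  have hvu : v = c • u := by
    have := congrArg (twist 1) huv
    rw [map_smul, hvw] at this
    exact this
  have hu0 : u ≠ 0 := by rintro rfl; simp at h2
  have hcc : (c * c) • u = (1 : ℂ) • u := by rw [mul_smul, ← hvu, ← huv, one_smul]
  have hc1 := smul_left_injective ℂ hu0 hcc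
  rcases mul_self_eq_one_iff.mp hc1 with rfl | rfl
  · exact ⟨0, by rw [IsHomog, sgn_zero]; exact hvu⟩
  · exact ⟨1, by rw [IsHomog]; exact hvu.trans (by simp [sgn])⟩

/-- An automaton of a finite system is implemented by a unitary of definite parity. -/
theorem exists_homogeneous_unitary [AddCommGroup G] {T : QuasiLocal π G ≃⋆ₐ[ℂ] QuasiLocal π G}
    (hT : IsFCA T) : ∃ U ∈ unitary (QuasiLocal π G),
      (∃ p, U ∈ gradedPart π G p) ∧ ∀ O, T O = star U * O * U := by
  obtain ⟨U, hU, hTU⟩ := exists_unitary T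
  refine ⟨U, hU, ?_, hTU⟩
  obtain ⟨α, hα, hTα⟩ := hT.exists_restricts
  obtain ⟨u, rfl⟩ := toQL_surjective U
  have hα' : ∀ a, α a = star u * a * u := fun a => toQL_injective (by
    rw [← hTα, hTU, map_mul, map_mul, toQL_star])
  rw [Unitary.mem_iff, ← toQL_star, ← map_mul, ← map_mul] at hU
  obtain ⟨p, hp⟩ := exists_isHomog_of_conj (u := u)
    (toQL_injective (hU.1.trans (map_one _).symm)) (toQL_injective (hU.2.trans (map_one _).symm))
    fun a => by rw [← hα', ← hα', hα.twist]
  exact ⟨p, toQL_mem_gradedPart.mpr hp⟩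

end Unitary

/-! ### Conjugation and compression -/

section Conjugation

variable {A : Type*} [Ring A] [StarRing A] [Algebra ℂ A] {T : A ≃⋆ₐ[ℂ] A} {p : A}

theorem compression_comm_iff (hp : p * p = p) :
    (∀ a, p * T a * p = T (p * a * p)) ↔ T p = p := by
  constructor
  · intro h
    have := h 1
    rw [map_one, mul_one, hp] at this
    exact this.symm
  · intro h a
    rw [map_mul, map_mul, h]

theorem map_eq_self_iff_commute {u : A} (hu : u ∈ unitary A) (h : ∀ a, T a = star u * a * u) :
    T p = p ↔ u * p = p * u := by
  rw [Unitary.mem_iff] at hu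
  rw [h]
  constructor
  · intro h1
    have := congrArg (u * ·) h1
    simp only [← mul_assoc, hu.2, one_mul] at this
    exact this.symm
  · intro h1
    rw [mul_assoc, ← h1, ← mul_assoc, hu.1, one_mul]

end Conjugation

/-! ### Tilings and product projections -/

/-- A family of disjoint copies of the tile `Λ₀` in `G`, indexed by the coarse-grained sites `X`. -/
structure Tiling (s N : ℕ) (X G : Type) where
  emb : X → tile s N ↪ G
  eq_of_emb_eq : ∀ {x y a b}, emb x a = emb y b → x = y

section Tiles

variable {κ : Type} [Fintype κ] [DecidableEq κ] {π : κ → ZMod 2} [Nonempty κ] {s N : ℕ}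
  {X G : Type} [DecidableEq X] [Countable G] [DecidableEq G] (t : Tiling s N X G)

/-- The union of the tiles with index in `F`. -/
def Tiling.tiles (F : Set X) : Set G := {g | ∃ x ∈ F, ∃ a, t.emb x a = g}

/-- The copy in the tile with index `x`. -/
def Tiling.copy (x : X) : LocalAlgebra π (tile s N) →ₐ[ℂ] LocalAlgebra π G :=
  LocalAlgebra.map (t.emb x)

/-- The product of the copies of `P` in the tiles with index in `F`. -/
def Tiling.proj (P : LocalAlgebra π (tile s N)) (F : Finset X) : LocalAlgebra π G :=
  (F.toList.map fun x => t.copy x P).prod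

theorem IsProjection.isHomog {P : LocalAlgebra π (tile s N)} (hP : IsProjection P) : IsHomog 0 P :=
  mem_graded_iff.mp hP.even

theorem IsProjection.star {P : LocalAlgebra π (tile s N)} (hP : IsProjection P) :
    Star.star P = P :=
  toQL_injective (by rw [toQL_star, hP.selfAdjoint])

namespace Tiling

variable {t} {P : LocalAlgebra π (tile s N)} {F F' : Finset X} {x y : X}

theorem tiles_mono {F F' : Set X} (h : F ⊆ F') : t.tiles F ⊆ t.tiles F' :=
  fun _ ⟨x, hx, a⟩ => ⟨x, h hx, a⟩

theorem disjoint_tiles {F F' : Set X} (h : Disjoint F F') :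
    Disjoint (t.tiles F) (t.tiles F') := by
  rw [Set.disjoint_left]
  rintro _ ⟨x, hx, a, rfl⟩ ⟨y, hy, b, h'⟩
  rw [t.eq_of_emb_eq h'] at hy
  exact Set.disjoint_left.mp h hx hy

theorem tiles_insert (x : X) (F : Set X) : t.tiles (insert x F) = t.tiles {x} ∪ t.tiles F := by
  ext g
  constructor
  · rintro ⟨y, rfl | hy, h⟩
    · exact Or.inl ⟨_, rfl, h⟩
    · exact Or.inr ⟨y, hy, h⟩
  · rintro (⟨y, rfl, h⟩ | ⟨y, hy, h⟩)
    · exact ⟨_, Or.inl rfl, h⟩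
    · exact ⟨y, Or.inr hy, h⟩

theorem tiles_singleton (x : X) : t.tiles {x} = Set.range (t.emb x) := by
  ext g
  constructor
  · rintro ⟨y, rfl, h⟩; exact h
  · exact fun h => ⟨x, rfl, h⟩

theorem copy_mem (x : X) (a : LocalAlgebra π (tile s N)) :
    t.copy x a ∈ regionSub π (t.tiles {x}) := by
  rw [tiles_singleton]
  exact map_mem_range _ a

theorem copy_mem_of_mem {F : Set X} (hx : x ∈ F) (a : LocalAlgebra π (tile s N)) :
    t.copy x a ∈ regionSub π (t.tiles F) :=
  regionSub_mono (tiles_mono (Set.singleton_subset_iff.mpr hx)) (copy_mem x a)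

theorem exists_copy_eq {a : LocalAlgebra π G} (h : a ∈ regionSub π (t.tiles {x})) :
    ∃ b, t.copy x b = a := by
  rw [tiles_singleton, ← range_map] at h
  exact h

theorem copy_isHomog {p : ZMod 2} {a : LocalAlgebra π (tile s N)} (h : IsHomog p a) :
    IsHomog p (t.copy x a) := h.map _

theorem copy_star (a : LocalAlgebra π (tile s N)) : t.copy x (star a) = star (t.copy x a) :=
  map_star' _ a

theorem copy_mul_copy (hxy : x ≠ y) {p q : ZMod 2} {a b : LocalAlgebra π (tile s N)}
    (ha : IsHomog p a) (hb : IsHomog q b) :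
    t.copy x a * t.copy y b = sgn (p * q) • (t.copy y b * t.copy x a) := by
  rw [(copy_isHomog ha).mul_comm_of_disjoint (disjoint_tiles (by simpa using hxy)) (copy_mem x a)
    (copy_mem y b), (copy_isHomog hb).twist, smul_mul_assoc]

theorem commute_copy_proj (hP : IsProjection P) (x y : X) :
    Commute (t.copy x P) (t.copy y P) := by
  by_cases h : x = y
  · subst h; exact Commute.refl _
  · have := copy_mul_copy (t := t) h hP.isHomog hP.isHomog
    rwa [mul_zero, sgn_zero, one_smul] at this

theorem copy_idem (hP : IsProjection P) : t.copy x P * t.copy x P = t.copy x P := by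
  rw [← map_mul, hP.idem]

theorem proj_empty : t.proj P ∅ = 1 := by simp [proj]

theorem proj_insert (hP : IsProjection P) (hx : x ∉ F) :
    t.proj P (insert x F) = t.copy x P * t.proj P F := by
  have hc : ∀ F : Finset X, (F : Set X).Pairwise
      (Function.onFun Commute fun x => t.copy x P) :=
    fun F x _ y _ _ => commute_copy_proj hP x y
  have key : ∀ F : Finset X, t.proj P F = F.noncommProd (fun x => t.copy x P) (hc F) :=
    fun F => by
    have := Finset.noncommProd_toFinset F.toList (fun x => t.copy x P)
      (fun x _ y _ _ => commute_copy_proj hP x y) F.nodup_toList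
    rw [proj, ← this]
    simp only [Finset.toList_toFinset]
  rw [key, key, Finset.noncommProd_insert_of_notMem _ _ _ (hc _) hx]

theorem proj_isHomog (hP : IsProjection P) : IsHomog 0 (t.proj P F) := by
  induction F using Finset.induction_on with
  | empty => rw [proj_empty]; exact isHomog_one
  | insert x F hx ih =>
    rw [proj_insert hP hx]
    exact (copy_isHomog hP.isHomog).mul ih

theorem proj_mem (hP : IsProjection P) : t.proj P F ∈ regionSub π (t.tiles F) := by
  induction F using Finset.induction_on with
  | empty => rw [proj_empty]; exact one_mem _
  | insert x F hx ih =>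
    rw [proj_insert hP hx]
    exact mul_mem (copy_mem_of_mem (by simp) P)
      (regionSub_mono (tiles_mono (by simp)) ih)

/-- The product projection commutes with everything outside its tiles. -/
theorem proj_comm (hP : IsProjection P) {Λ : Set G} (h : Disjoint (t.tiles F) Λ)
    {a : LocalAlgebra π G} (ha : a ∈ regionSub π Λ) : t.proj P F * a = a * t.proj P F :=
  (proj_isHomog hP).comm_of_disjoint h (proj_mem hP) ha

theorem copy_proj_comm (hP : IsProjection P) (F : Finset X) (x : X) :
    t.copy x P * t.proj P F = t.proj P F * t.copy x P := by
  induction F using Finset.induction_on with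
  | empty => rw [proj_empty, mul_one, one_mul]
  | insert y F hy ih =>
    rw [proj_insert hP hy, ← mul_assoc, (commute_copy_proj hP x y).eq, mul_assoc, ih, mul_assoc]

theorem copy_mul_proj (hP : IsProjection P) (hx : x ∈ F) :
    t.copy x P * t.proj P F = t.proj P F := by
  rw [← Finset.insert_erase hx, proj_insert hP (by simp), ← mul_assoc, copy_idem hP]

theorem proj_mul_proj (hP : IsProjection P) (h : F ⊆ F') :
    t.proj P F * t.proj P F' = t.proj P F' := by
  induction F using Finset.induction_on with
  | empty => rw [proj_empty, one_mul]
  | insert x F hx ih =>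
    rw [proj_insert hP hx, mul_assoc, ih ((Finset.subset_insert _ _).trans h),
      copy_mul_proj hP (h (by simp))]

theorem proj_mul_proj' (hP : IsProjection P) (h : F ⊆ F') :
    t.proj P F' * t.proj P F = t.proj P F' := by
  induction F using Finset.induction_on with
  | empty => rw [proj_empty, mul_one]
  | insert x F hx ih =>
    rw [proj_insert hP hx, ← mul_assoc, ← copy_proj_comm hP, copy_mul_proj hP (h (by simp)),
      ih ((Finset.subset_insert _ _).trans h)]

theorem proj_idem (hP : IsProjection P) : t.proj P F * t.proj P F = t.proj P F :=
  proj_mul_proj hP subset_rfl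

theorem proj_star (hP : IsProjection P) : star (t.proj P F) = t.proj P F := by
  induction F using Finset.induction_on with
  | empty => rw [proj_empty, star_one]
  | insert x F hx ih =>
    rw [proj_insert hP hx, star_mul, ih, ← copy_star, hP.star, copy_proj_comm hP]

/-- The factors of the product projection are tensor factors, so their product does not vanish. -/
theorem proj_ne_zero (hP : IsProjection P) : t.proj P F ≠ 0 := by
  induction F using Finset.induction_on with
  | empty =>
    have := nontrivial_local π G
    rw [proj_empty]; exact one_ne_zero
  | insert x F hx ih =>
    rw [proj_insert hP hx]
    intro h
    have h0 := eq_zero_of_mul_eq_zero (disjoint_tiles (F := {x}) (F' := F) (by simpa using hx))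
      (copy_mem x P) (proj_mem hP) ih (proj_isHomog hP) h
    exact hP.ne_zero (map_injective (t.emb x) (h0.trans (map_zero _).symm))

theorem proj_union (hP : IsProjection P) (F F' : Finset X) :
    t.proj P (F ∪ F') = t.proj P F * t.proj P F' := by
  induction F using Finset.induction_on with
  | empty => rw [proj_empty, one_mul, Finset.empty_union]
  | insert x F hx ih =>
    rw [proj_insert hP hx, mul_assoc, ← ih, Finset.insert_union]
    by_cases h : x ∈ F'
    · have h' : x ∈ F ∪ F' := Finset.mem_union_right _ h
      rw [Finset.insert_eq_of_mem h', copy_mul_proj hP h']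
    · rw [proj_insert hP (by simp [hx, h])]

end Tiling

end Tiles

/-! ### The product of the tile isometries -/

section Isometry

variable {κ : Type} [Fintype κ] [DecidableEq κ] {π : κ → ZMod 2} [Nonempty κ] {s N : ℕ}
  {X G : Type} [DecidableEq X] [Countable X] [Countable G] [DecidableEq G] (t : Tiling s N X G)
  {P : LocalAlgebra π (tile s N)} {r : ℕ} {π' : Fin r → ZMod 2} (E₀ : TileIsometry P r π')

theorem TileIsometry.isHomog (i j : Fin r) : IsHomog (π' i + π' j) (E₀.unit i j) :=
  mem_graded_iff.mp (E₀.unit_graded i j)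

theorem TileIsometry.star (i j : Fin r) : Star.star (E₀.unit i j) = E₀.unit j i :=
  toQL_injective (by rw [toQL_star, E₀.unit_star])

theorem TileIsometry.proj_mul (i j : Fin r) : P * E₀.unit i j = E₀.unit i j := by
  refine (congrArg (· * E₀.unit i j) E₀.sum_unit.symm).trans ?_
  simp [Finset.sum_mul, E₀.unit_mul]

theorem TileIsometry.mul_proj (i j : Fin r) : E₀.unit i j * P = E₀.unit i j := by
  refine (congrArg (E₀.unit i j * ·) E₀.sum_unit.symm).trans ?_
  simp [Finset.mul_sum, E₀.unit_mul]

theorem TileIsometry.nonempty (E₀ : TileIsometry P r π') (hP : IsProjection P) :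
    Nonempty (Fin r) := by
  by_contra h
  rw [not_nonempty_iff] at h
  exact hP.ne_zero (E₀.sum_unit.symm.trans (by simp))

/-- The correspondence of the cell algebras with their images in the tiles, without the projections
of the other tiles. As the image of the unit of a cell is not the unit of the tile, this is a
relation rather than the graph of a map. -/
def Tiling.isoGraph (F : Set X) : Subalgebra ℂ (LocalAlgebra π' X × LocalAlgebra π G) :=
  Algebra.adjoin ℂ {p | ∃ x ∈ F, ∃ i j, p = (cellUnit π' x i j, t.copy x (E₀.unit i j))}

namespace Tiling

variable {t E₀} {F F' : Set X}

theorem mem_isoGraph {x : X} (hx : x ∈ F) (i j : Fin r) :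
    (cellUnit π' x i j, t.copy x (E₀.unit i j)) ∈ t.isoGraph E₀ F :=
  Algebra.subset_adjoin ⟨x, hx, i, j, rfl⟩

theorem isoGraph_mono (h : F ⊆ F') : t.isoGraph E₀ F ≤ t.isoGraph E₀ F' :=
  Algebra.adjoin_mono fun _ ⟨x, hx, i, j, ha⟩ => ⟨x, h hx, i, j, ha⟩

theorem isoGraph_induction {p : LocalAlgebra π' X → LocalAlgebra π G → Prop}
    (hu : ∀ x ∈ F, ∀ i j, p (cellUnit π' x i j) (t.copy x (E₀.unit i j)))
    (hs : ∀ c : ℂ, p (algebraMap ℂ _ c) (algebraMap ℂ _ c))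
    (ha : ∀ a a' b b', p a a' → p b b' → p (a + b) (a' + b'))
    (hm : ∀ a a' b b', p a a' → p b b' → p (a * b) (a' * b'))
    {a : LocalAlgebra π' X} {a' : LocalAlgebra π G} (h : (a, a') ∈ t.isoGraph E₀ F) : p a a' := by
  have : ∀ q : LocalAlgebra π' X × LocalAlgebra π G, q ∈ t.isoGraph E₀ F → p q.1 q.2 := by
    intro q hq
    induction hq using Algebra.adjoin_induction with
    | mem q h => obtain ⟨x, hx, i, j, rfl⟩ := h; exact hu x hx i j
    | algebraMap r => exact hs r
    | add a b _ _ h1 h2 => exact ha _ _ _ _ h1 h2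
    | mul a b _ _ h1 h2 => exact hm _ _ _ _ h1 h2
  exact this _ h

theorem isoGraph_snd {a' : LocalAlgebra π' X} {a : LocalAlgebra π G}
    (h : (a', a) ∈ t.isoGraph E₀ F) : a ∈ regionSub π (t.tiles F) :=
  isoGraph_induction (p := fun _ a => a ∈ regionSub π (t.tiles F))
    (fun _ hx _ _ => copy_mem_of_mem hx _)
    (fun c => Subalgebra.algebraMap_mem _ c) (fun _ _ _ _ => add_mem) (fun _ _ _ _ => mul_mem) h

/-- The image of a coarse-grained cell commutes with the product projections: in its own tile the
factor `P` acts as the unit of the cell, the other factors are even and supported elsewhere. -/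
theorem copy_unit_comm_proj (hP : IsProjection P) (x : X) (i j : Fin r) (H : Finset X) :
    t.copy x (E₀.unit i j) * t.proj P H = t.proj P H * t.copy x (E₀.unit i j) := by
  by_cases hx : x ∈ H
  · rw [← Finset.insert_erase hx, proj_insert hP (by simp), ← mul_assoc, ← map_mul, E₀.mul_proj,
      ← proj_comm hP (disjoint_tiles (F' := {x}) (by simp)) (copy_mem x _)]
    rw [← proj_comm hP (disjoint_tiles (F' := {x}) (by simp)) (copy_mem x _), mul_assoc,
      ← map_mul, E₀.proj_mul]
  · rw [proj_comm hP (disjoint_tiles (F' := {x}) (by simpa using hx)) (copy_mem x _)]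

theorem isoGraph_comm_proj (hP : IsProjection P) (H : Finset X) {a' : LocalAlgebra π' X}
    {a : LocalAlgebra π G} (h : (a', a) ∈ t.isoGraph E₀ F) :
    a * t.proj P H = t.proj P H * a := by
  refine isoGraph_induction (p := fun _ a => a * t.proj P H = t.proj P H * a) ?_ ?_ ?_ ?_ h
  · intro x _ i j
    exact copy_unit_comm_proj hP x i j H
  · intro c; exact Algebra.commutes c _
  · intro _ _ _ _ h1 h2
    rw [add_mul, h1, h2, mul_add]
  · intro _ a _ b h1 h2
    rw [mul_assoc, h2, ← mul_assoc, h1, mul_assoc]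

/-- The compression of an operator on the tiles of `F` to the product projection is the image of an
operator of the coarse-grained cells. -/
theorem exists_isoGraph_of_mem (hP : IsProjection P) (F : Finset X) {a : LocalAlgebra π G}
    (ha : a ∈ regionSub π (t.tiles F)) :
    ∃ b' b, (b', b) ∈ t.isoGraph E₀ (F : Set X) ∧
      t.proj P F * a * t.proj P F = b * t.proj P F := by
  induction F using Finset.induction_on generalizing a with
  | empty =>
    have : t.tiles ((∅ : Finset X) : Set X) = ∅ := by
      ext g; simp [tiles]
    rw [this] at ha
    have : ∃ c : ℂ, a = algebraMap ℂ _ c := by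
      induction ha using regionSub_induction with
      | hu x hx i j => exact hx.elim
      | hs c => exact ⟨c, rfl⟩
      | ha a b _ _ h1 h2 =>
        obtain ⟨c, rfl⟩ := h1
        obtain ⟨d, rfl⟩ := h2
        exact ⟨c + d, (map_add _ _ _).symm⟩
      | hm a b _ _ h1 h2 =>
        obtain ⟨c, rfl⟩ := h1
        obtain ⟨d, rfl⟩ := h2
        exact ⟨c * d, (map_mul _ _ _).symm⟩
    obtain ⟨c, rfl⟩ := this
    exact ⟨_, _, Subalgebra.algebraMap_mem _ c, by rw [proj_empty, one_mul]⟩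
  | insert x F hx ih =>
    rw [Finset.coe_insert, tiles_insert] at ha
    replace ha := regionSub_union_le _ _ ha
    induction ha using Submodule.mul_induction_on' with
    | mem_mul_mem a₁ h1 a₂ h2 =>
      have h1 : a₁ ∈ regionSub π (t.tiles {x}) := h1
      have h2 : a₂ ∈ regionSub π (t.tiles (F : Set X)) := h2
      obtain ⟨b₂', b₂, hb₂, hb⟩ := ih h2
      obtain ⟨a₀, rfl⟩ := exists_copy_eq h1
      have hcell : ∃ c' c, (c', c) ∈ t.isoGraph E₀ ((insert x F : Finset X) : Set X) ∧
          t.copy x (P * a₀ * P) = c := by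
        have h0 := E₀.corner a₀
        generalize P * a₀ * P = a₁ at h0
        induction h0 using Submodule.span_induction with
        | mem a h =>
          obtain ⟨ij, rfl⟩ := h
          exact ⟨_, _, mem_isoGraph (by simp) ij.1 ij.2, rfl⟩
        | zero => exact ⟨0, 0, zero_mem _, map_zero _⟩
        | add a b _ _ h1 h2 =>
          obtain ⟨c', c, h1, h1'⟩ := h1
          obtain ⟨d', d, h2, h2'⟩ := h2
          exact ⟨c' + d', c + d, add_mem h1 h2, by rw [map_add, h1', h2']⟩
        | smul k a _ h1 =>
          obtain ⟨c', c, h1, h1'⟩ := h1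
          exact ⟨_, _, Subalgebra.smul_mem _ h1 k, by rw [map_smul, h1']⟩
      obtain ⟨c', c, hc, hc'⟩ := hcell
      have hd : Disjoint (t.tiles (F : Set X)) (t.tiles {x}) :=
        disjoint_tiles (by simpa using hx)
      refine ⟨_, _, mul_mem hc (isoGraph_mono (by simp) hb₂), ?_⟩
      have e1 : t.copy x a₀ * t.proj P F = t.proj P F * t.copy x a₀ :=
        (proj_comm hP hd (copy_mem x a₀)).symm
      have e2 : a₂ * t.copy x P = t.copy x P * a₂ :=
        ((copy_isHomog hP.isHomog).comm_of_disjoint hd.symm (copy_mem x P) h2).symm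
      have e3 : b₂ * t.copy x P = t.copy x P * b₂ :=
        ((copy_isHomog hP.isHomog).comm_of_disjoint hd.symm (copy_mem x P)
          (isoGraph_snd hb₂)).symm
      have e4 : t.copy x P * t.copy x a₀ * t.copy x P = c := by
        rw [← map_mul, ← map_mul, hc']
      have e5 : c * t.copy x P = c := by
        rw [← e4, mul_assoc, copy_idem hP]
      have e6 := copy_proj_comm (t := t) hP F x
      rw [proj_insert hP hx]
      calc t.copy x P * t.proj P F * (t.copy x a₀ * a₂) * (t.copy x P * t.proj P F)
          = t.copy x P * (t.proj P F * t.copy x a₀) * (a₂ * t.copy x P) * t.proj P F := by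
            simp only [mul_assoc]
        _ = t.copy x P * t.copy x a₀ * (t.proj P F * t.copy x P) * a₂ * t.proj P F := by
            rw [← e1, e2]; simp only [mul_assoc]
        _ = t.copy x P * t.copy x a₀ * t.copy x P * (t.proj P F * a₂ * t.proj P F) := by
            rw [← e6]; simp only [mul_assoc]
        _ = c * (b₂ * t.proj P F) := by rw [e4, hb]
        _ = c * b₂ * (t.copy x P * t.proj P F) := by
            rw [← mul_assoc, mul_assoc c b₂ (_ * _), ← mul_assoc b₂, e3, mul_assoc (t.copy x P),
              ← mul_assoc c (t.copy x P), e5, mul_assoc]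
    | add a b _ _ h1 h2 =>
      obtain ⟨c', c, h1, h1'⟩ := h1
      obtain ⟨d', d, h2, h2'⟩ := h2
      exact ⟨c' + d', c + d, add_mem h1 h2, by rw [mul_add, add_mul, h1', h2', add_mul]⟩

end Tiling

end Isometry

/-! ### The lattice isometry of a finite system -/

section Corner

variable {κ : Type} [Fintype κ] [DecidableEq κ] {π : κ → ZMod 2} {X : Type}

/-- The corner `p A p` of an algebra as an algebra with unit `p`. -/
@[reducible]
def cornerAlgebra {A : Type*} [Ring A] [Algebra ℂ A] {p : A} (hp : IsIdempotentElem p) :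
    Algebra ℂ hp.Corner :=
  RingHom.toAlgebra'
    { toFun := fun c => ⟨c • p, (Subsemigroup.mem_corner_iff hp).mpr
        ⟨by rw [mul_smul_comm, hp.eq], by rw [smul_mul_assoc, hp.eq]⟩⟩
      map_one' := Subtype.ext (one_smul ℂ p)
      map_mul' := fun c d => Subtype.ext (by
        change (c * d) • p = c • p * d • p
        rw [smul_mul_smul_comm, hp.eq])
      map_zero' := Subtype.ext (zero_smul ℂ p)
      map_add' := fun c d => Subtype.ext (add_smul c d p) }
    fun c x => Subtype.ext (by
      have hx := (Subsemigroup.mem_corner_iff hp).mp x.2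
      change c • p * x.1 = x.1 * c • p
      rw [smul_mul_assoc, mul_smul_comm, hx.1, hx.2])

/-- The universal property of the local algebra for homomorphisms which map the unit to a
projection. -/
theorem exists_lift_corner {A : Type*} [Ring A] [Algebra ℂ A] {p : A} (hp : p * p = p)
    (e : X → κ → κ → A) (hl : ∀ x i j, p * e x i j = e x i j) (hr : ∀ x i j, e x i j * p = e x i j)
    (hmul : ∀ x i j k l, e x i j * e x k l = if j = k then e x i l else 0)
    (hone : ∀ x, ∑ i, e x i i = p)
    (hcomm : ∀ x y, x ≠ y → ∀ i j k l, e x i j * e y k l =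
      sgn ((π i + π j) * (π k + π l)) • (e y k l * e x i j)) :
    ∃ E : LocalAlgebra π X →ₗ[ℂ] A, E 1 = p ∧ (∀ a b, E (a * b) = E a * E b) ∧
      ∀ x i j, E (cellUnit π x i j) = e x i j := by
  have hp' : IsIdempotentElem p := hp
  let _ := cornerAlgebra hp'
  have hsmul : ∀ (c : ℂ) (x : hp'.Corner), (c • x).1 = c • x.1 := fun c x => by
    have hx := (Subsemigroup.mem_corner_iff hp').mp x.2
    rw [Algebra.smul_def]
    change c • p * x.1 = c • x.1
    rw [smul_mul_assoc, hx.1]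
  let val : hp'.Corner →+ A :=
    { toFun := Subtype.val, map_zero' := rfl, map_add' := fun _ _ => rfl }
  let e' : X → κ → κ → hp'.Corner := fun x i j =>
    ⟨e x i j, (Subsemigroup.mem_corner_iff hp').mpr ⟨hl x i j, hr x i j⟩⟩
  let L : LocalAlgebra π X →ₐ[ℂ] hp'.Corner := LocalAlgebra.lift e'
    (fun x i j k l => Subtype.ext (by
      refine (hmul x i j k l).trans ?_
      split_ifs <;> rfl))
    (fun x => Subtype.ext (by
      change val (∑ i, e' x i i) = p
      rw [map_sum]
      exact hone x))
    (fun x y hxy i j k l => Subtype.ext (by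
      rw [hsmul]
      exact hcomm x y hxy i j k l))
  refine ⟨{ toFun := fun a => (L a).1
            map_add' := fun a b => by rw [map_add]; rfl
            map_smul' := fun c a => by rw [map_smul, hsmul]; rfl }, ?_, fun a b => ?_,
    fun x i j => ?_⟩
  · change (L 1).1 = p
    rw [map_one]; rfl
  · change (L (a * b)).1 = (L a).1 * (L b).1
    rw [map_mul]; rfl
  · change (L (cellUnit π x i j)).1 = _
    exact congrArg Subtype.val (lift_cellUnit (π := π) e' _ _ _ x i j)

end Corner

section Isometry

variable {κ : Type} [Fintype κ] [DecidableEq κ] {π : κ → ZMod 2} [Nonempty κ] {s N : ℕ}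
  {X G : Type} [DecidableEq X] [Fintype X] [Countable G] [DecidableEq G] {t : Tiling s N X G}
  {P : LocalAlgebra π (tile s N)} {r : ℕ} {π' : Fin r → ZMod 2} {E₀ : TileIsometry P r π'}

/-- The product of the copies of the tile isometry, on local algebras. -/
structure Tiling.IsIsometry (t : Tiling s N X G) (E₀ : TileIsometry P r π')
    (E : LocalAlgebra π' X →ₗ[ℂ] LocalAlgebra π G) : Prop where
  one : E 1 = t.proj P Finset.univ
  mul : ∀ a b, E (a * b) = E a * E b
  unit : ∀ x i j, E (cellUnit π' x i j) = t.copy x (E₀.unit i j) * t.proj P Finset.univ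

theorem Tiling.exists_isIsometry (hP : IsProjection P) : ∃ E, t.IsIsometry E₀ E := by
  have hc : ∀ x i j, t.copy x (E₀.unit i j) * t.proj P Finset.univ =
      t.proj P Finset.univ * t.copy x (E₀.unit i j) := fun x i j =>
    Tiling.copy_unit_comm_proj hP x i j _
  have hi := Tiling.proj_idem (t := t) (F := Finset.univ) hP
  have hm : ∀ x i j y k l,
      t.copy x (E₀.unit i j) * t.proj P Finset.univ * (t.copy y (E₀.unit k l) *
        t.proj P Finset.univ) =
      t.copy x (E₀.unit i j) * t.copy y (E₀.unit k l) * t.proj P Finset.univ := by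
    intro x i j y k l
    rw [mul_assoc, ← mul_assoc (t.proj P Finset.univ), ← hc, mul_assoc, hi, ← mul_assoc]
  obtain ⟨E, h1, h2, h3⟩ := exists_lift_corner (π := π') hi
    (fun x i j => t.copy x (E₀.unit i j) * t.proj P Finset.univ)
    (fun x i j => by rw [hc, ← mul_assoc, hi])
    (fun x i j => by rw [mul_assoc, hi])
    (fun x i j k l => by
      rw [hm, ← map_mul, E₀.unit_mul]
      split_ifs
      · rfl
      · rw [map_zero, zero_mul])
    (fun x => by
      rw [← Finset.sum_mul, ← map_sum, E₀.sum_unit]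
      exact Tiling.copy_mul_proj hP (Finset.mem_univ x))
    (fun x y hxy i j k l => by
      rw [hm, hm, Tiling.copy_mul_copy hxy (E₀.isHomog i j) (E₀.isHomog k l), smul_mul_assoc])
  exact ⟨E, h1, h2, h3⟩

namespace Tiling.IsIsometry

variable {E : LocalAlgebra π' X →ₗ[ℂ] LocalAlgebra π G} (hE : t.IsIsometry E₀ E)
include hE

theorem algebraMap (c : ℂ) : E (algebraMap ℂ _ c) = c • t.proj P Finset.univ := by
  rw [Algebra.algebraMap_eq_smul_one, map_smul, hE.one]

/-- On the coarse-grained algebra of a region, the lattice isometry is the tile-wise correspondence,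
followed by compression to the product projection. -/
theorem eq_of_isoGraph (hP : IsProjection P) {F : Set X} {a' : LocalAlgebra π' X}
    {a : LocalAlgebra π G} (h : (a', a) ∈ t.isoGraph E₀ F) :
    E a' = a * t.proj P Finset.univ := by
  -- the statement is multiplicative once the product projection is known to commute with `a`
  have : E a' = a * t.proj P Finset.univ ∧
      a * t.proj P Finset.univ = t.proj P Finset.univ * a := by
    refine Tiling.isoGraph_induction (p := fun a' a => E a' = a * t.proj P Finset.univ ∧
      a * t.proj P Finset.univ = t.proj P Finset.univ * a) ?_ ?_ ?_ ?_ h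
    · intro x _ i j
      exact ⟨hE.unit x i j, Tiling.copy_unit_comm_proj hP x i j _⟩
    · intro c
      exact ⟨by rw [hE.algebraMap, Algebra.smul_def], Algebra.commutes c _⟩
    · rintro _ _ _ _ ⟨h1, h1'⟩ ⟨h2, h2'⟩
      rw [map_add, h1, h2, add_mul, mul_add, h1', h2']
      exact ⟨rfl, rfl⟩
    · rintro _ a _ b ⟨h1, h1'⟩ ⟨h2, h2'⟩
      refine ⟨?_, by rw [mul_assoc, h2', ← mul_assoc, h1', mul_assoc]⟩
      rw [hE.mul, h1, h2, mul_assoc, ← mul_assoc (t.proj P Finset.univ), ← h2', mul_assoc b,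
        Tiling.proj_idem hP, mul_assoc]
  exact this.1

theorem proj_mul (a : LocalAlgebra π' X) : t.proj P Finset.univ * E a = E a := by
  rw [← hE.one, ← hE.mul, one_mul]

theorem mul_proj (a : LocalAlgebra π' X) : E a * t.proj P Finset.univ = E a := by
  rw [← hE.one, ← hE.mul, mul_one]

theorem injective [Nonempty (Fin r)] (hP : IsProjection P) : Function.Injective E := by
  refine (injective_iff_map_eq_zero E).mpr fun a ha => ?_
  -- the kernel is a proper two-sided ideal
  let I : TwoSidedIdeal (LocalAlgebra π' X) := TwoSidedIdeal.mk' {a | E a = 0}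
    (map_zero E)
    (fun {x y} hx hy => by
      simp only [Set.mem_ofPred_eq] at *; rw [map_add, hx, hy, add_zero])
    (fun {x} hx => by
      simp only [Set.mem_ofPred_eq] at *
      exact (map_neg E x).trans ((congrArg _ hx).trans neg_zero))
    (fun {x y} hy => by
      simp only [Set.mem_ofPred_eq] at *; rw [hE.mul, hy, mul_zero])
    (fun {x y} hx => by
      simp only [Set.mem_ofPred_eq] at *; rw [hE.mul, hx, zero_mul])
  by_contra hc
  have hI : (1 : LocalAlgebra π' X) ∈ I :=
    IsSimpleRing.one_mem_of_ne_zero_mem I hc (by rw [TwoSidedIdeal.mem_mk']; exact ha)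
  rw [TwoSidedIdeal.mem_mk'] at hI
  exact Tiling.proj_ne_zero hP (hE.one.symm.trans hI)

theorem twist (hP : IsProjection P) (a : LocalAlgebra π' X) :
    E (FermionicCA.twist 1 a) = FermionicCA.twist 1 (E a) := by
  have h0 := (Tiling.proj_isHomog (t := t) (F := Finset.univ) hP).twist 1
  rw [mul_zero, sgn_zero, one_smul] at h0
  induction a using local_induction with
  | hu x i j =>
    rw [isHomog_cellUnit (π := π') x i j, map_smul, hE.unit, map_mul, h0,
      Tiling.copy_isHomog (E₀.isHomog i j), smul_mul_assoc]
  | hs c => rw [AlgHom.commutes, hE.algebraMap, map_smul, h0]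
  | ha a b h1 h2 => rw [map_add, map_add, map_add, map_add, h1, h2]
  | hm a b h1 h2 => rw [map_mul, hE.mul, hE.mul, map_mul, h1, h2]

theorem star [Nonempty (Fin r)] (hP : IsProjection P) (a : LocalAlgebra π' X) :
    E (star a) = star (E a) := by
  induction a using local_induction with
  | hu x i j =>
    rw [star_cellUnit, hE.unit, hE.unit, star_mul, Tiling.proj_star hP, ← Tiling.copy_star,
      E₀.star, Tiling.copy_unit_comm_proj hP]
  | hs c =>
    rw [← algebraMap_star_comm, hE.algebraMap, hE.algebraMap, star_smul, Tiling.proj_star hP]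
  | ha a b h1 h2 => rw [star_add, map_add, map_add, star_add, h1, h2]
  | hm a b h1 h2 => rw [star_mul, hE.mul, hE.mul, star_mul, h1, h2]

/-- The product of the tile isometries is onto the corner of the product projection. -/
theorem exists_eq (hP : IsProjection P) (hcover : t.tiles Set.univ = Set.univ)
    (a : LocalAlgebra π G) :
    ∃ b, E b = t.proj P Finset.univ * a * t.proj P Finset.univ := by
  obtain ⟨b', b, hb, h⟩ := Tiling.exists_isoGraph_of_mem (t := t) (E₀ := E₀) hP Finset.univ (a := a)
    (by rw [Finset.coe_univ, hcover]; exact mem_regionSub_univ a)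
  exact ⟨b', by rw [h, hE.eq_of_isoGraph hP hb]⟩

end Tiling.IsIsometry

end Isometry

/-! ### Translation of tiles -/

section Equivariant

variable {κ : Type} [Fintype κ] [DecidableEq κ] {π : κ → ZMod 2} [Nonempty κ] {s N : ℕ}
  {X G : Type} [DecidableEq X] [Countable G] [DecidableEq G] [AddCommGroup X]
  [AddCommGroup G] {t : Tiling s N X G} {P : LocalAlgebra π (tile s N)} {r : ℕ}
  {π' : Fin r → ZMod 2} {E₀ : TileIsometry P r π'}

/-- The tiles are translates of each other: the coarse-grained shift by `x` is the shift by
`σ x`. -/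
def Tiling.IsEquivariant (t : Tiling s N X G) (σ : X →+ G) : Prop :=
  ∀ x y a, t.emb (x + y) a = σ x + t.emb y a

namespace Tiling

variable {σ : X →+ G} (hσ : t.IsEquivariant σ)
include hσ

theorem shift_copy (x y : X) (a : LocalAlgebra π (tile s N)) :
    shift (σ x) (t.copy y a) = t.copy (x + y) a := by
  unfold shift copy
  rw [map_map]
  congr 2
  exact (Function.Embedding.ext fun a => (hσ x y a).symm)

theorem shift_proj (hP : IsProjection P) (x : X) (F : Finset X) :
    shift (σ x) (t.proj P F) = t.proj P (x +ᵥ F) := by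
  induction F using Finset.induction_on with
  | empty => rw [Finset.vadd_finset_empty, proj_empty, map_one]
  | insert y F hy ih =>
    rw [proj_insert hP hy, map_mul, shift_copy hσ, ih, Finset.vadd_finset_insert,
      vadd_eq_add, proj_insert hP]
    rw [← vadd_eq_add, Finset.vadd_mem_vadd_finset_iff]
    exact hy

theorem shift_proj_univ [Fintype X] (hP : IsProjection P) (x : X) :
    shift (σ x) (t.proj P Finset.univ) = t.proj P Finset.univ := by
  rw [shift_proj hσ hP, Finset.vadd_finset_univ]

theorem IsIsometry.shift [Fintype X] [Nonempty (Fin r)] (hP : IsProjection P)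
    {E : LocalAlgebra π' X →ₗ[ℂ] LocalAlgebra π G} (hE : t.IsIsometry E₀ E) (x : X)
    (a : LocalAlgebra π' X) :
    E (FermionicCA.shift x a) = FermionicCA.shift (σ x) (E a) := by
  induction a using local_induction with
  | hu y i j =>
    rw [shift_cellUnit, hE.unit, hE.unit, map_mul, shift_copy hσ, shift_proj_univ hσ hP]
  | hs c => rw [AlgHom.commutes, hE.algebraMap, map_smul, shift_proj_univ hσ hP]
  | ha a b h1 h2 => rw [map_add, map_add, map_add, map_add, h1, h2]
  | hm a b h1 h2 => rw [map_mul, hE.mul, hE.mul, map_mul, h1, h2]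

end Tiling

end Equivariant

/-! ### The tilings of the lattice and of the torus -/

section Concrete

variable {s : ℕ}

theorem mem_tile {N : ℕ} {y : ZLattice s} : y ∈ tile s N ↔ ∀ i, 0 ≤ y i ∧ y i < N := by
  simp [tile, Fintype.mem_piFinset]

theorem tile_eq_of_add_eq {N : ℕ} {a b : ZLattice s} (ha : a ∈ tile s N) (hb : b ∈ tile s N)
    {i : Fin s} {x y : ℤ} (h : (N : ℤ) ∣ (a i + N * x) - (b i + N * y)) : a i = b i := by
  have h1 := mem_tile.mp ha i
  have h2 := mem_tile.mp hb i
  have h3 : (N : ℤ) ∣ a i - b i := by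
    have : a i - b i = (a i + N * x) - (b i + N * y) + N * (y - x) := by ring
    rw [this]
    exact dvd_add h (dvd_mul_right _ _)
  have h4 := Int.eq_zero_of_abs_lt_dvd h3 (by rw [abs_lt]; constructor <;> omega)
  omega

/-- The tiling of `ℤ^s` by the tiles `Λ_x = Λ₀ + N x`. -/
def latticeTiling (s N : ℕ) [NeZero N] : Tiling s N (ZLattice s) (ZLattice s) where
  emb x := (Function.Embedding.subtype _).trans (Equiv.addRight ((N : ℤ) • x)).toEmbedding
  eq_of_emb_eq := by
    intro x y a b h
    have hN : (N : ℤ) ≠ 0 := by exact_mod_cast NeZero.ne N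
    funext i
    have h1 : a.1 i + N * x i = b.1 i + N * y i := congrFun h i
    have h2 := tile_eq_of_add_eq (x := x i) (y := y i) a.2 b.2
      (by rw [h1, sub_self]; exact dvd_zero _)
    rw [h2] at h1
    exact mul_left_cancel₀ hN (add_left_cancel h1)

theorem latticeTiling_emb {N : ℕ} [NeZero N] (x : ZLattice s) (a : tile s N) :
    (latticeTiling s N).emb x a = a + (N : ℤ) • x := rfl

variable {N m : ℕ} [NeZero m]

theorem intCast_mul_val (x : ℤ) :
    ((N * (x : ZMod m).val : ℕ) : ZMod (N * m)) = ((N * x : ℤ) : ZMod (N * m)) := by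
  have h : ((N * (x : ZMod m).val : ℕ) : ZMod (N * m)) =
      ((N * ((x : ZMod m).val : ℤ) : ℤ) : ZMod (N * m)) := by push_cast; rfl
  rw [h, ZMod.val_intCast, ZMod.intCast_eq_intCast_iff_dvd_sub, ← mul_sub]
  push_cast
  exact mul_dvd_mul_left _ (Int.dvd_self_sub_emod)

/-- The tiling of the torus `ℤ_{Nm}^s`, indexed by `ℤ_m^s`. -/
def torusTiling (s N m : ℕ) [NeZero N] [NeZero m] : Tiling s N (Torus s m) (Torus s (N * m)) where
  emb := tileEmb N m
  eq_of_emb_eq := by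
    intro x y a b h
    have hN : (N : ℤ) ≠ 0 := by exact_mod_cast NeZero.ne N
    funext i
    have h1 : ((a.1 i : ℤ) : ZMod (N * m)) + ((N * (x i).val : ℕ) : ZMod (N * m)) =
      ((b.1 i : ℤ) : ZMod (N * m)) + ((N * (y i).val : ℕ) : ZMod (N * m)) := congrFun h i
    have h2 : ((b.1 i + N * ((y i).val : ℤ) : ℤ) : ZMod (N * m)) =
        ((a.1 i + N * ((x i).val : ℤ) : ℤ) : ZMod (N * m)) := by
      push_cast at h1 ⊢
      exact h1.symm
    rw [ZMod.intCast_eq_intCast_iff_dvd_sub] at h2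
    rw [Nat.cast_mul] at h2
    have h3 := tile_eq_of_add_eq (i := i) b.2 a.2
      ((dvd_mul_right (N : ℤ) m).trans ((dvd_sub_comm).mp h2))
    rw [h3, add_sub_add_left_eq_sub, ← mul_sub] at h2
    have h4 := (mul_dvd_mul_iff_left hN).mp h2
    have h5 := (ZMod.intCast_eq_intCast_iff_dvd_sub _ _ _).mpr h4
    simpa using h5.symm

variable [NeZero N]

/-- The coarse-grained shifts of the torus. -/
def torusScale (s N m : ℕ) [NeZero m] : Torus s m →+ Torus s (N * m) where
  toFun x i := ((N * (x i).val : ℕ) : ZMod (N * m))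
  map_zero' := by funext i; simp
  map_add' x y := by
    funext i
    change ((N * (x i + y i).val : ℕ) : ZMod (N * m)) =
      ((N * (x i).val : ℕ) : ZMod (N * m)) + ((N * (y i).val : ℕ) : ZMod (N * m))
    rw [← Nat.cast_add, ← mul_add, ZMod.natCast_eq_natCast_iff, ZMod.val_add]
    exact (Nat.mod_modEq _ _).mul_left' _

theorem torusTiling_isEquivariant : (torusTiling s N m).IsEquivariant (torusScale s N m) := by
  intro x y a
  change (fun i => ((a.1 i : ℤ) : ZMod (N * m))) + torusScale s N m (x + y) =
    torusScale s N m x + ((fun i => ((a.1 i : ℤ) : ZMod (N * m))) + torusScale s N m y)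
  rw [map_add]; abel

theorem wrap_latticeTiling_emb (x : ZLattice s) (a : tile s N) :
    wrapHom s (N * m) ((latticeTiling s N).emb x a) =
      (torusTiling s N m).emb (wrapHom s m x) a := by
  funext i
  change ((a.1 i + N * x i : ℤ) : ZMod (N * m)) =
    ((a.1 i : ℤ) : ZMod (N * m)) + ((N * (x i : ZMod m).val : ℕ) : ZMod (N * m))
  rw [intCast_mul_val, Int.cast_add]

theorem wrapHom_surjective (n : ℕ) : Function.Surjective (wrapHom s n) := by
  intro x
  choose y hy using fun i => ZMod.intCast_surjective (x i)
  exact ⟨y, funext hy⟩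

/-- Each site of the lattice lies in the tile whose index is the coordinatewise quotient by `N`. -/
theorem mem_tiles_latticeTiling (x : ZLattice s) {F : Set (ZLattice s)} :
    x ∈ (latticeTiling s N).tiles F ↔ (fun i => x i / (N : ℤ)) ∈ F := by
  have hN : (0 : ℤ) < N := by exact_mod_cast NeZero.pos N
  constructor
  · rintro ⟨y, hy, a, rfl⟩
    convert hy using 2 with i
    rename_i i
    change (a.1 i + N * y i) / (N : ℤ) = y i
    have := mem_tile.mp a.2 i
    rw [Int.add_mul_ediv_left _ _ hN.ne', Int.ediv_eq_zero_of_lt this.1 this.2, zero_add]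
  · intro h
    refine ⟨_, h, ⟨fun i => x i % N, mem_tile.mpr fun i =>
      ⟨Int.emod_nonneg _ hN.ne', Int.emod_lt_of_pos _ hN⟩⟩, ?_⟩
    funext i
    exact Int.emod_add_mul_ediv (x i) N

theorem tiles_torusTiling_univ : (torusTiling s N m).tiles Set.univ = Set.univ := by
  rw [Set.eq_univ_iff_forall]
  intro g
  obtain ⟨x, rfl⟩ := wrapHom_surjective (s := s) (N * m) g
  obtain ⟨y, -, a, rfl⟩ := (mem_tiles_latticeTiling (N := N) x (F := Set.univ)).mpr trivial
  exact ⟨_, trivial, a, (wrap_latticeTiling_emb y a).symm⟩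

theorem image_tiles_latticeTiling (F : Set (ZLattice s)) :
    wrapHom s (N * m) '' (latticeTiling s N).tiles F =
      (torusTiling s N m).tiles (wrapHom s m '' F) := by
  ext g
  constructor
  · rintro ⟨_, ⟨x, hx, a, rfl⟩, rfl⟩
    exact ⟨_, ⟨x, hx, rfl⟩, a, (wrap_latticeTiling_emb x a).symm⟩
  · rintro ⟨_, ⟨x, hx, rfl⟩, a, rfl⟩
    exact ⟨_, ⟨x, hx, a, rfl⟩, wrap_latticeTiling_emb x a⟩

theorem injOn_tiles {F : Set (ZLattice s)} (h : Set.InjOn (wrapHom s m) F) :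
    Set.InjOn (wrapHom s (N * m)) ((latticeTiling s N).tiles F) := by
  rintro _ ⟨x, hx, a, rfl⟩ _ ⟨y, hy, b, rfl⟩ hxy
  rw [wrap_latticeTiling_emb, wrap_latticeTiling_emb] at hxy
  have h1 := h hx hy ((torusTiling s N m).eq_of_emb_eq hxy)
  subst h1
  rw [((torusTiling s N m).emb _).injective hxy]

theorem tiles_singleton_zero : (latticeTiling s N).tiles {0} = (tile s N : Set (ZLattice s)) := by
  ext g
  constructor
  · rintro ⟨_, rfl, a, rfl⟩
    simp [latticeTiling_emb]
  · intro hg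
    exact ⟨0, rfl, ⟨g, hg⟩, by simp [latticeTiling_emb]⟩

theorem tile_add_subset (𝒩 : Finset (ZLattice s)) :
    (tile s N : Set (ZLattice s)) + (𝒩 : Set (ZLattice s)) ⊆
      (latticeTiling s N).tiles (tileNeighbourhood N 𝒩 : Set (ZLattice s)) := by
  intro x hx
  rw [mem_tiles_latticeTiling]
  exact Finset.mem_image.mpr ⟨x, by exact_mod_cast hx, rfl⟩

end Concrete

/-! ### Large tori -/

section Large

variable {s : ℕ}

/-- A finite set of lattice points is mapped injectively to every sufficiently large torus. -/
theorem exists_forall_injOn (F : Finset (ZLattice s)) :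
    ∃ M : ℕ, ∀ n, M ≤ n → Set.InjOn (wrapHom s n) (F : Set (ZLattice s)) := by
  let B : ℕ := ∑ x ∈ F, ∑ i, (x i).natAbs
  have hB : ∀ x ∈ F, ∀ i, (x i).natAbs ≤ B := fun x hx i =>
    (Finset.single_le_sum (f := fun i => (x i).natAbs) (fun _ _ => Nat.zero_le _)
      (Finset.mem_univ i)).trans
      (Finset.single_le_sum (f := fun x : ZLattice s => ∑ i, (x i).natAbs)
        (fun _ _ => Nat.zero_le _) hx)
  refine ⟨2 * B + 1, fun n hn x hx y hy hxy => funext fun i => ?_⟩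
  have h1 : ((x i : ℤ) : ZMod n) = ((y i : ℤ) : ZMod n) := congrFun hxy i
  rw [ZMod.intCast_eq_intCast_iff_dvd_sub] at h1
  have h2 := hB x hx i
  have h3 := hB y hy i
  have h4 := Int.eq_zero_of_abs_lt_dvd h1 (by rw [abs_lt]; constructor <;> omega)
  omega

/-- Overlapping neighbourhoods `x + 𝒩` and `y + 𝒩` have `y - x ∈ 𝒩 - 𝒩`, so injectivity on
`𝒩 ∪ (𝒩 - 𝒩 + 𝒩)` suffices for a regular wrapping. -/
theorem isRegular_of_injOn {n : ℕ} {𝒩 : Finset (ZLattice s)}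
    (h : Set.InjOn (wrapHom s n) (𝒩 ∪ (𝒩 - 𝒩 + 𝒩) : Finset (ZLattice s))) :
    IsRegular n 𝒩 := by
  have key : ∀ x y : ZLattice s,
      ((x +ᵥ (𝒩 : Set (ZLattice s))) ∩ (y +ᵥ (𝒩 : Set (ZLattice s)))).Nonempty →
      ∀ z ∈ x +ᵥ (𝒩 : Set (ZLattice s)), wrap n z ∈ wrap n '' (y +ᵥ (𝒩 : Set (ZLattice s))) →
        z ∈ y +ᵥ (𝒩 : Set (ZLattice s)) := by
    rintro x y ⟨_, ⟨a, ha, rfl⟩, ⟨b, hb, hab⟩⟩ _ ⟨u, hu, rfl⟩ ⟨_, ⟨v, hv, rfl⟩, huv⟩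
    have hab' : y = x + (a - b) := by
      have : y + b = x + a := hab
      rw [eq_sub_of_add_eq this]; abel
    have huv' : wrapHom s n (y + v) = wrapHom s n (x + u) := huv
    rw [hab', add_assoc, map_add, map_add _ x u, add_right_inj] at huv'
    have e := h (x₁ := a - b + v) (x₂ := u) ?_ ?_ huv'
    · refine ⟨v, hv, ?_⟩
      change y + v = x + u
      rw [hab', ← e, add_assoc]
    · exact Finset.mem_union_right _ (Finset.add_mem_add (Finset.sub_mem_sub ha hb) hv)
    · exact Finset.mem_union_left _ hu
  intro x y hxy
  ext z
  constructor
  · rintro ⟨⟨h1, h2⟩, hz | hz⟩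
    · exact ⟨hz, key x y hxy z hz h2⟩
    · exact ⟨key y x (by rwa [Set.inter_comm]) z hz h1, hz⟩
  · rintro ⟨h1, h2⟩
    exact ⟨⟨⟨z, h1, rfl⟩, ⟨z, h2, rfl⟩⟩, Or.inl h1⟩

end Large

/-! ### Invariance of the product projection -/

section Invariance

/-- If `β p ≤ p` for an injective `*`-endomorphism `β` of a finite-dimensional algebra and a
projection `p`, then `β p = p`, since the left ideals generated by `p` and `β p` have the same
dimension. -/
theorem map_eq_of_mul_eq {A : Type*} [Ring A] [StarRing A] [Algebra ℂ A] [FiniteDimensional ℂ A]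
    (β : A →ₐ[ℂ] A) (hβ : Function.Injective β) {p : A} (hp : p * p = p)
    (hs : star p = p) (hs' : star (β p) = β p) (h : p * β p = p) : β p = p := by
  have hle : LinearMap.range (LinearMap.mulRight ℂ p) ≤
      LinearMap.range (LinearMap.mulRight ℂ (β p)) := by
    rintro _ ⟨a, rfl⟩
    exact ⟨a * p, by simp [mul_assoc, h]⟩
  have hle' : (LinearMap.range (LinearMap.mulRight ℂ p)).map β.toLinearMap ≤
      LinearMap.range (LinearMap.mulRight ℂ (β p)) := by
    rintro _ ⟨_, ⟨a, rfl⟩, rfl⟩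
    exact ⟨β a, by simp⟩
  have hsurj : Function.Surjective β :=
    LinearMap.surjective_of_injective (f := β.toLinearMap) hβ
  have hge' : LinearMap.range (LinearMap.mulRight ℂ (β p)) ≤
      (LinearMap.range (LinearMap.mulRight ℂ p)).map β.toLinearMap := by
    rintro _ ⟨b, rfl⟩
    obtain ⟨a, rfl⟩ := hsurj b
    exact ⟨_, ⟨a, rfl⟩, by simp⟩
  have heq := Submodule.eq_of_le_of_finrank_eq hle (by
    rw [le_antisymm hge' hle']
    exact (LinearEquiv.finrank_eq (Submodule.equivMapOfInjective β.toLinearMap hβ _)))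
  have hmem : β p ∈ LinearMap.range (LinearMap.mulRight ℂ p) := by
    rw [heq]; exact ⟨1, by simp⟩
  obtain ⟨c, hc⟩ := hmem
  have h1 : β p * p = β p := by
    rw [← hc, LinearMap.mulRight_apply, mul_assoc, hp]
  have h2 := congrArg star h
  rw [star_mul, hs, hs'] at h2
  exact h1.symm.trans h2

variable {κ : Type} [Fintype κ] [DecidableEq κ] {π : κ → ZMod 2} [Nonempty κ] {s N m : ℕ}
  [NeZero N] [NeZero m]

variable {P : LocalAlgebra π (tile s N)}

theorem copy_mem_wrapGraph (x : ZLattice s) (a : LocalAlgebra π (tile s N)) :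
    ((latticeTiling s N).copy x a, (torusTiling s N m).copy (wrapHom s m x) a) ∈
      wrapGraph π (wrapHom s (N * m)) ((latticeTiling s N).tiles {x}) := by
  induction a using local_induction with
  | hu y i j =>
    rw [Tiling.copy, Tiling.copy, map_cellUnit, map_cellUnit, ← wrap_latticeTiling_emb]
    exact cellUnit_mem_wrapGraph (x := (latticeTiling s N).emb x y)
      (Λ := (latticeTiling s N).tiles {x}) ⟨x, rfl, y, rfl⟩ i j
  | hs c =>
    rw [AlgHom.commutes, AlgHom.commutes]
    exact Subalgebra.algebraMap_mem _ c
  | ha a b h1 h2 => rw [map_add, map_add]; exact add_mem h1 h2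
  | hm a b h1 h2 => rw [map_mul, map_mul]; exact mul_mem h1 h2

theorem proj_mem_wrapGraph (hP : IsProjection P) {F : Finset (ZLattice s)}
    (hF : Set.InjOn (wrapHom s m) (F : Set (ZLattice s))) :
    ((latticeTiling s N).proj P F, (torusTiling s N m).proj P (F.image (wrapHom s m))) ∈
      wrapGraph π (wrapHom s (N * m)) ((latticeTiling s N).tiles F) := by
  induction F using Finset.induction_on with
  | empty =>
    rw [Finset.image_empty, Tiling.proj_empty, Tiling.proj_empty]
    exact one_mem (wrapGraph π (wrapHom s (N * m)) _)
  | insert x F hx ih =>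
    rw [Finset.coe_insert] at hF
    have hx' : wrapHom s m x ∉ F.image (wrapHom s m) := by
      intro h
      obtain ⟨y, hy, hxy⟩ := Finset.mem_image.mp h
      have := hF (Set.mem_insert_of_mem _ hy) (Set.mem_insert _ _) hxy
      exact hx (this ▸ hy)
    rw [Finset.image_insert, Tiling.proj_insert hP hx, Tiling.proj_insert hP hx']
    exact mul_mem (wrapGraph_mono (Tiling.tiles_mono (by simp)) (copy_mem_wrapGraph x P))
      (wrapGraph_mono (Tiling.tiles_mono (by simp)) (ih (hF.mono (Set.subset_insert _ _))))

/-- The factors of the product projection outside `F` can be cancelled. -/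
theorem Tiling.eq_of_mul_proj_eq {X G : Type} [DecidableEq X] [Countable G] [DecidableEq G]
    {t : Tiling s N X G} (hP : IsProjection P) {F : Set X} {H : Finset X}
    (hd : Disjoint F (H : Set X)) {a b : LocalAlgebra π G} (ha : a ∈ regionSub π (t.tiles F))
    (hb : b ∈ regionSub π (t.tiles F)) (h : a * t.proj P H = b * t.proj P H) : a = b := by
  refine sub_eq_zero.mp (eq_zero_of_mul_eq_zero (Tiling.disjoint_tiles hd) (sub_mem ha hb)
    (Tiling.proj_mem hP) (Tiling.proj_ne_zero hP) (Tiling.proj_isHomog hP) ?_)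
  exact (sub_mul _ _ _).trans (sub_eq_zero.mpr h)

/-- The local form of the invariance of the product projection: the evolved projection of a tile
contains the product projection of the tiles in `F`. -/
def IsLocallyInvariant (α : LocalAlgebra π (ZLattice s) →ₐ[ℂ] LocalAlgebra π (ZLattice s))
    (P : LocalAlgebra π (tile s N)) (F : Finset (ZLattice s)) : Prop :=
  α ((latticeTiling s N).copy 0 P) * (latticeTiling s N).proj P F = (latticeTiling s N).proj P F

/-- Local invariance does not depend on the set of tiles containing the evolved projection. -/
theorem IsLocallyInvariant.of_mem
    {α : LocalAlgebra π (ZLattice s) →ₐ[ℂ] LocalAlgebra π (ZLattice s)} (hP : IsProjection P)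
    {F F' : Finset (ZLattice s)} (h : IsLocallyInvariant α P F)
    (hF' : α ((latticeTiling s N).copy 0 P) ∈ regionSub π ((latticeTiling s N).tiles F')) :
    IsLocallyInvariant α P F' := by
  refine Tiling.eq_of_mul_proj_eq (t := latticeTiling s N) (F := F') (H := F \ F') hP ?_
    (mul_mem hF' (Tiling.proj_mem hP)) (Tiling.proj_mem hP) ?_
  · rw [Finset.coe_sdiff]; exact disjoint_sdiff_self_right
  · have e : (latticeTiling s N).proj P F' * (latticeTiling s N).proj P (F \ F') =
        (latticeTiling s N).proj P (F ∪ F') := by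
      rw [← Tiling.proj_union hP, Finset.union_sdiff_self_eq_union, Finset.union_comm]
    rw [mul_assoc, e, Tiling.proj_union hP, ← mul_assoc]
    exact congrArg (· * _) h

variable {α : LocalAlgebra π (ZLattice s) →ₐ[ℂ] LocalAlgebra π (ZLattice s)}
  {β : LocalAlgebra π (Torus s (N * m)) →ₐ[ℂ] LocalAlgebra π (Torus s (N * m))}
  {𝒩 : Finset (ZLattice s)}

theorem tile_add_subset' (𝒩 : Finset (ZLattice s)) :
    (latticeTiling s N).tiles {0} + (𝒩 : Set (ZLattice s)) ⊆
      (latticeTiling s N).tiles (tileNeighbourhood N 𝒩 : Set (ZLattice s)) := by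
  rw [tiles_singleton_zero]; exact tile_add_subset 𝒩

theorem map_copy_mem (hα : IsLocalCA α)
    (h𝒩 : ∀ i j, α (cellUnit π 0 i j) ∈ regionSub π (𝒩 : Set (ZLattice s)))
    (a : LocalAlgebra π (tile s N)) :
    α ((latticeTiling s N).copy 0 a) ∈
      regionSub π ((latticeTiling s N).tiles (tileNeighbourhood N 𝒩)) :=
  regionSub_mono (tile_add_subset' 𝒩) (hα.map_mem h𝒩 (Tiling.copy_mem 0 a))

theorem IsLocalWrapping.copy_mem (h : IsLocalWrapping (N * m) α β 𝒩)
    (a : LocalAlgebra π (tile s N)) :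
    (α ((latticeTiling s N).copy 0 a), β ((torusTiling s N m).copy 0 a)) ∈
      wrapGraph π (wrapHom s (N * m)) ((latticeTiling s N).tiles (tileNeighbourhood N 𝒩)) := by
  have h1 := copy_mem_wrapGraph (m := m) (0 : ZLattice s) a
  rw [map_zero] at h1
  exact wrapGraph_mono (tile_add_subset' 𝒩) (wrapGraph_map h.left h.right h.rule h1)

theorem IsLocalWrapping.isLocallyInvariant_iff (h : IsLocalWrapping (N * m) α β 𝒩)
    (hP : IsProjection P)
    (hF : Set.InjOn (wrapHom s m) (tileNeighbourhood N 𝒩 : Set (ZLattice s))) :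
    IsLocallyInvariant α P (tileNeighbourhood N 𝒩) ↔
      β ((torusTiling s N m).copy 0 P) *
        (torusTiling s N m).proj P ((tileNeighbourhood N 𝒩).image (wrapHom s m)) =
      (torusTiling s N m).proj P ((tileNeighbourhood N 𝒩).image (wrapHom s m)) :=
  wrapGraph_eq_iff (injOn_tiles hF) (mul_mem (h.copy_mem P) (proj_mem_wrapGraph hP hF))
    (proj_mem_wrapGraph hP hF)

/-- An invariant product projection on the torus is locally invariant: the evolved projection of a
tile dominates the product projection, and the factors of the tiles away from it can be
cancelled. -/
theorem IsLocalWrapping.isLocallyInvariant (h : IsLocalWrapping (N * m) α β 𝒩)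
    (hP : IsProjection P)
    (hF : Set.InjOn (wrapHom s m) (tileNeighbourhood N 𝒩 : Set (ZLattice s)))
    (hβ : β ((torusTiling s N m).proj P Finset.univ) = (torusTiling s N m).proj P Finset.univ) :
    IsLocallyInvariant α P (tileNeighbourhood N 𝒩) := by
  rw [h.isLocallyInvariant_iff hP hF]
  set F := (tileNeighbourhood N 𝒩).image (wrapHom s m) with hFdef
  have hmem : β ((torusTiling s N m).copy 0 P) ∈ regionSub π ((torusTiling s N m).tiles F) := by
    have := wrapGraph_snd (h.copy_mem P)
    rw [image_tiles_latticeTiling] at this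
    rwa [hFdef, Finset.coe_image]
  refine Tiling.eq_of_mul_proj_eq (t := torusTiling s N m) (F := F) (H := Finset.univ \ F) hP ?_
    (mul_mem hmem (Tiling.proj_mem hP)) (Tiling.proj_mem hP) ?_
  · rw [Finset.coe_sdiff]; exact disjoint_sdiff_self_right
  · rw [mul_assoc, ← Tiling.proj_union hP, Finset.union_sdiff_of_subset (Finset.subset_univ _)]
    nth_rewrite 1 [← hβ]
    rw [← map_mul, Tiling.copy_mul_proj hP (Finset.mem_univ _), hβ]

/-- Local invariance implies invariance on the torus: translates of the local condition multiply to
`β p * p = p` for the product projection `p`, and a dimension count turns this into an equality. -/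
theorem IsLocalWrapping.map_proj_eq (h : IsLocalWrapping (N * m) α β 𝒩)
    (hP : IsProjection P)
    (hF : Set.InjOn (wrapHom s m) (tileNeighbourhood N 𝒩 : Set (ZLattice s)))
    (hα : IsLocallyInvariant α P (tileNeighbourhood N 𝒩)) :
    β ((torusTiling s N m).proj P Finset.univ) = (torusTiling s N m).proj P Finset.univ := by
  rw [h.isLocallyInvariant_iff hP hF] at hα
  have h0 : β ((torusTiling s N m).copy 0 P) * (torusTiling s N m).proj P Finset.univ =
      (torusTiling s N m).proj P Finset.univ := by
    rw [← Tiling.proj_mul_proj (t := torusTiling s N m) hP (Finset.subset_univ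
      ((tileNeighbourhood N 𝒩).image (wrapHom s m))), ← mul_assoc, hα]
  have hx : ∀ x, β ((torusTiling s N m).copy x P) * (torusTiling s N m).proj P Finset.univ =
      (torusTiling s N m).proj P Finset.univ := fun x => by
    have := congrArg (shift (torusScale s N m x)) h0
    rw [map_mul, Tiling.shift_proj_univ torusTiling_isEquivariant hP, ← h.right.shift,
      Tiling.shift_copy torusTiling_isEquivariant, add_zero] at this
    exact this
  have hH : ∀ H : Finset (Torus s m),
      β ((torusTiling s N m).proj P H) * (torusTiling s N m).proj P Finset.univ =
      (torusTiling s N m).proj P Finset.univ := fun H => by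
    induction H using Finset.induction_on with
    | empty => rw [Tiling.proj_empty, map_one, one_mul]
    | insert x H hxH ih => rw [Tiling.proj_insert hP hxH, map_mul, mul_assoc, ih, hx]
  have hst : star (β ((torusTiling s N m).proj P Finset.univ)) =
      β ((torusTiling s N m).proj P Finset.univ) := by
    rw [← h.right.star, Tiling.proj_star hP]
  refine map_eq_of_mul_eq β (bijective_of_fintype β).1 (Tiling.proj_idem hP)
    (Tiling.proj_star hP) hst ?_
  have := congrArg star (hH Finset.univ)
  rwa [star_mul, Tiling.proj_star hP, hst] at this

end Invariance

/-! ### The induced automaton on the coarse-grained torus -/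

section Induced

variable {κ : Type} [Fintype κ] [DecidableEq κ] {π : κ → ZMod 2} [Nonempty κ] {s N : ℕ}
  {X G : Type} [DecidableEq X] [Fintype X] [AddCommGroup X] [Fintype G] [DecidableEq G]
  [AddCommGroup G] {t : Tiling s N X G} {P : LocalAlgebra π (tile s N)} {r : ℕ}
  [Nonempty (Fin r)] {π' : Fin r → ZMod 2} {E₀ : TileIsometry P r π'} {σ : X →+ G}

/-- An automaton which leaves the product projection invariant induces an automaton of the
coarse-grained system. -/
theorem Tiling.IsIsometry.exists_induced (hσ : t.IsEquivariant σ)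
    (hcover : t.tiles Set.univ = Set.univ) (hP : IsProjection P)
    {E : LocalAlgebra π' X →ₗ[ℂ] LocalAlgebra π G} (hE : t.IsIsometry E₀ E)
    {β : LocalAlgebra π G →ₐ[ℂ] LocalAlgebra π G} (hβ : IsLocalCA β)
    (hinv : β (t.proj P Finset.univ) = t.proj P Finset.univ) :
    ∃ γ : LocalAlgebra π' X →ₐ[ℂ] LocalAlgebra π' X, IsLocalCA γ ∧ ∀ a, E (γ a) = β (E a) := by
  have hinj := hE.injective hP
  have hex : ∀ a, ∃ b, E b = β (E a) := fun a => by
    obtain ⟨b, hb⟩ := hE.exists_eq hP hcover (β (E a))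
    refine ⟨b, ?_⟩
    rw [hb, ← hinv, ← map_mul, ← map_mul, hE.proj_mul, hE.mul_proj]
  choose f hf using hex
  let γ : LocalAlgebra π' X →ₐ[ℂ] LocalAlgebra π' X :=
    { toFun := f
      map_one' := hinj (by rw [hf, hE.one, hinv])
      map_mul' := fun a b => hinj (by rw [hf, hE.mul, hE.mul, map_mul, hf, hf])
      map_zero' := hinj (by rw [hf, map_zero, map_zero])
      map_add' := fun a b => hinj (by rw [hf, map_add, map_add, map_add, hf, hf])
      commutes' := fun c => hinj (by rw [hf, hE.algebraMap, map_smul, hinv]) }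
  have hγ : ∀ a, E (γ a) = β (E a) := hf
  exact ⟨γ, ⟨fun a => hinj (by rw [hγ, hE.star hP, hβ.star, hE.star hP, hγ]),
    fun a => hinj (by rw [hγ, hE.twist hP, hβ.twist, hE.twist hP, hγ]),
    fun x a => hinj (by rw [hγ, hE.shift hσ hP, hβ.shift, hE.shift hσ hP, hγ])⟩, hγ⟩

end Induced

/-! ### The renormalised automaton -/

section Renormalised

variable {κ : Type} [Fintype κ] [DecidableEq κ] {π : κ → ZMod 2} [Nonempty κ] {s N m : ℕ}
  [NeZero N] [NeZero m] {P : LocalAlgebra π (tile s N)} {r : ℕ} {π' : Fin r → ZMod 2}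
  {E₀ : TileIsometry P r π'}

/-- The tile-wise correspondence is compatible with wrapping the lattice and the coarse-grained
lattice simultaneously. -/
theorem isoGraph_wrap {F : Set (ZLattice s)} {a' : LocalAlgebra π' (ZLattice s)}
    {a : LocalAlgebra π (ZLattice s)} (h : (a', a) ∈ (latticeTiling s N).isoGraph E₀ F) :
    ∃ b' b, (a', b') ∈ wrapGraph π' (wrapHom s m) F ∧
      (a, b) ∈ wrapGraph π (wrapHom s (N * m)) ((latticeTiling s N).tiles F) ∧
      (b', b) ∈ (torusTiling s N m).isoGraph E₀ (wrapHom s m '' F) := by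
  refine Tiling.isoGraph_induction (p := fun a' a =>
    ∃ b' b, (a', b') ∈ wrapGraph π' (wrapHom s m) F ∧
      (a, b) ∈ wrapGraph π (wrapHom s (N * m)) ((latticeTiling s N).tiles F) ∧
      (b', b) ∈ (torusTiling s N m).isoGraph E₀ (wrapHom s m '' F)) ?_ ?_ ?_ ?_ h
  · intro x hx i j
    exact ⟨_, _, cellUnit_mem_wrapGraph hx i j,
      wrapGraph_mono (Tiling.tiles_mono (Set.singleton_subset_iff.mpr hx)) (copy_mem_wrapGraph x _),
      Tiling.mem_isoGraph (Set.mem_image_of_mem (wrapHom s m) hx) i j⟩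
  · intro c
    exact ⟨_, _, Subalgebra.algebraMap_mem _ c, Subalgebra.algebraMap_mem _ c,
      Subalgebra.algebraMap_mem _ c⟩
  · rintro _ _ _ _ ⟨b', b, h1, h2, h3⟩ ⟨c', c, h1', h2', h3'⟩
    exact ⟨b' + c', b + c, add_mem h1 h1', add_mem h2 h2', add_mem h3 h3'⟩
  · rintro _ _ _ _ ⟨b', b, h1, h2, h3⟩ ⟨c', c, h1', h2', h3'⟩
    exact ⟨b' * c', b * c, mul_mem h1 h1', mul_mem h2 h2', mul_mem h3 h3'⟩

/-- `ρ` is the transition rule obtained from `α` by compression to the product projection of the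
tiles in `F`. -/
def IsRenormalisedRule (α : LocalAlgebra π (ZLattice s) →ₐ[ℂ] LocalAlgebra π (ZLattice s))
    (E₀ : TileIsometry P r π') (F : Finset (ZLattice s))
    (ρ : Fin r → Fin r → LocalAlgebra π' (ZLattice s)) : Prop :=
  ∀ i j, ∃ b, (ρ i j, b) ∈ (latticeTiling s N).isoGraph E₀ (F : Set (ZLattice s)) ∧
    (latticeTiling s N).proj P F * α ((latticeTiling s N).copy 0 (E₀.unit i j)) *
      (latticeTiling s N).proj P F = b * (latticeTiling s N).proj P F

variable {α : LocalAlgebra π (ZLattice s) →ₐ[ℂ] LocalAlgebra π (ZLattice s)}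
  {β : LocalAlgebra π (Torus s (N * m)) →ₐ[ℂ] LocalAlgebra π (Torus s (N * m))}
  {γ : LocalAlgebra π' (Torus s m) →ₐ[ℂ] LocalAlgebra π' (Torus s m)}
  {𝒩 𝒩' : Finset (ZLattice s)} {ρ ρ' : Fin r → Fin r → LocalAlgebra π' (ZLattice s)}

theorem exists_isRenormalisedRule (hP : IsProjection P) (hα : IsLocalCA α)
    (h𝒩 : ∀ i j, α (cellUnit π 0 i j) ∈ regionSub π (𝒩 : Set (ZLattice s)))
    (E₀ : TileIsometry P r π') :
    ∃ ρ, IsRenormalisedRule α E₀ (tileNeighbourhood N 𝒩) ρ := by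
  choose ρ b hb h using fun i j => Tiling.exists_isoGraph_of_mem (E₀ := E₀) hP
    (tileNeighbourhood N 𝒩) (map_copy_mem hα h𝒩 (E₀.unit i j))
  exact ⟨ρ, fun i j => ⟨b i j, hb i j, h i j⟩⟩

/-- The compressed transition rule is the transition rule of the induced automaton of the torus. -/
theorem IsRenormalisedRule.mem_wrapGraph [Nonempty (Fin r)] (hP : IsProjection P)
    (h : IsLocalWrapping (N * m) α β 𝒩)
    (hF : Set.InjOn (wrapHom s m) (tileNeighbourhood N 𝒩 : Set (ZLattice s)))
    (hinv : β ((torusTiling s N m).proj P Finset.univ) = (torusTiling s N m).proj P Finset.univ)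
    {E : LocalAlgebra π' (Torus s m) →ₗ[ℂ] LocalAlgebra π (Torus s (N * m))}
    (hE : (torusTiling s N m).IsIsometry E₀ E) (hγ : ∀ a, E (γ a) = β (E a))
    (hρ : IsRenormalisedRule α E₀ (tileNeighbourhood N 𝒩) ρ) (i j : Fin r) :
    (ρ i j, γ (cellUnit π' 0 i j)) ∈
      wrapGraph π' (wrapHom s m) (tileNeighbourhood N 𝒩 : Set (ZLattice s)) := by
  obtain ⟨b, hb, hc⟩ := hρ i j
  obtain ⟨c', c, h1, h2, h3⟩ := isoGraph_wrap (m := m) hb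
  have hp := proj_mem_wrapGraph (m := m) hP hF
  have h4 := (wrapGraph_eq_iff (injOn_tiles hF)
    (mul_mem (mul_mem hp (h.copy_mem (E₀.unit i j))) hp) (mul_mem h2 hp)).mp hc
  set F' := (tileNeighbourhood N 𝒩).image (wrapHom s m)
  set p := (torusTiling s N m).proj P Finset.univ with hpdef
  set v := β ((torusTiling s N m).copy 0 (E₀.unit i j))
  have hl : p * (torusTiling s N m).proj P F' = p :=
    Tiling.proj_mul_proj' hP (Finset.subset_univ _)
  have hr : (torusTiling s N m).proj P F' * p = p :=
    Tiling.proj_mul_proj hP (Finset.subset_univ _)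
  have h5 : p * v * p = c * p := by
    have h4' : (torusTiling s N m).proj P F' * v * (torusTiling s N m).proj P F' =
      c * (torusTiling s N m).proj P F' := h4
    have : p * ((torusTiling s N m).proj P F' * v * (torusTiling s N m).proj P F') * p =
        p * (c * (torusTiling s N m).proj P F') * p := congrArg (fun z => p * z * p) h4'
    rw [← mul_assoc p, ← mul_assoc p, hl, mul_assoc (p * v), hr, mul_assoc p (c * _), mul_assoc c,
      hr] at this
    rw [this, ← mul_assoc, hpdef, ← Tiling.isoGraph_comm_proj hP _ h3, mul_assoc,
      Tiling.proj_idem hP]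
  have hu : (torusTiling s N m).copy 0 (E₀.unit i j) * p =
      p * (torusTiling s N m).copy 0 (E₀.unit i j) * p := by
    rw [← Tiling.copy_unit_comm_proj hP, mul_assoc, Tiling.proj_idem hP]
  -- `copy 0 (unit i j) * p` lies in the corner of `p`, and `β` leaves `p` invariant
  have h6 : E (γ (cellUnit π' 0 i j)) = E c' := by
    rw [hE.eq_of_isoGraph hP h3, ← hpdef, ← h5, hγ, hE.unit, ← hpdef, hu, map_mul,
      map_mul, hinv]
  rw [hE.injective hP h6]
  exact h1

/-- Finitely many injectivity requirements hold on a sufficiently large torus, where the automaton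
has a wrapping. -/
theorem exists_large (hα : IsLocalCA α)
    (h𝒩 : ∀ i j, α (cellUnit π 0 i j) ∈ regionSub π (𝒩 : Set (ZLattice s)))
    (D : Finset (ZLattice s)) :
    ∃ (m : ℕ) (_ : NeZero m), IsRegular (N * m) 𝒩 ∧
      Set.InjOn (wrapHom s m) (D : Set (ZLattice s)) ∧
      ∃ β : LocalAlgebra π (Torus s (N * m)) →ₐ[ℂ] LocalAlgebra π (Torus s (N * m)),
        IsLocalWrapping (N * m) α β 𝒩 := by
  obtain ⟨M, hM⟩ := exists_forall_injOn D
  obtain ⟨M', hM'⟩ := exists_forall_injOn (𝒩 ∪ (𝒩 - 𝒩 + 𝒩))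
  have : NeZero (M + M' + 1) := ⟨by omega⟩
  have hle : M' ≤ N * (M + M' + 1) :=
    le_trans (by omega) (Nat.le_mul_of_pos_left _ (NeZero.pos N))
  have hreg := isRegular_of_injOn (hM' _ hle)
  exact ⟨M + M' + 1, this, hreg, hM _ (by omega), exists_isLocalWrapping hα h𝒩 hreg⟩

/-- The compressed transition rule does not depend on the neighbourhood scheme. -/
theorem IsRenormalisedRule.unique [Nonempty (Fin r)] (hP : IsProjection P) (hα : IsLocalCA α)
    (h𝒩 : ∀ i j, α (cellUnit π 0 i j) ∈ regionSub π (𝒩 : Set (ZLattice s)))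
    (h𝒩' : ∀ i j, α (cellUnit π 0 i j) ∈ regionSub π (𝒩' : Set (ZLattice s)))
    (hinv : IsLocallyInvariant α P (tileNeighbourhood N 𝒩))
    (hρ : IsRenormalisedRule α E₀ (tileNeighbourhood N 𝒩) ρ)
    (hρ' : IsRenormalisedRule α E₀ (tileNeighbourhood N 𝒩') ρ') : ρ = ρ' := by
  obtain ⟨m, _, hreg, hD, β, hβ⟩ := exists_large (N := N) hα h𝒩
    (tileNeighbourhood N 𝒩 ∪ tileNeighbourhood N 𝒩')
  rw [Finset.coe_union] at hD
  have h1 := hD.mono Set.subset_union_left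
  have h2 := hD.mono Set.subset_union_right
  have hβinv := hβ.map_proj_eq hP h1 hinv
  obtain ⟨E, hE⟩ := Tiling.exists_isIsometry (t := torusTiling s N m) (E₀ := E₀) hP
  obtain ⟨γ, -, hγ⟩ := hE.exists_induced torusTiling_isEquivariant tiles_torusTiling_univ hP
    hβ.right hβinv
  funext i j
  exact (wrapGraph_eq_iff hD
    (wrapGraph_mono Set.subset_union_left (hρ.mem_wrapGraph hP hβ h1 hβinv hE hγ i j))
    (wrapGraph_mono Set.subset_union_right
      (hρ'.mem_wrapGraph hP (hβ.of_mem hreg.injOn h𝒩') h2 hβinv hE hγ i j))).mpr rfl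

/-- An automaton whose wrapping on a sufficiently large torus is invertible is invertible: the
inverse on the torus has the reflected neighbourhood, hence can be unwrapped. -/
theorem IsLocalWrapping.surjective {n : ℕ} [NeZero n]
    {β : LocalAlgebra π (Torus s n) →ₐ[ℂ] LocalAlgebra π (Torus s n)}
    (h : IsLocalWrapping n α β 𝒩)
    (hinj : Set.InjOn (wrapHom s n) ((-𝒩 + 𝒩) ∪ {0} : Finset (ZLattice s))) :
    Function.Surjective α := by
  have h0 : ∀ i j, ∃ a, α a = cellUnit π 0 i j := by
    intro i j
    obtain ⟨v, hv⟩ := (bijective_of_fintype β).2 (cellUnit π 0 i j)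
    -- `β v` is a cell at the origin, so `v` graded-commutes with every cell `x` whose image under
    -- `β` does not reach the origin, that is, with all `x` outside the wrapped `-𝒩`
    have hv' : v ∈ regionSub π
        (wrapHom s n '' ((-𝒩 : Finset (ZLattice s)) : Set (ZLattice s))) := by
      classical
      have := mem_of_comm (Λ := Set.univ) (a := v)
        ((Finset.univ : Finset (Torus s n)) \ (-𝒩).image (wrapHom s n)) (mem_regionSub_univ v) ?_
      · refine regionSub_mono ?_ this
        rintro x ⟨-, hx⟩
        by_contra hx'
        refine hx ?_
        rw [Finset.mem_coe, Finset.mem_sdiff, ← Finset.mem_coe, ← Finset.mem_coe, Finset.coe_image]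
        exact ⟨Finset.mem_univ x, hx'⟩
      · intro x hx k l
        have hx' : x ∉ (-𝒩).image (wrapHom s n) := (Finset.mem_sdiff.mp hx).2
        refine (bijective_of_fintype β).1 ?_
        have hhom := h.right.isHomog (isHomog_cellUnit (π := π) x k l)
        have hmem : β (cellUnit π x k l) ∈
            regionSub π (x +ᵥ (wrapHom s n '' (𝒩 : Set (ZLattice s)))) := by
          rw [h.right.cellUnit]
          exact shift_mem x (wrapGraph_snd (h.rule k l))
        have hd : Disjoint (x +ᵥ (wrapHom s n '' (𝒩 : Set (ZLattice s)))) {0} := by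
          rw [Set.disjoint_singleton_right]
          rintro ⟨_, ⟨u, hu, rfl⟩, hxu⟩
          refine hx' (Finset.mem_image.mpr ⟨-u, Finset.neg_mem_neg hu, ?_⟩)
          rw [map_neg]
          exact neg_eq_of_add_eq_zero_left hxu
        have htw : β (twist (π k + π l) v) = twist (π k + π l) (cellUnit π 0 i j) := by
          rcases zmod_two_cases (π k + π l) with hp | hp
          · rw [hp, twist_zero, twist_zero, hv]
          · rw [hp, h.right.twist, hv]
        rw [map_mul, map_mul, htw, hv, hhom.mul_comm_of_disjoint hd hmem
          (twist_mem _ (cellUnit_mem (Set.mem_singleton _) i j)), twist_twist]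
    obtain ⟨w, hw⟩ := wrapGraph_exists_left hv'
    refine ⟨w, ?_⟩
    have h1 := wrapGraph_map h.left h.right h.rule hw
    rw [hv] at h1
    rw [Finset.coe_union, Finset.coe_add, Finset.coe_singleton] at hinj
    have h2 := cellUnit_mem_wrapGraph (π := π) (f := wrapHom s n)
      (Λ := (((-𝒩 : Finset (ZLattice s)) : Set (ZLattice s)) + (𝒩 : Set (ZLattice s))) ∪ {0})
      (x := 0) (Or.inr rfl) i j
    rw [map_zero] at h2
    exact (wrapGraph_eq_iff hinj (wrapGraph_mono Set.subset_union_left h1) h2).mpr rfl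
  intro a
  induction a using local_induction with
  | hu x i j =>
    obtain ⟨a, ha⟩ := h0 i j
    exact ⟨shift x a, by rw [h.left.shift, ha, shift_cellUnit, add_zero]⟩
  | hs c => exact ⟨_, AlgHom.commutes _ c⟩
  | ha a b h1 h2 =>
    obtain ⟨a, rfl⟩ := h1
    obtain ⟨b, rfl⟩ := h2
    exact ⟨a + b, map_add _ _ _⟩
  | hm a b h1 h2 =>
    obtain ⟨a, rfl⟩ := h1
    obtain ⟨b, rfl⟩ := h2
    exact ⟨a * b, map_mul _ _ _⟩

/-- If the product projection is locally invariant, the compressed transition rule defines an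
automaton. -/
theorem IsRenormalisedRule.exists_localCA [Nonempty (Fin r)] (hP : IsProjection P)
    (hα : IsLocalCA α) (h𝒩 : ∀ i j, α (cellUnit π 0 i j) ∈ regionSub π (𝒩 : Set (ZLattice s)))
    (hinv : IsLocallyInvariant α P (tileNeighbourhood N 𝒩))
    (hρ : IsRenormalisedRule α E₀ (tileNeighbourhood N 𝒩) ρ) :
    ∃ δ : LocalAlgebra π' (ZLattice s) →ₐ[ℂ] LocalAlgebra π' (ZLattice s),
      IsLocalCA δ ∧ Function.Bijective δ ∧ ∀ i j, δ (cellUnit π' 0 i j) = ρ i j := by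
  set F := tileNeighbourhood N 𝒩
  obtain ⟨m, _, hreg, hD, β, hβ⟩ := exists_large (N := N) hα h𝒩
    ((F ∪ (F - F + F)) ∪ ((-F + F) ∪ {0}))
  rw [Finset.coe_union] at hD
  have hD1 := hD.mono Set.subset_union_left
  have hD2 := hD.mono Set.subset_union_right
  have hF : Set.InjOn (wrapHom s m) (F : Set (ZLattice s)) := by
    rw [Finset.coe_union] at hD1
    exact hD1.mono Set.subset_union_left
  have hβinv := hβ.map_proj_eq hP hF hinv
  obtain ⟨E, hE⟩ := Tiling.exists_isIsometry (t := torusTiling s N m) (E₀ := E₀) hP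
  obtain ⟨γ, hγ', hγ⟩ := hE.exists_induced torusTiling_isEquivariant tiles_torusTiling_univ hP
    hβ.right hβinv
  have hrel := fun i j => hρ.mem_wrapGraph hP hβ hF hβinv hE hγ i j
  have hrule := (isRule_iff_of_wrapGraph hrel hF).mpr hγ'.isRule
  have hcomm := (ruleComm_iff_of_wrapGraph hrel hrule hγ'.isRule
    ((isRegular_of_injOn hD1).injOn_union hF)).mpr hγ'.ruleComm
  obtain ⟨δ, hδ, hδr⟩ := hrule.exists_localCA hcomm
  have hw : IsLocalWrapping m δ γ F := ⟨hδ, hγ', fun i j => by rw [hδr]; exact hrel i j⟩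
  have := nontrivial_local π' (ZLattice s)
  exact ⟨δ, hδ, ⟨algHom_injective δ, hw.surjective hD2⟩, hδr⟩

end Renormalised

/-! ### Existence of a tile isometry -/

section Spectral

variable {V : Type*} [NormedAddCommGroup V] [InnerProductSpace ℂ V] [FiniteDimensional ℂ V]

open InnerProductSpace in
/-- The corner of a projection which commutes with a self-adjoint involution has a system of matrix
units in which the involution is diagonal. -/
theorem exists_matrixUnits {Q Z : V →L[ℂ] V} (hQs : star Q = Q) (hQ : Q * Q = Q)
    (hZs : star Z = Z) (hZ : Z * Z = 1) (hc : Z * Q = Q * Z) :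
    ∃ (r : ℕ) (q : Fin r → ZMod 2) (u : Fin r → Fin r → V →L[ℂ] V),
      (∀ i j, Z * u i j = sgn (q i + q j) • (u i j * Z)) ∧
      (∀ i j k l, u i j * u k l = if j = k then u i l else 0) ∧
      (∀ i j, star (u i j) = u j i) ∧ ∑ i, u i i = Q ∧
      ∀ a, Q * a * Q ∈ Submodule.span ℂ (Set.range fun ij : Fin r × Fin r => u ij.1 ij.2) := by
  have hsym : ∀ {A : V →L[ℂ] V}, star A = A → ∀ x y, inner ℂ (A x) y = inner ℂ x (A y) := by
    intro A hA x y
    nth_rewrite 2 [← hA]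
    rw [ContinuousLinearMap.star_eq_adjoint, ContinuousLinearMap.adjoint_inner_right]
  let W : Submodule ℂ V := LinearMap.range (Q : V →ₗ[ℂ] V)
  have hQW : ∀ w : W, Q w = w := by
    rintro ⟨_, x, rfl⟩
    exact DFunLike.congr_fun hQ x
  let ZW : W →ₗ[ℂ] W := (Z : V →ₗ[ℂ] V).restrict (p := W) (q := W) (by
    rintro _ ⟨x, rfl⟩
    exact ⟨Z x, (DFunLike.congr_fun hc x).symm⟩)
  have hZW : ∀ w : W, ((ZW w : W) : V) = Z w := fun w => rfl
  have hT : ZW.IsSymmetric := fun x y => hsym hZs x y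
  let b := hT.eigenvectorBasis rfl
  let ν := hT.eigenvalues rfl
  have hb : ∀ i, Z (b i : V) = (ν i : ℂ) • (b i : V) := fun i =>
    congrArg Subtype.val (hT.apply_eigenvectorBasis rfl i)
  have hν : ∀ i, (ν i : ℂ) = 1 ∨ (ν i : ℂ) = -1 := fun i => by
    have h1 : Z (Z (b i : V)) = (b i : V) := DFunLike.congr_fun hZ _
    rw [hb, map_smul, hb, smul_smul] at h1
    have h2 : (b i : V) ≠ 0 := by
      intro h0
      exact (b.orthonormal.ne_zero i) (Subtype.ext h0)
    exact mul_self_eq_one_iff.mp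
      (smul_left_injective ℂ h2 (h1.trans (one_smul ℂ _).symm))
  have hsgn : ∀ i, (ν i : ℂ) = sgn (if (ν i : ℂ) = 1 then 0 else 1) := fun i => by
    rcases hν i with h | h
    · rw [if_pos h, h, sgn_zero]
    · rw [if_neg (by rw [h]; norm_num), h]; simp [sgn]
  have horth : ∀ i j, inner ℂ (b i : V) (b j : V) = if i = j then 1 else 0 := fun i j =>
    orthonormal_iff_ite.mp b.orthonormal i j
  have hsum : ∑ i, rankOne ℂ (b i : V) (b i : V) = Q := by
    ext1 x
    rw [sum_apply]
    have h1 := congrArg (Subtype.val : W → V) (b.sum_repr' ⟨Q x, x, rfl⟩)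
    simp only at h1
    rw [← h1, AddSubmonoidClass.coe_finsetSum]
    refine Finset.sum_congr rfl fun i _ => ?_
    rw [rankOne_apply]
    change inner ℂ (b i : V) x • (b i : V) = inner ℂ (b i : V) (Q x) • (b i : V)
    rw [← hsym hQs, hQW]
  refine ⟨_, fun i => if (ν i : ℂ) = 1 then 0 else 1, fun i j => rankOne ℂ (b i : V) (b j : V),
    fun i j => ?_, fun i j k l => ?_, fun i j => ?_, hsum, fun a => ?_⟩
  · rw [sgn_add, ← hsgn, ← hsgn]
    ext1 x
    rw [smul_apply, mul_apply_eq_comp, mul_apply_eq_comp, rankOne_apply, rankOne_apply, map_smul,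
      hb, ← hsym hZs, hb, inner_smul_left, smul_smul, smul_smul, Complex.conj_ofReal]
    have h1 : (ν j : ℂ) * ν j = 1 := mul_self_eq_one_iff.mpr (hν j)
    congr 1
    linear_combination (-(inner ℂ (b j : V) x * ν i)) * h1
  · ext1 x
    rw [mul_apply_eq_comp, rankOne_apply, rankOne_apply, inner_smul_right, horth]
    split_ifs
    · rw [mul_one, rankOne_apply]
    · simp
  · rw [ContinuousLinearMap.star_eq_adjoint, adjoint_rankOne]
  · rw [← hsum, Finset.sum_mul, Finset.sum_mul]
    refine Submodule.sum_mem _ fun i _ => ?_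
    rw [Finset.mul_sum]
    refine Submodule.sum_mem _ fun j _ => ?_
    have : rankOne ℂ (b i : V) (b i : V) * a * rankOne ℂ (b j : V) (b j : V) =
        inner ℂ (b i : V) (a (b j : V)) • rankOne ℂ (b i : V) (b j : V) := by
      ext1 x
      rw [mul_apply_eq_comp, mul_apply_eq_comp, smul_apply, rankOne_apply, rankOne_apply,
        rankOne_apply, map_smul, inner_smul_right, smul_smul, mul_comm]
    rw [this]
    exact Submodule.smul_mem _ _ (Submodule.subset_span ⟨(i, j), rfl⟩)

end Spectral

section TileIsometry

variable {κ : Type} [Fintype κ] [DecidableEq κ] {π : κ → ZMod 2} [Nonempty κ] {s N : ℕ}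

/-- The parity operator of a single cell. -/
theorem exists_siteParity {G : Type} [Fintype G] [DecidableEq G] (x : G) :
    ∃ z ∈ regionSub π ({x} : Set G), IsHomog 0 z ∧ star z = z ∧ z * z = 1 ∧
      (∀ i j, z * cellUnit π x i j = sgn (π i) • cellUnit π x i j) ∧
      ∀ i j, cellUnit π x i j * z = sgn (π j) • cellUnit π x i j := by
  have hzl : ∀ i j, (∑ i, sgn (π i) • cellUnit π x i i) * cellUnit π x i j =
      sgn (π i) • cellUnit π x i j := fun i j => by
    simp [Finset.sum_mul, cellUnit_mul]
  have hzr : ∀ i j, cellUnit π x i j * (∑ i, sgn (π i) • cellUnit π x i i) =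
      sgn (π j) • cellUnit π x i j := fun i j => by
    simp [Finset.mul_sum, cellUnit_mul]
  refine ⟨∑ i, sgn (π i) • cellUnit π x i i, ?_, ?_, ?_, ?_, hzl, hzr⟩
  · have h1 : ∀ i, sgn (π i) • cellUnit π x i i ∈ regionSub π ({x} : Set G) := fun i =>
      Subalgebra.smul_mem _ (cellUnit_mem (Set.mem_singleton x) i i) _
    exact Subalgebra.sum_mem _ fun i _ => h1 i
  · have h1 : ∀ i, twist 1 (cellUnit π x i i) = cellUnit π x i i := fun i => by
      rw [twist_cellUnit, CharTwo.add_self_eq_zero, mul_zero, sgn_zero, one_smul]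
    rw [IsHomog, map_sum, sgn_zero, one_smul]
    exact Finset.sum_congr rfl fun i _ => by rw [map_smul, h1]
  · rw [star_sum]
    exact Finset.sum_congr rfl fun i _ => by rw [star_smul, star_sgn, star_cellUnit]
  · rw [Finset.mul_sum, ← sum_cellUnit x]
    exact Finset.sum_congr rfl fun i _ => by
      rw [mul_smul_comm, hzl, smul_smul, sgn_mul_self, one_smul]

/-- The parity automorphism of a finite system is implemented by a self-adjoint involution. -/
theorem exists_parity (π : κ → ZMod 2) (G : Type) [Fintype G] [DecidableEq G] :
    ∃ Z : LocalAlgebra π G, star Z = Z ∧ Z * Z = 1 ∧ ∀ a, Z * a = twist 1 a * Z := by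
  have key : ∀ F : Finset G, ∃ Z ∈ regionSub π (F : Set G), IsHomog 0 Z ∧ star Z = Z ∧
      Z * Z = 1 ∧ ∀ x ∈ F, ∀ i j, Z * cellUnit π x i j = twist 1 (cellUnit π x i j) * Z := by
    intro F
    induction F using Finset.induction_on with
    | empty => exact ⟨1, one_mem _, isHomog_one, star_one _, mul_one 1, by simp⟩
    | insert x F hx ih =>
      obtain ⟨Z, hmem, hhom, hs, hZ, hc⟩ := ih
      obtain ⟨z, hzmem, hzhom, hzs, hzz, hzl, hzr⟩ := exists_siteParity (π := π) x
      have hd : Disjoint ({x} : Set G) (F : Set G) := Set.disjoint_singleton_left.mpr hx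
      have hcomm : z * Z = Z * z := hzhom.comm_of_disjoint hd hzmem hmem
      have h1 : ({x} : Set G) ⊆ ((insert x F : Finset G) : Set G) :=
        Set.singleton_subset_iff.mpr (Finset.mem_insert_self x F)
      have h2 : (F : Set G) ⊆ ((insert x F : Finset G) : Set G) :=
        fun y hy => Finset.mem_insert_of_mem hy
      have h3 : z * Z ∈ regionSub π ((insert x F : Finset G) : Set G) :=
        (regionSub π _).mul_mem (regionSub_mono h1 hzmem) (regionSub_mono h2 hmem)
      have h4 : IsHomog 0 (z * Z) := hzhom.mul hhom
      have h5 : star (z * Z) = z * Z := by rw [star_mul, hs, hzs, hcomm]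
      have h6 : z * Z * (z * Z) = 1 := by
        rw [mul_assoc, ← mul_assoc Z, ← hcomm, mul_assoc z, hZ, mul_one, hzz]
      refine ⟨z * Z, h3, h4, h5, h6, ?_⟩
      · intro y hy i j
        by_cases hyx : y = x
        · subst hyx
          rw [mul_assoc,
            hhom.comm_of_disjoint hd.symm hmem (cellUnit_mem (Set.mem_singleton y) i j),
            ← mul_assoc, ← mul_assoc, hzl, twist_cellUnit, smul_mul_assoc (sgn (1 * _)), hzr,
            smul_smul, one_mul, sgn_add, mul_assoc, sgn_mul_self, mul_one]
        · have hyF : y ∈ F := Finset.mem_of_mem_insert_of_ne hy hyx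
          rw [mul_assoc, hc y hyF, ← mul_assoc, ← mul_assoc,
            hzhom.comm_of_disjoint (Set.disjoint_singleton.mpr (Ne.symm hyx)) hzmem
              (twist_mem _ (cellUnit_mem (Set.mem_singleton y) i j))]
  obtain ⟨Z, -, -, hs, hZ, hc⟩ := key Finset.univ
  refine ⟨Z, hs, hZ, fun a => ?_⟩
  induction a using local_induction with
  | hu x i j => exact hc x (Finset.mem_univ x) i j
  | hs c => rw [AlgHom.commutes]; exact (Algebra.commutes c Z).symm
  | ha a b h1 h2 => rw [mul_add, map_add, add_mul, h1, h2]
  | hm a b h1 h2 => rw [← mul_assoc, h1, mul_assoc, h2, map_mul, mul_assoc]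

/-- A tile isometry onto the corner of an even projection is a basis of its range in which the
parity operator is diagonal. -/
theorem exists_tileIsometry {P : LocalAlgebra π (tile s N)} (hP : IsProjection P) :
    ∃ (r : ℕ) (π' : Fin r → ZMod 2), Nonempty (TileIsometry P r π') := by
  obtain ⟨Z, hZs, hZ, hc⟩ := exists_parity π (tile s N)
  let Φ := operatorEquiv π (tile s N)
  let L : LocalAlgebra π (tile s N) ≃ₐ[ℂ] (ConfSpace κ (tile s N) →L[ℂ] ConfSpace κ (tile s N)) :=
    (localEquiv π (tile s N)).trans Φ.toAlgEquiv
  have hLΦ : ∀ a, L a = Φ (toQL a) := fun a => rfl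
  have hL : ∀ a, L (star a) = star (L a) := fun a => by rw [hLΦ, hLΦ, toQL_star, map_star]
  have hPZ : Z * P = P * Z := by
    rw [hc, hP.isHomog, sgn_zero, one_smul]
  obtain ⟨r, π', u, h1, h2, h3, h4, h5⟩ := exists_matrixUnits (Q := L P) (Z := L Z)
    (by rw [← hL, hP.star]) (by rw [← map_mul, hP.idem]) (by rw [← hL, hZs])
    (by rw [← map_mul, hZ, map_one]) (by rw [← map_mul, ← map_mul, hPZ])
  have hgen : ∀ v : Fin r → Fin r → LocalAlgebra π (tile s N), (∀ i j, L (v i j) = u i j) →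
      Nonempty (TileIsometry P r π') := by
    intro v hv
    refine ⟨⟨v, fun i j => mem_graded_iff.mpr ?_, fun i j k l => L.injective ?_, fun i j => ?_,
      L.injective ?_, fun a => ?_⟩⟩
    · have h6 : Z * v i j = sgn (π' i + π' j) • (v i j * Z) := L.injective (by
        rw [map_mul, map_smul, map_mul, hv, h1])
      have h7 := congrArg (· * Z) ((hc (v i j)).symm.trans h6)
      simp only [mul_assoc, smul_mul_assoc, hZ, mul_one] at h7
      exact h7
    · rw [map_mul, hv, hv, h2]
      split_ifs
      · rw [hv]
      · rw [map_zero]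
    · rw [← toQL_star]
      exact congrArg _ (L.injective (by rw [hL, hv, hv, h3]))
    · rw [map_sum, ← h4]
      exact Finset.sum_congr rfl fun i _ => hv i i
    · have h8 := h5 (L a)
      rw [← map_mul, ← map_mul] at h8
      have h9 : Submodule.span ℂ (Set.range fun ij : Fin r × Fin r => u ij.1 ij.2) =
          (Submodule.span ℂ (Set.range fun ij : Fin r × Fin r => v ij.1 ij.2)).map
            L.toLinearMap := by
        rw [Submodule.map_span, ← Set.range_comp]
        congr 2
        funext ij
        exact (hv _ _).symm
      rw [h9] at h8
      obtain ⟨c, hc', hca⟩ := h8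
      rwa [L.injective hca] at hc'
  exact ⟨r, π', hgen (fun i j => L.symm (u i j)) fun i j => L.apply_symm_apply _⟩

end TileIsometry

/-! ### The lattice isometry on the quasi-local algebra -/

section LatticeIsometry

variable {κ : Type} [Fintype κ] [DecidableEq κ] {π : κ → ZMod 2} [Nonempty κ] {s N m : ℕ}
  [NeZero N] [NeZero m] {P : LocalAlgebra π (tile s N)} {r : ℕ} {π' : Fin r → ZMod 2}
  {E₀ : TileIsometry P r π'}

theorem productProjection_eq (m : ℕ) [NeZero m] (P : LocalAlgebra π (tile s N)) :
    productProjection m P = toQL ((torusTiling s N m).proj P Finset.univ) := by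
  unfold productProjection Tiling.proj
  rw [map_list_prod, List.map_map]
  rfl

theorem productProjection_idem (m : ℕ) [NeZero m] (hP : IsProjection P) :
    productProjection m P * productProjection m P = productProjection m P := by
  rw [productProjection_eq, ← map_mul, Tiling.proj_idem hP]

variable {E : QuasiLocal π' (Torus s m) →⋆ₙₐ[ℂ] QuasiLocal π (Torus s (N * m))}
  {L : LocalAlgebra π' (Torus s m) →ₗ[ℂ] LocalAlgebra π (Torus s (N * m))}

/-- A lattice isometry is determined by its values on the cells, which are those of the lattice
isometry of local algebras. -/
theorem IsLatticeIsometry.apply_toQL (hE : IsLatticeIsometry m E₀ E)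
    (hL : (torusTiling s N m).IsIsometry E₀ L) (a : LocalAlgebra π' (Torus s m)) :
    E (toQL a) = toQL (L a) := by
  induction a using local_induction with
  | hu x i j =>
    rw [hE.2, hL.unit, map_mul, ← productProjection_eq]
    rfl
  | hs c =>
    rw [hL.algebraMap, Algebra.algebraMap_eq_smul_one, map_smul, map_smul, map_smul, map_one, hE.1,
      productProjection_eq]
  | ha a b h1 h2 => rw [map_add, map_add, map_add, map_add, h1, h2]
  | hm a b h1 h2 => rw [map_mul, map_mul, hL.mul, map_mul, h1, h2]

theorem exists_latticeIsometry [Nonempty (Fin r)] (hP : IsProjection P)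
    (hL : (torusTiling s N m).IsIsometry E₀ L) : ∃ E, IsLatticeIsometry m E₀ E := by
  let e := localEquiv π' (Torus s m)
  have he : ∀ a, e.symm (toQL a) = a := fun a => e.symm_apply_apply a
  let E : QuasiLocal π' (Torus s m) →⋆ₙₐ[ℂ] QuasiLocal π (Torus s (N * m)) :=
    { toFun := fun a => toQL (L (e.symm a))
      map_smul' := fun c a => by rw [map_smul, map_smul, map_smul]; rfl
      map_zero' := by rw [map_zero, map_zero, map_zero]
      map_add' := fun a b => by rw [map_add, map_add, map_add]
      map_mul' := fun a b => by rw [map_mul, hL.mul, map_mul]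
      map_star' := fun a => by
        obtain ⟨a, rfl⟩ := toQL_surjective a
        rw [← toQL_star, he, he, hL.star hP, toQL_star] }
  have hE : ∀ a, E (toQL a) = toQL (L a) := fun a => by
    change toQL (L (e.symm (toQL a))) = _
    rw [he]
  refine ⟨E, ?_, fun x i j => ?_⟩
  · rw [← map_one (toQL (π := π') (G := Torus s m)), hE, hL.one, productProjection_eq]
  · rw [hE, hL.unit, map_mul, productProjection_eq]
    rfl

theorem existsUnique_latticeIsometry (hP : IsProjection P) (E₀ : TileIsometry P r π') (m : ℕ)
    [NeZero m] : ∃! E, IsLatticeIsometry m E₀ E := by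
  have := E₀.nonempty hP
  obtain ⟨L, hL⟩ := Tiling.exists_isIsometry (t := torusTiling s N m) (E₀ := E₀) hP
  obtain ⟨E, hE⟩ := exists_latticeIsometry hP hL
  refine ⟨E, hE, fun E' hE' => NonUnitalStarAlgHom.ext fun a => ?_⟩
  obtain ⟨a, rfl⟩ := toQL_surjective a
  rw [hE.apply_toQL hL, hE'.apply_toQL hL]

theorem IsLatticeIsometry.injective (hP : IsProjection P) (hE : IsLatticeIsometry m E₀ E) :
    Function.Injective E := by
  have := E₀.nonempty hP
  obtain ⟨L, hL⟩ := Tiling.exists_isIsometry (t := torusTiling s N m) (E₀ := E₀) hP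
  intro a b hab
  obtain ⟨a, rfl⟩ := toQL_surjective a
  obtain ⟨b, rfl⟩ := toQL_surjective b
  rw [hE.apply_toQL hL, hE.apply_toQL hL] at hab
  rw [hL.injective hP (toQL_injective hab)]

theorem IsLatticeIsometry.coisometry_apply (hP : IsProjection P) (hE : IsLatticeIsometry m E₀ E)
    (a : QuasiLocal π' (Torus s m)) : coisometry m P E (E a) = a := by
  have h1 : productProjection m P * E a * productProjection m P = E a := by
    rw [← hE.1, ← map_mul, ← map_mul, one_mul, mul_one]
  rw [coisometry, h1]
  exact Function.leftInverse_invFun (hE.injective hP) a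

theorem IsLatticeIsometry.apply_coisometry (hP : IsProjection P) (hE : IsLatticeIsometry m E₀ E)
    (a : QuasiLocal π (Torus s (N * m))) :
    E (coisometry m P E a) = productProjection m P * a * productProjection m P := by
  have := E₀.nonempty hP
  obtain ⟨L, hL⟩ := Tiling.exists_isIsometry (t := torusTiling s N m) (E₀ := E₀) hP
  obtain ⟨a, rfl⟩ := toQL_surjective a
  obtain ⟨b, hb⟩ := hL.exists_eq hP tiles_torusTiling_univ a
  refine Function.invFun_eq ⟨toQL b, ?_⟩
  rw [hE.apply_toQL hL, hb, map_mul, map_mul, ← productProjection_eq]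

end LatticeIsometry

/-! ### Renormalisability -/

section Main

variable {κ : Type} [Fintype κ] [DecidableEq κ] {π : κ → ZMod 2} [Nonempty κ] {s N m : ℕ}
  [NeZero N] [NeZero m] {P : LocalAlgebra π (tile s N)} {r : ℕ} {π' : Fin r → ZMod 2}
  {E₀ : TileIsometry P r π'}
  {R : QuasiLocal π (ZLattice s) ≃⋆ₐ[ℂ] QuasiLocal π (ZLattice s)}
  {α : LocalAlgebra π (ZLattice s) →ₐ[ℂ] LocalAlgebra π (ZLattice s)}
  {𝒩 𝒩₀ : Finset (ZLattice s)}
  {Tw : QuasiLocal π (Torus s (N * m)) ≃⋆ₐ[ℂ] QuasiLocal π (Torus s (N * m))}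
  {E : QuasiLocal π' (Torus s m) →⋆ₙₐ[ℂ] QuasiLocal π (Torus s (N * m))}

theorem IsWrapping.exists_isLocalWrapping {n : ℕ}
    {Tw : QuasiLocal π (Torus s n) ≃⋆ₐ[ℂ] QuasiLocal π (Torus s n)} (h : IsWrapping n R Tw)
    (hα : IsLocalCA α) (hR : Restricts R α)
    (h𝒩 : ∀ i j, α (cellUnit π 0 i j) ∈ regionSub π (𝒩 : Set (ZLattice s))) :
    ∃ β, Restricts Tw β ∧ IsLocalWrapping n α β 𝒩 := by
  obtain ⟨β, hβ, hTw⟩ := h.1.exists_restricts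
  exact ⟨β, hTw, hα, hβ, h.mem_wrapGraph hR hTw h𝒩⟩

theorem IsLocalWrapping.isWrapping {n : ℕ} {𝒩 : Finset (ZLattice s)}
    {Tw : QuasiLocal π (Torus s n) ≃⋆ₐ[ℂ] QuasiLocal π (Torus s n)}
    {β : LocalAlgebra π (Torus s n) →ₐ[ℂ] LocalAlgebra π (Torus s n)}
    (h : IsLocalWrapping n α β 𝒩) (hR : Restricts R α) (hTw : Restricts Tw β)
    (hinj : Set.InjOn (wrapHom s n) (𝒩 : Set (ZLattice s))) : IsWrapping n R Tw :=
  isWrapping_of_mem_wrapGraph h.left h.right hR hTw hinj h.rule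

theorem map_productProjection_eq_iff {β : LocalAlgebra π (Torus s (N * m)) →ₐ[ℂ]
      LocalAlgebra π (Torus s (N * m))} (hTw : Restricts Tw β) :
    Tw (productProjection m P) = productProjection m P ↔
      β ((torusTiling s N m).proj P Finset.univ) = (torusTiling s N m).proj P Finset.univ := by
  rw [productProjection_eq, hTw]
  exact toQL_injective.eq_iff

/-- The invariance of the product projection is a condition on the infinite lattice. -/
theorem IsWrapping.map_productProjection_iff (hα : IsLocalCA α) (hR : Restricts R α)
    (hP : IsProjection P)
    (h𝒩₀ : ∀ i j, α (cellUnit π 0 i j) ∈ regionSub π (𝒩₀ : Set (ZLattice s)))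
    (hreg : IsRegularWrapping N m R 𝒩) (h : IsWrapping (N * m) R Tw) :
    Tw (productProjection m P) = productProjection m P ↔
      IsLocallyInvariant α P (tileNeighbourhood N 𝒩₀) := by
  obtain ⟨h𝒩, -, hinj⟩ := hreg
  rw [hR.isNeighbourhood_iff hα] at h𝒩
  obtain ⟨β, hTw, hβ⟩ := h.exists_isLocalWrapping hα hR h𝒩
  rw [map_productProjection_eq_iff hTw]
  constructor
  · intro h1
    exact (hβ.isLocallyInvariant hP hinj h1).of_mem hP (map_copy_mem hα h𝒩₀ P)
  · intro h1
    exact hβ.map_proj_eq hP hinj (h1.of_mem hP (map_copy_mem hα h𝒩 P))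

/-- There are regular wrappings on which a given finite set is mapped injectively. -/
theorem exists_isRegularWrapping (hα : IsLocalCA α) (hR : Restricts R α)
    (h𝒩 : ∀ i j, α (cellUnit π 0 i j) ∈ regionSub π (𝒩 : Set (ZLattice s)))
    (D : Finset (ZLattice s)) :
    ∃ (m : ℕ) (_ : NeZero m), IsRegularWrapping N m R 𝒩 ∧
      Set.InjOn (wrapHom s m) (D : Set (ZLattice s)) := by
  obtain ⟨m, hm, hreg, hD, -⟩ := exists_large (N := N) hα h𝒩 (tileNeighbourhood N 𝒩 ∪ D)
  rw [Finset.coe_union] at hD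
  exact ⟨m, hm, ⟨(hR.isNeighbourhood_iff hα).mpr h𝒩, hreg, hD.mono Set.subset_union_left⟩,
    hD.mono Set.subset_union_right⟩

/-- The automaton `δ` has the compressed transition rule of `α`. -/
def IsLocalRenormalisation (α : LocalAlgebra π (ZLattice s) →ₐ[ℂ] LocalAlgebra π (ZLattice s))
    (E₀ : TileIsometry P r π') (F : Finset (ZLattice s))
    (δ : LocalAlgebra π' (ZLattice s) →ₐ[ℂ] LocalAlgebra π' (ZLattice s)) : Prop :=
  IsRenormalisedRule α E₀ F fun i j => δ (cellUnit π' 0 i j)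

theorem IsLocalRenormalisation.of_mem [Nonempty (Fin r)] (hP : IsProjection P) (hα : IsLocalCA α)
    {δ : LocalAlgebra π' (ZLattice s) →ₐ[ℂ] LocalAlgebra π' (ZLattice s)}
    (h𝒩₀ : ∀ i j, α (cellUnit π 0 i j) ∈ regionSub π (𝒩₀ : Set (ZLattice s)))
    (h𝒩 : ∀ i j, α (cellUnit π 0 i j) ∈ regionSub π (𝒩 : Set (ZLattice s)))
    (hinv : IsLocallyInvariant α P (tileNeighbourhood N 𝒩₀))
    (hδ : IsLocalRenormalisation α E₀ (tileNeighbourhood N 𝒩₀) δ) :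
    IsLocalRenormalisation α E₀ (tileNeighbourhood N 𝒩) δ := by
  obtain ⟨ρ, hρ⟩ := exists_isRenormalisedRule hP hα h𝒩 E₀
  have := IsRenormalisedRule.unique hP hα h𝒩₀ h𝒩 hinv hδ hρ
  unfold IsLocalRenormalisation
  rwa [this]

/-- On each regular wrapping, the induced automaton of the coarse-grained torus is a wrapping of the
renormalised automaton. -/
theorem IsLocalRenormalisation.exists_isLocalWrapping [Nonempty (Fin r)] (hP : IsProjection P)
    (hα : IsLocalCA α) (hR : Restricts R α)
    {δ : LocalAlgebra π' (ZLattice s) →ₐ[ℂ] LocalAlgebra π' (ZLattice s)} (hδ' : IsLocalCA δ)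
    (hinv : IsLocallyInvariant α P (tileNeighbourhood N 𝒩))
    (hδ : IsLocalRenormalisation α E₀ (tileNeighbourhood N 𝒩) δ)
    (hreg : IsRegularWrapping N m R 𝒩) (hTw : IsWrapping (N * m) R Tw)
    (hE : IsLatticeIsometry m E₀ E) :
    ∃ γ, IsLocalWrapping m δ γ (tileNeighbourhood N 𝒩) ∧
      ∀ a, Tw (E (toQL a)) = E (toQL (γ a)) := by
  obtain ⟨h𝒩, -, hinj⟩ := hreg
  rw [hR.isNeighbourhood_iff hα] at h𝒩
  obtain ⟨β, hTwβ, hβ⟩ := hTw.exists_isLocalWrapping hα hR h𝒩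
  have hβinv := hβ.map_proj_eq hP hinj hinv
  obtain ⟨L, hL⟩ := Tiling.exists_isIsometry (t := torusTiling s N m) (E₀ := E₀) hP
  obtain ⟨γ, hγ', hγ⟩ := hL.exists_induced torusTiling_isEquivariant tiles_torusTiling_univ hP
    hβ.right hβinv
  refine ⟨γ, ⟨hδ', hγ', fun i j => hδ.mem_wrapGraph hP hβ hinj hβinv hL hγ i j⟩, fun a => ?_⟩
  rw [hE.apply_toQL hL, hE.apply_toQL hL, hTwβ, hγ]

/-- Automata with a common wrapping on a torus which is injective on a neighbourhood of both are
equal. -/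
theorem IsLocalWrapping.eq {n : ℕ} {F F' : Finset (ZLattice s)}
    {δ δ' : LocalAlgebra π (ZLattice s) →ₐ[ℂ] LocalAlgebra π (ZLattice s)}
    {γ : LocalAlgebra π (Torus s n) →ₐ[ℂ] LocalAlgebra π (Torus s n)}
    (h : IsLocalWrapping n δ γ F) (h' : IsLocalWrapping n δ' γ F')
    (hinj : Set.InjOn (wrapHom s n) ((F : Set (ZLattice s)) ∪ F')) : δ = δ' :=
  h.left.ext h'.left fun i j => (wrapGraph_eq_iff hinj
    (wrapGraph_mono Set.subset_union_left (h.rule i j))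
    (wrapGraph_mono Set.subset_union_right (h'.rule i j))).mpr rfl

/-- A renormalisation leaves the product projection invariant, as it is the image of the unit. -/
theorem IsRenormalisation.isLocallyInvariant {T : QuasiLocal π (ZLattice s) ≃⋆ₐ[ℂ]
      QuasiLocal π (ZLattice s)} {S : QuasiLocal π' (ZLattice s) ≃⋆ₐ[ℂ] QuasiLocal π' (ZLattice s)}
    (hS : IsRenormalisation T E₀ S) (hα : IsLocalCA α) (hR : Restricts (T ^ N) α)
    (hP : IsProjection P)
    (h𝒩 : ∀ i j, α (cellUnit π 0 i j) ∈ regionSub π (𝒩 : Set (ZLattice s))) :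
    IsLocallyInvariant α P (tileNeighbourhood N 𝒩) := by
  obtain ⟨m, _, hreg, -⟩ := exists_isRegularWrapping (N := N) hα hR h𝒩 ∅
  obtain ⟨Tw, Sw, E, hTw, -, hE, hTS⟩ := hS.2 m ⟨𝒩, hreg⟩
  refine (hTw.map_productProjection_iff hα hR hP h𝒩 hreg).mp ?_
  rw [← hE.1, hTS, map_one]

/-- The renormalised automaton. -/
theorem exists_isRenormalisation {T : QuasiLocal π (ZLattice s) ≃⋆ₐ[ℂ]
      QuasiLocal π (ZLattice s)} (hα : IsLocalCA α) (hR : Restricts (T ^ N) α)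
    (hP : IsProjection P) (E₀ : TileIsometry P r π')
    (h𝒩₀ : ∀ i j, α (cellUnit π 0 i j) ∈ regionSub π (𝒩₀ : Set (ZLattice s)))
    (hinv : IsLocallyInvariant α P (tileNeighbourhood N 𝒩₀)) :
    ∃ S, IsRenormalisation T E₀ S ∧ (∀ S', IsRenormalisation T E₀ S' → S' = S) ∧
      ∀ (m : ℕ) [NeZero m] (𝒩 : Finset (ZLattice s)), IsRegularWrapping N m (T ^ N) 𝒩 →
        IsNeighbourhood S (tileNeighbourhood N 𝒩) ∧
        ∀ Tw E, IsWrapping (N * m) (T ^ N) Tw → IsLatticeIsometry m E₀ E →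
          ∃ Sw, (∀ O', Sw O' = coisometry m P E (Tw (E O'))) ∧ IsWrapping m S Sw ∧
            ∀ S', IsFCA S' → IsNeighbourhood S' (tileNeighbourhood N 𝒩) →
              IsWrapping m S' Sw → S' = S := by
  have := E₀.nonempty hP
  have hT : IsFCA (T ^ N) := hR.isFCA hα
  obtain ⟨ρ, hρ⟩ := exists_isRenormalisedRule hP hα h𝒩₀ E₀
  obtain ⟨δ, hδ, hbij, hδρ⟩ := hρ.exists_localCA hP hα h𝒩₀ hinv
  have hδ₀ : IsLocalRenormalisation α E₀ (tileNeighbourhood N 𝒩₀) δ := by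
    have : (fun i j => δ (cellUnit π' 0 i j)) = ρ := funext fun i => funext fun j => hδρ i j
    unfold IsLocalRenormalisation
    rwa [this]
  obtain ⟨S, hS, hSδ⟩ := hδ.exists_fca hbij
  -- the induced automata are wrappings of `δ`
  have key : ∀ (m : ℕ) [NeZero m] (𝒩 : Finset (ZLattice s)), IsRegularWrapping N m (T ^ N) 𝒩 →
      ∀ Tw E, IsWrapping (N * m) (T ^ N) Tw → IsLatticeIsometry m E₀ E →
        ∃ γ, IsLocalWrapping m δ γ (tileNeighbourhood N 𝒩) ∧
          ∀ a, Tw (E (toQL a)) = E (toQL (γ a)) := by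
    intro m _ 𝒩 hreg Tw E hTw hE
    have h𝒩 := (hR.isNeighbourhood_iff hα).mp hreg.1
    exact IsLocalRenormalisation.exists_isLocalWrapping hP hα hR hδ
      (hinv.of_mem hP (map_copy_mem hα h𝒩 P)) (hδ₀.of_mem hP hα h𝒩₀ h𝒩 hinv) hreg hTw hE
  refine ⟨S, ⟨hS, fun m _ hex => ?_⟩, fun S' hS' => ?_, fun m _ 𝒩 hreg => ⟨?_, ?_⟩⟩
  · obtain ⟨𝒩, hreg⟩ := hex
    obtain ⟨Tw, hTw⟩ := exists_isWrapping hT hreg.1 hreg.2.1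
    obtain ⟨E, hE, -⟩ := existsUnique_latticeIsometry hP E₀ m
    obtain ⟨γ, hγ, hTE⟩ := key m 𝒩 hreg Tw E hTw hE
    obtain ⟨Sw, -, hSw⟩ := hγ.right.exists_fca (bijective_of_fintype γ)
    refine ⟨Tw, Sw, E, hTw, hγ.isWrapping hSδ hSw hreg.2.2, hE, fun a => ?_⟩
    obtain ⟨a, rfl⟩ := toQL_surjective a
    rw [hTE, hSw]
  · obtain ⟨δ', hδ', hSδ'⟩ := hS'.1.exists_restricts
    obtain ⟨𝒩', h𝒩'⟩ := IsLocalCA.exists_neighbourhood δ'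
    obtain ⟨m, _, hreg, hD⟩ := exists_isRegularWrapping (N := N) hα hR h𝒩₀
      (𝒩' ∪ tileNeighbourhood N 𝒩₀)
    rw [Finset.coe_union] at hD
    obtain ⟨Tw, Sw, E, hTw, hSw, hE, hTS⟩ := hS'.2 m ⟨𝒩₀, hreg⟩
    obtain ⟨γ, hγ, hTE⟩ := key m 𝒩₀ hreg Tw E hTw hE
    obtain ⟨γ', hSwγ', hγ'⟩ := hSw.exists_isLocalWrapping hδ' hSδ' h𝒩'
    have : γ = γ' := AlgHom.ext fun a => toQL_injective (hE.injective hP (by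
      rw [← hTE, hTS, hSwγ']))
    subst this
    have := hγ'.eq hγ hD
    subst this
    exact hSδ'.ext hSδ
  · obtain ⟨Tw, hTw⟩ := exists_isWrapping hT hreg.1 hreg.2.1
    obtain ⟨E, hE, -⟩ := existsUnique_latticeIsometry hP E₀ m
    obtain ⟨γ, hγ, -⟩ := key m 𝒩 hreg Tw E hTw hE
    exact (hSδ.isNeighbourhood_iff hδ).mpr fun i j => wrapGraph_fst (hγ.rule i j)
  · intro Tw E hTw hE
    obtain ⟨γ, hγ, hTE⟩ := key m 𝒩 hreg Tw E hTw hE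
    obtain ⟨Sw, -, hSw⟩ := hγ.right.exists_fca (bijective_of_fintype γ)
    refine ⟨Sw, fun a => ?_, hγ.isWrapping hSδ hSw hreg.2.2, fun S' hS' hn hw => ?_⟩
    · obtain ⟨a, rfl⟩ := toQL_surjective a
      rw [hTE, hE.coisometry_apply hP, hSw]
    · obtain ⟨δ', hδ', hSδ'⟩ := hS'.exists_restricts
      obtain ⟨γ', hSwγ', hγ'⟩ := hw.exists_isLocalWrapping hδ' hSδ'
        ((hSδ'.isNeighbourhood_iff hδ').mp hn)
      have : γ = γ' := AlgHom.ext fun a => toQL_injective (by rw [← hSw, hSwγ'])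
      subst this
      have := hγ'.eq hγ (by rw [Set.union_self]; exact hreg.2.2)
      subst this
      exact hSδ'.ext hSδ

end Main

end FermionicCA

end

open FermionicCA in
theorem mainTheorem1 {κ : Type} [Fintype κ] [DecidableEq κ] [Nonempty κ] (π : κ → ZMod 2)
    (s N : ℕ) [NeZero N]
    (T : QuasiLocal π (ZLattice s) ≃⋆ₐ[ℂ] QuasiLocal π (ZLattice s)) (hT : IsFCA T)
    (P : LocalAlgebra π (tile s N)) (hP : IsProjection P) :
    -- renormalisability is equivalent to the invariance of the projection on one regular wrapping
    (IsRenormalisable T P ↔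
      ∃ (m : ℕ) (_ : NeZero m), (∃ 𝒩, IsRegularWrapping N m (T ^ N) 𝒩) ∧
        ∃ Tw, IsWrapping (N * m) (T ^ N) Tw ∧
          Tw (productProjection m P) = productProjection m P) ∧
    -- on each regular wrapping: the wrapped evolution, its unitary, and the equivalent conditions
    (∀ (m : ℕ) [NeZero m], (∃ 𝒩, IsRegularWrapping N m (T ^ N) 𝒩) →
      (∃! Tw, IsWrapping (N * m) (T ^ N) Tw) ∧
      ∀ Tw, IsWrapping (N * m) (T ^ N) Tw →
        ((∀ O, productProjection m P * Tw O * productProjection m P =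
            Tw (productProjection m P * O * productProjection m P)) ↔
          Tw (productProjection m P) = productProjection m P) ∧
        (∃ U ∈ unitary (QuasiLocal π (Torus s (N * m))),
          (∃ p, U ∈ gradedPart π (Torus s (N * m)) p) ∧ ∀ O, Tw O = star U * O * U) ∧
        ∀ U ∈ unitary (QuasiLocal π (Torus s (N * m))), (∀ O, Tw O = star U * O * U) →
          (Tw (productProjection m P) = productProjection m P ↔
            U * productProjection m P = productProjection m P * U)) ∧
    -- the condition does not depend on the regular wrapping
    (∀ (m m' : ℕ) [NeZero m] [NeZero m'],
      (∃ 𝒩, IsRegularWrapping N m (T ^ N) 𝒩) → (∃ 𝒩, IsRegularWrapping N m' (T ^ N) 𝒩) →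
      ∀ Tw Tw', IsWrapping (N * m) (T ^ N) Tw → IsWrapping (N * m') (T ^ N) Tw' →
        (Tw (productProjection m P) = productProjection m P ↔
          Tw' (productProjection m' P) = productProjection m' P)) ∧
    -- the isometry on each torus
    (∀ (r : ℕ) (π' : Fin r → ZMod 2) (E₀ : TileIsometry P r π') (m : ℕ) [NeZero m],
      (∃! E, IsLatticeIsometry m E₀ E) ∧
      ∀ E, IsLatticeIsometry m E₀ E →
        (∀ O', coisometry m P E (E O') = O') ∧
        ∀ O, E (coisometry m P E O) = productProjection m P * O * productProjection m P) ∧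
    -- the renormalised automaton is the unique extension of the induced map
    (IsRenormalisable T P →
      ∀ (r : ℕ) (π' : Fin r → ZMod 2) (E₀ : TileIsometry P r π'),
        ∃ S, IsRenormalisation T E₀ S ∧ (∀ S', IsRenormalisation T E₀ S' → S' = S) ∧
          ∀ (m : ℕ) [NeZero m] (𝒩 : Finset (ZLattice s)), IsRegularWrapping N m (T ^ N) 𝒩 →
            IsNeighbourhood S (tileNeighbourhood N 𝒩) ∧
            ∀ Tw E, IsWrapping (N * m) (T ^ N) Tw → IsLatticeIsometry m E₀ E →
              ∃ Sw, (∀ O', Sw O' = coisometry m P E (Tw (E O'))) ∧ IsWrapping m S Sw ∧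
                ∀ S', IsFCA S' → IsNeighbourhood S' (tileNeighbourhood N 𝒩) →
                  IsWrapping m S' Sw → S' = S) := by
  have hTN : IsFCA (T ^ N) := hT.pow N
  obtain ⟨α, hα, hR⟩ := hTN.exists_restricts
  obtain ⟨𝒩₀, h𝒩₀⟩ := IsLocalCA.exists_neighbourhood α
  have hiff : ∀ (m : ℕ) [NeZero m], (∃ 𝒩, IsRegularWrapping N m (T ^ N) 𝒩) → ∀ Tw,
      IsWrapping (N * m) (T ^ N) Tw → (Tw (productProjection m P) = productProjection m P ↔
        IsLocallyInvariant α P (tileNeighbourhood N 𝒩₀)) := fun m _ ⟨𝒩, hreg⟩ Tw hTw =>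
    hTw.map_productProjection_iff hα hR hP h𝒩₀ hreg
  have hrenorm : IsRenormalisable T P → IsLocallyInvariant α P (tileNeighbourhood N 𝒩₀) := by
    rintro ⟨r, π', E₀, S, hS⟩
    exact hS.isLocallyInvariant hα hR hP h𝒩₀
  refine ⟨⟨fun h => ?_, ?_⟩, fun m _ hex => ⟨?_, fun Tw hTw => ⟨?_, ?_, fun U hU hTU => ?_⟩⟩,
    fun m m' _ _ h h' Tw Tw' hTw hTw' => ?_, fun r π' E₀ m _ => ⟨?_, fun E hE => ⟨?_, ?_⟩⟩,
    fun h r π' E₀ => ?_⟩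
  · obtain ⟨m, hm, hreg, -⟩ := exists_isRegularWrapping (N := N) hα hR h𝒩₀ ∅
    obtain ⟨Tw, hTw⟩ := exists_isWrapping hTN hreg.1 hreg.2.1
    exact ⟨m, hm, ⟨𝒩₀, hreg⟩, Tw, hTw, (hiff m ⟨𝒩₀, hreg⟩ Tw hTw).mpr (hrenorm h)⟩
  · rintro ⟨m, _, hex, Tw, hTw, hinv⟩
    obtain ⟨r, π', ⟨E₀⟩⟩ := exists_tileIsometry hP
    obtain ⟨S, hS, -⟩ := exists_isRenormalisation hα hR hP E₀ h𝒩₀ ((hiff m hex Tw hTw).mp hinv)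
    exact ⟨r, π', E₀, S, hS⟩
  · obtain ⟨𝒩, hreg⟩ := hex
    obtain ⟨Tw, hTw⟩ := exists_isWrapping hTN hreg.1 hreg.2.1
    exact ⟨Tw, hTw, fun Tw' hTw' => hTw'.unique hTN hTw hreg.1 hreg.2.1.injOn⟩
  · exact compression_comm_iff (productProjection_idem m hP)
  · exact exists_homogeneous_unitary hTw.1
  · exact map_eq_self_iff_commute hU hTU
  · rw [hiff m h Tw hTw, hiff m' h' Tw' hTw']
  · exact existsUnique_latticeIsometry hP E₀ m
  · exact hE.coisometry_apply hP
  · exact hE.apply_coisometry hP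
  · exact exists_isRenormalisation hα hR hP E₀ h𝒩₀ (hrenorm h)
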